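/- Work in Minkowski space $\mathbb R^{2,1}$ with $\langle x,y\rangle=x_0y_0+x_1y_1-x_2y_2$, and let $H^2=\{x:\langle x,x\rangle=-1,\ x_2>0\}$ be the hyperbolic plane. Let $p\subset H^2$ be a compact convex hyperbolic polygon with $n\ge 3$ vertices $v_1,\dots,v_n$ in cyclic order (all interior angles less than $\pi$) and edges $e_i=[v_i,v_{i+1}]$ (indices mod $n$). Let $e_i^*$ be the point dual to $e_i$ in de Sitter space, i.e. the vector with $\langle e_i^*,e_i^*\rangle=1$ that is orthogonal to $v_i$ and $v_{i+1}$ and points to the exterior of $p$ ($\langle e_i^*,v_j\rangle<0$ for $j\ne i,i+1$). Let $w_1,\dots,w_q$ ($q\ge 0$) be distinct points in the interior of $p$. Hyperbolic polygons with cone singularities at the $w_k$, near $p$, are described by a geodesic triangulation $T$ of $p$ with vertex set exactly $\{v_j\}\cup\{w_k\}$: such a polygon is obtained by replacing the triangles of $T$ by hyperbolic triangles whose edge lengths are positive, agree on common edges and satisfy the strict triangle inequalities. Its angle at $v_j$ is the sum of the angles at $v_j$ of the triangles containing $v_j$, and its curvature at $w_k$ is $2\pi$ minus the sum of the angles at $w_k$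 of the triangles containing $w_k$. A first-order deformation of $p$ is the derivative at $t=0$ of a one-parameter family of edge lengths of such polygons that starts, at $t=0$, at $p$ and is differentiable at $t=0$. It is called trivial if it is the first-order variation of the edge lengths obtained by moving the points $w_k$ inside the fixed polygon $p$ (so that the metric of $p$ does not change). **Theorem.** Such triangulations $T$ exist, and for each of them the following holds for all real numbers $l_1',\dots,l_n'$, $\alpha_1',\dots,\alpha_n'$, $\theta_1',\dots,\theta_q'$. There exists a first-order deformation of $p$ among hyperbolic polygons with cone singularities at the $w_k$ for which the first-order variation of the length of $e_i$ is $l_i'$, that of the interior angle at $v_j$ is $\alpha_j'$, and that of the curvature at $w_k$ is $\theta_k'$ (for all $i,j,k$) if and only if $$\sum_{i=1}^n l_i'\,e_i^*+\sum_{j=1}^n\alpha_j'\,v_j-\sum_{k=1}^q\theta_k'\,w_k=0 .$$ Such a deformation is then unique up to trivial deformations: if one first-order deformation has these variations, then another one has them if and only if the two differ by a trivial one. -/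

import Mathlib

open Filter Topology

noncomputable section

namespace HypPolygon

/-- Minkowski space of signature `(2,1)`; the third coordinate is the time coordinate. -/
abbrev Mink : Type := Fin 3 → ℝ

/-- The Minkowski bilinear form. -/
def mform (x y : Mink) : ℝ := x 0 * y 0 + x 1 * y 1 - x 2 * y 2

/-- The hyperbolic plane, as the upper sheet of the hyperboloid. -/
def hypPlane : Set Mink := {x | mform x x = -1 ∧ 0 < x 2}

/-- The hyperbolic distance: `cosh d(x, y) = - ⟨x, y⟩`. -/
def hdist (x y : Mink) : ℝ := Real.arcosh (-(mform x y))

/-- The geodesic convex hull, in the hyperbolic plane, of the points `pos a` for `a ∈ S`: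
the points of the hyperbolic plane that lie in the convex cone spanned by these points. -/
def geodesicHull {ι : Type*} (pos : ι → Mink) (S : Finset ι) : Set Mink :=
  {x | x ∈ hypPlane ∧ ∃ c : ι → ℝ, (∀ a ∈ S, 0 ≤ c a) ∧ x = ∑ a ∈ S, c a • pos a}

/-- The angle of a hyperbolic triangle between two sides of lengths `b` and `c`, opposite to a
side of length `a`, as given by the hyperbolic law of cosines. -/
def triangleAngle (a b c : ℝ) : ℝ :=
  Real.arccos ((Real.cosh b * Real.cosh c - Real.cosh a) / (Real.sinh b * Real.sinh c))

/-- A (compact, strictly) convex hyperbolic polygon with `n ≥ 3` vertices, numbered in cyclic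
order (the indices are taken modulo `n`). The `i`-th edge joins `vertex i` to `vertex (i + 1)`,
and the polygon lies on one side of the line through that edge, touching it along the edge only. -/
structure ConvexPolygon (n : ℕ) [NeZero n] where
  three_le : 3 ≤ n
  vertex : Fin n → Mink
  vertex_mem : ∀ i, vertex i ∈ hypPlane
  convex : ∀ i, ∃ u : Mink, mform u u = 1 ∧ mform u (vertex i) = 0 ∧
    mform u (vertex (i + 1)) = 0 ∧ ∀ j, j ≠ i → j ≠ i + 1 → mform u (vertex j) < 0

namespace ConvexPolygon

variable {n q : ℕ} [NeZero n]

/-- The point of de Sitter space dual to the `i`-th edge: the unit spacelike vector orthogonal to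
the edge and pointing to the exterior of the polygon. These properties determine it. -/
def edgeDual (P : ConvexPolygon n) (i : Fin n) : Mink := (P.convex i).choose

theorem edgeDual_spec (P : ConvexPolygon n) (i : Fin n) :
    mform (P.edgeDual i) (P.edgeDual i) = 1 ∧ mform (P.edgeDual i) (P.vertex i) = 0 ∧
      mform (P.edgeDual i) (P.vertex (i + 1)) = 0 ∧
      ∀ j, j ≠ i → j ≠ i + 1 → mform (P.edgeDual i) (P.vertex j) < 0 :=
  (P.convex i).choose_spec

/-- The polygon as a subset of the hyperbolic plane. -/
def carrier (P : ConvexPolygon n) : Set Mink := geodesicHull P.vertex Finset.univ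

/-- The interior of the polygon: the points strictly on the inner side of every edge. -/
def interior (P : ConvexPolygon n) : Set Mink :=
  {x | x ∈ hypPlane ∧ ∀ i, mform (P.edgeDual i) x < 0}

/-- The vertices of the polygon (`inl`) together with further points `w` (`inr`). -/
def marked (P : ConvexPolygon n) (w : Fin q → Mink) : Fin n ⊕ Fin q → Mink :=
  Sum.elim P.vertex w

end ConvexPolygon

/-- A geodesic triangulation of the polygon `P` whose vertices are exactly the vertices of `P` and
the points `w k`. A face is recorded by the set of its three vertices. -/
structure Triangulation {n q : ℕ} [NeZero n] (P : ConvexPolygon n) (w : Fin q → Mink) where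
  faces : Finset (Finset (Fin n ⊕ Fin q))
  card_eq : ∀ σ ∈ faces, σ.card = 3
  nondegenerate : ∀ σ ∈ faces, LinearIndependent ℝ (fun a : σ => P.marked w a)
  vertex_used : ∀ a, ∃ σ ∈ faces, a ∈ σ
  cover : ⋃ σ ∈ faces, geodesicHull (P.marked w) σ = P.carrier
  inter : ∀ σ ∈ faces, ∀ τ ∈ faces,
    geodesicHull (P.marked w) σ ∩ geodesicHull (P.marked w) τ = geodesicHull (P.marked w) (σ ∩ τ)

namespace Triangulation

variable {n q : ℕ} [NeZero n] {P : ConvexPolygon n} {w : Fin q → Mink}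

/-- `a` and `b` are the ends of an edge of the triangulation. -/
def Adj (T : Triangulation P w) (a b : Fin n ⊕ Fin q) : Prop :=
  a ≠ b ∧ ∃ σ ∈ T.faces, a ∈ σ ∧ b ∈ σ

/-- The edge lengths `ℓ` define a hyperbolic polygon with cone singularities, by gluing along
their common edges the hyperbolic triangles with these edge lengths: all lengths are positive and
the strict triangle inequalities hold in every face. Only the values of `ℓ` at edges matter. -/
def IsConeMetric (T : Triangulation P w) (ℓ : Sym2 (Fin n ⊕ Fin q) → ℝ) : Prop :=
  (∀ a b, T.Adj a b → 0 < ℓ s(a, b)) ∧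
    ∀ a b c, {a, b, c} ∈ T.faces → ℓ s(a, b) < ℓ s(a, c) + ℓ s(c, b)

/-- The total angle at `a`: the sum of the angles at `a` of all the triangles that contain `a`.
In the double sum each triangle `{a, b, c}` is counted twice, hence the factor `1/2`. -/
def totalAngle (T : Triangulation P w) (ℓ : Sym2 (Fin n ⊕ Fin q) → ℝ) (a : Fin n ⊕ Fin q) : ℝ :=
  (1 / 2 : ℝ) * ∑ b, ∑ c,
    if {a, b, c} ∈ T.faces then triangleAngle (ℓ s(b, c)) (ℓ s(a, b)) (ℓ s(a, c)) else 0

/-- The (interior) angle at the `j`-th vertex of the polygon with cone singularities. -/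
def vertexAngle (T : Triangulation P w) (ℓ : Sym2 (Fin n ⊕ Fin q) → ℝ) (j : Fin n) : ℝ :=
  T.totalAngle ℓ (Sum.inl j)

/-- The curvature at the `k`-th cone point: `2π` minus the total angle. -/
def curvature (T : Triangulation P w) (ℓ : Sym2 (Fin n ⊕ Fin q) → ℝ) (k : Fin q) : ℝ :=
  2 * Real.pi - T.totalAngle ℓ (Sum.inr k)

end Triangulation

/-- A one-parameter deformation of `P` among hyperbolic polygons with cone singularities at the
`w k`, with its first-order part. For every `t` near `0`, `length t` gives the edge lengths of
such a polygon; at `t = 0` they are those of the triangulated polygon `P` itself; and `velocity`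
is the derivative at `t = 0`. The first-order deformation is `velocity` on the edges; values of
`length t` and `velocity` at pairs that are not edges are irrelevant. -/
structure ConeDeformation {n q : ℕ} [NeZero n] {P : ConvexPolygon n} {w : Fin q → Mink}
    (T : Triangulation P w) where
  length : ℝ → Sym2 (Fin n ⊕ Fin q) → ℝ
  velocity : Sym2 (Fin n ⊕ Fin q) → ℝ
  length_zero : ∀ a b, T.Adj a b → length 0 s(a, b) = hdist (P.marked w a) (P.marked w b)
  isConeMetric : ∀ᶠ t in 𝓝 (0 : ℝ), T.IsConeMetric (length t)
  hasDerivAt : ∀ a b, T.Adj a b →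
    HasDerivAt (fun t => length t s(a, b)) (velocity s(a, b)) 0

namespace ConeDeformation

variable {n q : ℕ} [NeZero n] {P : ConvexPolygon n} {w : Fin q → Mink} {T : Triangulation P w}

/-- The first-order variations of the lengths of the edges of the polygon, of the angles at its
vertices and of the curvatures at the cone points are `l'`, `α'` and `θ'`. -/
def Realizes (D : ConeDeformation T) (l' α' : Fin n → ℝ) (θ' : Fin q → ℝ) : Prop :=
  (∀ i, HasDerivAt (fun t => D.length t s(Sum.inl i, Sum.inl (i + 1))) (l' i) 0) ∧
  (∀ j, HasDerivAt (fun t => T.vertexAngle (D.length t) j) (α' j) 0) ∧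
  (∀ k, HasDerivAt (fun t => T.curvature (D.length t) k) (θ' k) 0)

end ConeDeformation

/-- The variation `δ` of edge lengths is trivial: it comes from moving the marked points `w k`
inside the fixed polygon `P`, with its unchanged hyperbolic metric. -/
def Triangulation.IsTrivial {n q : ℕ} [NeZero n] {P : ConvexPolygon n} {w : Fin q → Mink}
    (T : Triangulation P w) (δ : Sym2 (Fin n ⊕ Fin q) → ℝ) : Prop :=
  ∃ c : ℝ → Fin q → Mink, c 0 = w ∧ (∀ t k, c t k ∈ hypPlane) ∧ DifferentiableAt ℝ c 0 ∧
    ∀ a b, T.Adj a b →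
      HasDerivAt (fun t => hdist (P.marked (c t) a) (P.marked (c t) b)) (δ s(a, b)) 0

end HypPolygon

end

open HypPolygon

/-! The inequalities that define a cone metric are open, so first-order deformations are arbitrary
real functions on the edges of `T`. Let V (`variations`) map such a function to the variations of
side lengths, angles and curvatures, and let B (`balance`) be the linear map whose vanishing is the
vector equation. The theorem says that range V = ker B and that ker V consists of the motions of the
w_k.

B ∘ V = 0 comes from single triangles: the angle variations times the vertices plus the length
variations times the dual points sum to zero (`angleVar_sum`, paired with a test vector). An
interior edge has opposite dual vectors in its two triangles, so only the sides of the polygon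
survive in the sum over `T` (`sum_mform_mul_totalAngleVar`).

For the converse, a linear functional that vanishes on range V has a coefficient at each marked
point, and on each triangle these are the products with one vector. Testing on the variation of a
single interior edge shows that the vectors of adjacent triangles agree, and strong connectivity
(`eq_of_forall_adjacent`) makes them all equal to some u (`exists_of_relation`). The functional is
then ⟨u, B(·)⟩, which vanishes on ker B (`exists_variations_eq`).

Motions of the w_k lie in ker V, because angle variations are differences of rotation speeds, which
cancel around a vertex (`totalAngleVar_lengthVar`). They form a space of dimension 2q by
infinitesimal rigidity (`motion_eq_zero`). As B is onto, dim ker V = |E| - (2n + q - 3), so the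
bound |E| ≤ 3q + 2n - 3 (`card_edges_le`) leaves no room for anything else.

Triangulations exist as lower hulls of generic heights (`nonempty_triangulation`). Throughout, a
geodesic triangle is treated as the simplicial cone over it, so that incidence is expressed by signs
of determinants. -/

noncomputable section

namespace HypPolygon

/-! ### The Minkowski form, determinants and the cross product -/

/-- The determinant of three vectors. -/
def det3 (a b c : Mink) : ℝ :=
  a 0 * (b 1 * c 2 - b 2 * c 1) - a 1 * (b 0 * c 2 - b 2 * c 0) + a 2 * (b 0 * c 1 - b 1 * c 0)

/-- The cross product for the Minkowski form. -/
def mcross (b c : Mink) : Mink :=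
  ![b 1 * c 2 - b 2 * c 1, b 2 * c 0 - b 0 * c 2, -(b 0 * c 1 - b 1 * c 0)]

theorem mform_comm (x y : Mink) : mform x y = mform y x := by unfold mform; ring

theorem mform_add_left (x y z : Mink) : mform (x + y) z = mform x z + mform y z := by
  simp only [mform, Pi.add_apply]; ring

theorem mform_add_right (x y z : Mink) : mform x (y + z) = mform x y + mform x z := by
  simp only [mform, Pi.add_apply]; ring

theorem mform_sub_left (x y z : Mink) : mform (x - y) z = mform x z - mform y z := by
  simp only [mform, Pi.sub_apply]; ring

theorem mform_sub_right (x y z : Mink) : mform x (y - z) = mform x y - mform x z := by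
  simp only [mform, Pi.sub_apply]; ring

theorem mform_smul_left (r : ℝ) (x y : Mink) : mform (r • x) y = r * mform x y := by
  simp only [mform, Pi.smul_apply, smul_eq_mul]; ring

theorem mform_smul_right (r : ℝ) (x y : Mink) : mform x (r • y) = r * mform x y := by
  simp only [mform, Pi.smul_apply, smul_eq_mul]; ring

@[simp] theorem mform_zero_left (x : Mink) : mform 0 x = 0 := by simp [mform]

@[simp] theorem mform_zero_right (x : Mink) : mform x 0 = 0 := by simp [mform]

theorem mform_neg_left (x y : Mink) : mform (-x) y = -mform x y := by
  simp only [mform, Pi.neg_apply]; ring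

theorem mform_neg_right (x y : Mink) : mform x (-y) = -mform x y := by
  simp only [mform, Pi.neg_apply]; ring

/-- The Minkowski form with its first argument fixed, as a linear map. -/
def mformL (x : Mink) : Mink →ₗ[ℝ] ℝ where
  toFun := mform x
  map_add' := mform_add_right x
  map_smul' r y := by simp [mform_smul_right]

@[simp] theorem mformL_apply (x y : Mink) : mformL x y = mform x y := rfl

theorem mform_sum_right {ι : Type*} (x : Mink) (S : Finset ι) (f : ι → Mink) :
    mform x (∑ i ∈ S, f i) = ∑ i ∈ S, mform x (f i) :=
  map_sum (mformL x) f S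

theorem mform_sum_left {ι : Type*} (x : Mink) (S : Finset ι) (f : ι → Mink) :
    mform (∑ i ∈ S, f i) x = ∑ i ∈ S, mform (f i) x := by
  simp only [mform_comm _ x, mform_sum_right]

theorem continuous_mform (x : Mink) : Continuous (mform x) := by unfold mform; fun_prop

theorem eq_zero_of_mform_eq_zero {x : Mink} (h : ∀ y, mform x y = 0) : x = 0 := by
  have h0 := h ![1, 0, 0]
  have h1 := h ![0, 1, 0]
  have h2 := h ![0, 0, 1]
  simp [mform] at h0 h1 h2
  ext i; fin_cases i <;> simp [*]

theorem mform_mcross (b c y : Mink) : mform (mcross b c) y = det3 b c y := by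
  simp [mform, mcross, det3]; ring

theorem mform_mcross_mcross (a b c d : Mink) : mform (mcross a b) (mcross c d) =
    mform a d * mform b c - mform a c * mform b d := by
  simp [mform, mcross]; ring

theorem det3_rotate (a b c : Mink) : det3 b c a = det3 a b c := by unfold det3; ring

theorem det3_rotate' (a b c : Mink) : det3 c a b = det3 a b c := by unfold det3; ring

theorem det3_swap (a b c : Mink) : det3 a c b = -det3 a b c := by unfold det3; ring

theorem det3_swap' (a b c : Mink) : det3 b a c = -det3 a b c := by unfold det3; ring

theorem det3_self_left (a b : Mink) : det3 a a b = 0 := by unfold det3; ring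

theorem det3_self_right (a b : Mink) : det3 a b b = 0 := by unfold det3; ring

theorem det3_self_mid (a b : Mink) : det3 a b a = 0 := by unfold det3; ring

theorem det3_add_right (a b c d : Mink) : det3 a b (c + d) = det3 a b c + det3 a b d := by
  simp only [det3, Pi.add_apply]; ring

theorem det3_smul_right (a b c : Mink) (r : ℝ) : det3 a b (r • c) = r * det3 a b c := by
  simp only [det3, Pi.smul_apply, smul_eq_mul]; ring

theorem continuous_det3_right (a b : Mink) : Continuous (det3 a b) := by unfold det3; fun_prop

/-- The product of two determinants as a Gram determinant. -/
theorem det3_mul_det3 (a b c x y z : Mink) : det3 a b c * det3 x y z =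
    -(mform a x * (mform b y * mform c z - mform b z * mform c y)
      - mform a y * (mform b x * mform c z - mform b z * mform c x)
      + mform a z * (mform b x * mform c y - mform b y * mform c x)) := by
  simp only [mform, det3]; ring

/-- Cramer's rule. -/
theorem cramer (a b c x : Mink) : det3 a b c • x =
    det3 b c x • a + det3 c a x • b + det3 a b x • c := by
  ext i; fin_cases i <;> simp [det3] <;> ring

theorem cramer' {a b c : Mink} (h : det3 a b c ≠ 0) (x : Mink) : x =
    (det3 b c x / det3 a b c) • a + (det3 c a x / det3 a b c) • b +
      (det3 a b x / det3 a b c) • c := by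
  have := congrArg (fun v => (det3 a b c)⁻¹ • v) (cramer a b c x)
  simp only [smul_add, smul_smul, inv_mul_cancel₀ h, one_smul] at this
  simpa only [div_eq_inv_mul] using this

theorem eq_zero_of_mform_triple {a b c x : Mink} (h : det3 a b c ≠ 0) (ha : mform x a = 0)
    (hb : mform x b = 0) (hc : mform x c = 0) : x = 0 := by
  refine eq_zero_of_mform_eq_zero fun y => ?_
  rw [cramer' h y]
  simp [mform_add_right, mform_smul_right, *]

theorem exists_mform_triple {a b c : Mink} (h : det3 a b c ≠ 0) (r s t : ℝ) :
    ∃ x, mform x a = r ∧ mform x b = s ∧ mform x c = t := by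
  refine ⟨(det3 a b c)⁻¹ • (r • mcross b c + s • mcross c a + t • mcross a b), ?_, ?_, ?_⟩ <;>
  · simp only [mform_add_left, mform_smul_left, mform_mcross, det3_self_mid,
      det3_self_right, det3_rotate a b c, det3_rotate' a b c]
    field_simp
    ring

/-- A vector orthogonal to `b` and `c` is a multiple of their cross product. -/
theorem eq_smul_mcross {a b c e : Mink} (h : det3 a b c ≠ 0) (hb : mform e b = 0)
    (hc : mform e c = 0) : e = (mform e a / det3 a b c) • mcross b c := by
  rw [← sub_eq_zero]
  apply eq_zero_of_mform_triple h <;>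
  simp [mform_sub_left, mform_smul_left, mform_mcross, det3_self_mid, det3_self_right,
    det3_rotate a b c, hb, hc, h]

theorem det3_ne_zero_of_linearIndependent {ι : Type*} {pos : ι → Mink} {σ : Finset ι}
    (h : LinearIndependent ℝ (fun a : σ => pos a)) {a b c : ι} (ha : a ∈ σ) (hb : b ∈ σ)
    (hc : c ∈ σ) (hab : a ≠ b) (hac : a ≠ c) (hbc : b ≠ c) :
    det3 (pos a) (pos b) (pos c) ≠ 0 := by
  have hinj : Function.Injective (![⟨a, ha⟩, ⟨b, hb⟩, ⟨c, hc⟩] : Fin 3 → σ) := by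
    intro i j hij
    fin_cases i <;> fin_cases j <;> simp_all
  have h2 := h.comp _ hinj
  have h3 : LinearIndependent ℝ (Matrix.row (Matrix.of ![pos a, pos b, pos c])) := by
    convert h2 using 1
    ext i j
    fin_cases i <;> rfl
  rw [Matrix.linearIndependent_rows_iff_isUnit, Matrix.isUnit_iff_isUnit_det, isUnit_iff_ne_zero,
    Matrix.det_fin_three] at h3
  intro h4
  apply h3
  simp [det3] at h4 ⊢
  linarith

/-! ### The hyperbolic plane and cones -/

/-- Reversed Cauchy–Schwarz: in terms of the horizontal parts u ≠ v it reduces to (1 + u·v)² < (1 +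
|u|²)(1 + |v|²). -/
theorem one_lt_neg_mform {a b : Mink} (ha : a ∈ hypPlane) (hb : b ∈ hypPlane) (hab : a ≠ b) :
    1 < -mform a b := by
  obtain ⟨ha1, ha2⟩ := ha
  obtain ⟨hb1, hb2⟩ := hb
  simp only [mform] at *
  have hne : a 0 ≠ b 0 ∨ a 1 ≠ b 1 := by
    by_contra! h
    apply hab
    have : a 2 = b 2 := by
      have : (a 2 - b 2) * (a 2 + b 2) = 0 := by
        obtain ⟨h0, h1⟩ := h
        rw [h0, h1] at ha1
        linarith
      rcases mul_eq_zero.1 this with h | h <;> linarith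
    ext i; fin_cases i <;> simp [*]
  have hpos : 0 < (a 0 - b 0) ^ 2 + (a 1 - b 1) ^ 2 := by
    rcases hne with h | h
    · have := sq_pos_of_ne_zero (sub_ne_zero.2 h); positivity
    · have := sq_pos_of_ne_zero (sub_ne_zero.2 h); positivity
  have hsq : (1 + a 0 * b 0 + a 1 * b 1) ^ 2 < (a 2 * b 2) ^ 2 := by
    have e1 : (a 2) ^ 2 = 1 + a 0 ^ 2 + a 1 ^ 2 := by linarith
    have e2 : (b 2) ^ 2 = 1 + b 0 ^ 2 + b 1 ^ 2 := by linarith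
    rw [mul_pow, e1, e2]
    have := sq_nonneg (a 0 * b 1 - a 1 * b 0)
    nlinarith
  have := abs_lt_of_sq_lt_sq hsq (by positivity)
  have := (abs_lt.1 this).2
  linarith

theorem one_le_neg_mform {a b : Mink} (ha : a ∈ hypPlane) (hb : b ∈ hypPlane) :
    1 ≤ -mform a b := by
  by_cases h : a = b
  · rw [← h, ha.1]; norm_num
  · exact (one_lt_neg_mform ha hb h).le

theorem mcross_ne_zero {a b : Mink} (ha : a ∈ hypPlane) (hb : b ∈ hypPlane) (hab : a ≠ b) :
    mcross a b ≠ 0 := by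
  intro h
  have h1 := mform_mcross_mcross a b a b
  rw [h, mform_zero_left, mform_comm b a, ha.1, hb.1] at h1
  have := one_lt_neg_mform ha hb hab
  nlinarith

/-- The convex cone spanned by the points `pos a`, `a ∈ S`. -/
def cone {ι : Type*} (pos : ι → Mink) (S : Finset ι) : Set Mink :=
  {x | ∃ c : ι → ℝ, (∀ a ∈ S, 0 ≤ c a) ∧ x = ∑ a ∈ S, c a • pos a}

theorem geodesicHull_eq {ι : Type*} (pos : ι → Mink) (S : Finset ι) :
    geodesicHull pos S = hypPlane ∩ cone pos S := rfl

section Cone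

variable {ι : Type*} {pos : ι → Mink} {S S' : Finset ι}

theorem smul_mem_cone {x : Mink} (hx : x ∈ cone pos S) {r : ℝ} (hr : 0 ≤ r) :
    r • x ∈ cone pos S := by
  obtain ⟨c, hc, rfl⟩ := hx
  exact ⟨fun a => r * c a, fun a ha => mul_nonneg hr (hc a ha), by
    simp [Finset.smul_sum, mul_smul]⟩

theorem add_mem_cone {x y : Mink} (hx : x ∈ cone pos S) (hy : y ∈ cone pos S) :
    x + y ∈ cone pos S := by
  obtain ⟨c, hc, rfl⟩ := hx
  obtain ⟨d, hd, rfl⟩ := hy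
  exact ⟨fun a => c a + d a, fun a ha => add_nonneg (hc a ha) (hd a ha), by
    simp [add_smul, Finset.sum_add_distrib]⟩

theorem mem_cone_self {a : ι} (ha : a ∈ S) : pos a ∈ cone pos S := by
  classical
  exact ⟨fun b => if b = a then 1 else 0, fun b _ => by dsimp only; split_ifs <;> norm_num, by
    simp [ite_smul, ha]⟩

theorem zero_mem_cone : (0 : Mink) ∈ cone pos S := ⟨0, by simp, by simp⟩

theorem cone_subset (h : ∀ a ∈ S, pos a ∈ cone pos S') : cone pos S ⊆ cone pos S' := by
  classical
  rintro x ⟨c, hc, rfl⟩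
  refine Finset.sum_induction (fun a => c a • pos a) (· ∈ cone pos S')
    (fun _ _ => add_mem_cone) zero_mem_cone fun a ha => smul_mem_cone (h a ha) (hc a ha)

theorem cone_mono (h : S ⊆ S') : cone pos S ⊆ cone pos S' :=
  cone_subset fun _ ha => mem_cone_self (h ha)

/-- Nonzero points of a cone over points of the hyperbolic plane project to this plane. -/
theorem exists_smul_mem_hypPlane (hpos : ∀ a ∈ S, pos a ∈ hypPlane) {x : Mink}
    (hx : x ∈ cone pos S) (hx0 : x ≠ 0) : ∃ r : ℝ, 0 < r ∧ r • x ∈ hypPlane := by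
  obtain ⟨c, hc, rfl⟩ := hx
  set x := ∑ a ∈ S, c a • pos a with hxd
  obtain ⟨b, hb, hcb⟩ : ∃ b ∈ S, c b ≠ 0 := by
    by_contra! h
    exact hx0 (Finset.sum_eq_zero fun a ha => by rw [h a ha, zero_smul])
  have hs : 0 < ∑ a ∈ S, c a :=
    Finset.sum_pos' hc ⟨b, hb, lt_of_le_of_ne (hc b hb) hcb.symm⟩
  -- Each generator pairs with `y` to at most -1, so `-mform x y` is at least the total weight.
  -- Taking the generators for `y` shows that `x` is timelike.
  have hb2 : ∀ y ∈ hypPlane, ∑ a ∈ S, c a ≤ -mform x y := by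
    intro y hy
    rw [hxd, mform_sum_left, ← Finset.sum_neg_distrib]
    refine Finset.sum_le_sum fun a ha => ?_
    rw [mform_smul_left]
    nlinarith [hc a ha, one_le_neg_mform (hpos a ha) hy]
  have hm : mform x x < 0 := by
    have : mform x x = ∑ a ∈ S, c a * mform x (pos a) := by
      conv_lhs => rw [hxd]
      rw [mform_sum_right]
      exact Finset.sum_congr rfl fun a _ => by rw [mform_smul_right]
    rw [this]
    refine Finset.sum_neg' (fun a ha => ?_) ⟨b, hb, ?_⟩
    · nlinarith [hc a ha, hb2 _ (hpos a ha)]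
    · have := lt_of_le_of_ne (hc b hb) hcb.symm
      nlinarith [hb2 _ (hpos b hb)]
  have h2 : 0 < x 2 := by
    rw [hxd, Finset.sum_apply]
    refine Finset.sum_pos' (fun a ha => ?_) ⟨b, hb, ?_⟩
    · exact mul_nonneg (hc a ha) (hpos a ha).2.le
    · exact mul_pos (lt_of_le_of_ne (hc b hb) hcb.symm) (hpos b hb).2
  have hr : 0 < (Real.sqrt (-mform x x))⁻¹ := inv_pos.2 (Real.sqrt_pos.2 (neg_pos.2 hm))
  refine ⟨(Real.sqrt (-mform x x))⁻¹, hr, ?_, mul_pos hr h2⟩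
  · rw [mform_smul_left, mform_smul_right, ← mul_assoc, ← mul_inv,
      Real.mul_self_sqrt (by linarith)]
    rw [inv_neg, neg_mul, inv_mul_cancel₀ hm.ne]

variable [DecidableEq ι]

/-- By Cramer's rule the three quotients are the coordinates of `x` in the basis. -/
theorem mem_cone_triple {a b c : ι} (h : det3 (pos a) (pos b) (pos c) ≠ 0) {x : Mink} :
    x ∈ cone pos {a, b, c} ↔ 0 ≤ det3 (pos b) (pos c) x / det3 (pos a) (pos b) (pos c) ∧
      0 ≤ det3 (pos c) (pos a) x / det3 (pos a) (pos b) (pos c) ∧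
      0 ≤ det3 (pos a) (pos b) x / det3 (pos a) (pos b) (pos c) := by
  have hab : a ≠ b := by rintro rfl; exact h (det3_self_left _ _)
  have hac : a ≠ c := by rintro rfl; exact h (det3_self_mid _ _)
  have hbc : b ≠ c := by rintro rfl; exact h (det3_self_right _ _)
  have hsum : ∀ f : ι → ℝ, ∑ x ∈ ({a, b, c} : Finset ι), f x • pos x =
      f a • pos a + (f b • pos b + f c • pos c) := fun f => by
    rw [Finset.sum_insert (by simp [hab, hac]), Finset.sum_insert (by simp [hbc]),
      Finset.sum_singleton]
  constructor
  · rintro ⟨f, hf, rfl⟩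
    rw [hsum]
    simp only [det3_add_right, det3_smul_right, det3_self_mid, det3_self_right, mul_zero, add_zero,
      zero_add, det3_rotate (pos a) (pos b) (pos c), det3_rotate' (pos a) (pos b) (pos c)]
    rw [mul_div_cancel_right₀ _ h, mul_div_cancel_right₀ _ h, mul_div_cancel_right₀ _ h]
    exact ⟨hf _ (by simp), hf _ (by simp), hf _ (by simp)⟩
  · rintro ⟨h1, h2, h3⟩
    rw [cramer' h x, add_assoc]
    refine add_mem_cone (smul_mem_cone (mem_cone_self (by simp)) h1)
      (add_mem_cone (smul_mem_cone (mem_cone_self (by simp)) h2)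
        (smul_mem_cone (mem_cone_self (by simp)) h3))

theorem isClosed_cone_triple {a b c : ι} (h : det3 (pos a) (pos b) (pos c) ≠ 0) :
    IsClosed (cone pos {a, b, c}) := by
  have : cone pos {a, b, c} = {x | 0 ≤ det3 (pos b) (pos c) x / det3 (pos a) (pos b) (pos c) ∧
      0 ≤ det3 (pos c) (pos a) x / det3 (pos a) (pos b) (pos c) ∧
      0 ≤ det3 (pos a) (pos b) x / det3 (pos a) (pos b) (pos c)} := by
    ext x; exact mem_cone_triple h
  rw [this]
  have hc : ∀ u v : Mink, IsClosed {x | 0 ≤ det3 u v x / det3 (pos a) (pos b) (pos c)} :=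
    fun u v => isClosed_le continuous_const ((continuous_det3_right u v).div_const _)
  exact (hc _ _).inter ((hc _ _).inter (hc _ _))

/-- A cone over some of the points `b`, `c` lies in the plane of these points. -/
theorem det3_eq_zero_of_mem_cone {b c : ι} {x : Mink} (hS : S ⊆ {b, c}) (hx : x ∈ cone pos S) :
    det3 (pos b) (pos c) x = 0 := by
  obtain ⟨f, -, rfl⟩ := hx
  rw [← mform_mcross, mform_sum_right]
  refine Finset.sum_eq_zero fun d hd => ?_
  rw [mform_smul_right, mform_mcross]
  have := hS hd
  simp only [Finset.mem_insert, Finset.mem_singleton] at this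
  rcases this with rfl | rfl
  · rw [det3_self_mid, mul_zero]
  · rw [det3_self_right, mul_zero]

end Cone

/-! ### First-order variations of hyperbolic triangles -/

/-- The first-order variation of the angle at `a` of the triangle with vertices `a`, `b`, `c`,
in terms of the variations `X`, `Y`, `Z` of the hyperbolic cosines of the lengths of the edges
`bc`, `ab` and `ac`. -/
def angleVar (a b c : Mink) (X Y Z : ℝ) : ℝ :=
  (X - (mform b c * mform a b + mform a c) * Y / (mform a b ^ 2 - 1)
    - (mform b c * mform a c + mform a b) * Z / (mform a c ^ 2 - 1)) / |det3 a b c|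

theorem det3_sq {a b c : Mink} (ha : mform a a = -1) (hb : mform b b = -1) (hc : mform c c = -1) :
    det3 a b c ^ 2 = 1 - 2 * mform a b * mform b c * mform a c - mform a b ^ 2 - mform b c ^ 2
      - mform a c ^ 2 := by
  rw [sq, det3_mul_det3, ha, hb, hc, mform_comm b a, mform_comm c a, mform_comm c b]
  ring

/-- Here `r` is the square root of the Gram determinant of the triangle, and the sine of the angle
is r / (sinh y sinh z). Its positivity makes `arccos` differentiable, and it is the denominator of
the derivative. -/
theorem hasDerivAt_triangleAngle_aux {x y z : ℝ → ℝ} {x' y' z' r : ℝ}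
    (hx : HasDerivAt x x' 0) (hy : HasDerivAt y y' 0) (hz : HasDerivAt z z' 0)
    (hy0 : 0 < y 0) (hz0 : 0 < z 0) (hr : 0 < r)
    (hD : r ^ 2 = 1 + 2 * Real.cosh (x 0) * Real.cosh (y 0) * Real.cosh (z 0)
      - Real.cosh (x 0) ^ 2 - Real.cosh (y 0) ^ 2 - Real.cosh (z 0) ^ 2) :
    HasDerivAt (fun t => triangleAngle (x t) (y t) (z t))
      ((Real.sinh (x 0) * x'
        - (Real.cosh (x 0) * Real.cosh (y 0) - Real.cosh (z 0)) * (Real.sinh (y 0) * y')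
            / (Real.cosh (y 0) ^ 2 - 1)
        - (Real.cosh (x 0) * Real.cosh (z 0) - Real.cosh (y 0)) * (Real.sinh (z 0) * z')
            / (Real.cosh (z 0) ^ 2 - 1)) / r) 0 := by
  have sy : 0 < Real.sinh (y 0) := Real.sinh_pos_iff.2 hy0
  have sz : 0 < Real.sinh (z 0) := Real.sinh_pos_iff.2 hz0
  have ey : Real.cosh (y 0) ^ 2 = Real.sinh (y 0) ^ 2 + 1 := Real.cosh_sq _
  have ez : Real.cosh (z 0) ^ 2 = Real.sinh (z 0) ^ 2 + 1 := Real.cosh_sq _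
  have hq : HasDerivAt (fun t => (Real.cosh (y t) * Real.cosh (z t) - Real.cosh (x t)) /
      (Real.sinh (y t) * Real.sinh (z t))) _ 0 :=
    ((hy.cosh.mul hz.cosh).sub hx.cosh).div (hy.sinh.mul hz.sinh) (mul_pos sy sz).ne'
  set q := (Real.cosh (y 0) * Real.cosh (z 0) - Real.cosh (x 0)) /
      (Real.sinh (y 0) * Real.sinh (z 0)) with hqd
  have h1 : 1 - q ^ 2 = (r / (Real.sinh (y 0) * Real.sinh (z 0))) ^ 2 := by
    rw [hqd, div_pow, div_pow, hD, eq_div_iff (by positivity), sub_mul,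
      div_mul_cancel₀ _ (by positivity)]
    linear_combination (-Real.sinh (z 0) ^ 2) * ey + (1 - Real.cosh (y 0) ^ 2) * ez
  have hpos : 0 < 1 - q ^ 2 := by rw [h1]; positivity
  have hs : √(1 - q ^ 2) = r / (Real.sinh (y 0) * Real.sinh (z 0)) := by
    rw [h1, Real.sqrt_sq (by positivity)]
  have hq1 : q ≠ -1 := by rintro h; rw [h] at hpos; norm_num at hpos
  have hq2 : q ≠ 1 := by rintro h; rw [h] at hpos; norm_num at hpos
  have := (Real.hasDerivAt_arccos hq1 hq2).comp (0 : ℝ) hq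
  refine this.congr_deriv ?_
  rw [hs]
  simp only [Pi.mul_apply, Pi.sub_apply]
  rw [show Real.cosh (y 0) ^ 2 - 1 = Real.sinh (y 0) ^ 2 by rw [ey]; ring,
    show Real.cosh (z 0) ^ 2 - 1 = Real.sinh (z 0) ^ 2 by rw [ez]; ring]
  field_simp
  linear_combination (Real.cosh (z 0) * Real.sinh (z 0) * y') * ey +
    (Real.cosh (y 0) * Real.sinh (y 0) * z') * ez

section Lengths

variable {a b c : Mink}

theorem hdist_comm (a b : Mink) : hdist a b = hdist b a := by
  unfold hdist; rw [mform_comm]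

theorem cosh_hdist (ha : a ∈ hypPlane) (hb : b ∈ hypPlane) :
    Real.cosh (hdist a b) = -mform a b :=
  Real.cosh_arcosh (one_le_neg_mform ha hb)

theorem hdist_pos (ha : a ∈ hypPlane) (hb : b ∈ hypPlane) (hab : a ≠ b) : 0 < hdist a b :=
  Real.arcosh_pos (one_lt_neg_mform ha hb hab)

theorem sinh_hdist (ha : a ∈ hypPlane) (hb : b ∈ hypPlane) :
    Real.sinh (hdist a b) = √(mform a b ^ 2 - 1) := by
  rw [hdist, Real.sinh_arcosh (one_le_neg_mform ha hb), neg_sq]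

theorem mform_sq_sub_one_pos (ha : a ∈ hypPlane) (hb : b ∈ hypPlane) (hab : a ≠ b) :
    0 < mform a b ^ 2 - 1 := by
  nlinarith [one_lt_neg_mform ha hb hab]

/-- The strict triangle inequality for the vertices of a nondegenerate triangle. -/
theorem hdist_lt_add (ha : a ∈ hypPlane) (hb : b ∈ hypPlane) (hc : c ∈ hypPlane)
    (h : det3 a b c ≠ 0) : hdist a b < hdist a c + hdist c b := by
  have hac : a ≠ c := by rintro rfl; exact h (det3_self_mid _ _)
  have hcb : c ≠ b := by rintro rfl; exact h (det3_self_right _ _)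
  have p1 := hdist_pos ha hc hac
  have p2 := hdist_pos hc hb hcb
  have key : Real.cosh (hdist a b) < Real.cosh (hdist a c + hdist c b) := by
    rw [Real.cosh_add, cosh_hdist ha hb, cosh_hdist ha hc, cosh_hdist hc hb]
    have e1 := Real.sinh_sq (hdist a c)
    have e2 := Real.sinh_sq (hdist c b)
    rw [cosh_hdist ha hc] at e1
    rw [cosh_hdist hc hb] at e2
    have s1 := Real.sinh_pos_iff.2 p1
    have s2 := Real.sinh_pos_iff.2 p2
    have hD := det3_sq ha.1 hb.1 hc.1
    have hD' : 0 < det3 a b c ^ 2 := by positivity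
    rw [mform_comm c b] at *
    -- This is the positivity of the Gram determinant, rearranged.
    have : (-mform a b - -mform a c * -mform b c) ^ 2 <
        (Real.sinh (hdist a c) * Real.sinh (hdist c b)) ^ 2 := by
      rw [mul_pow, e1, e2]
      nlinarith
    have := (abs_lt.1 (abs_lt_of_sq_lt_sq this (by positivity))).2
    linarith
  have p3 : 0 ≤ hdist a b := Real.arcosh_nonneg (one_le_neg_mform ha hb)
  rw [Real.cosh_lt_cosh, abs_of_nonneg p3, abs_of_pos (by positivity)] at key
  exact key

theorem hasDerivAt_triangleAngle {x y z : ℝ → ℝ} {x' y' z' : ℝ}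
    (ha : a ∈ hypPlane) (hb : b ∈ hypPlane) (hc : c ∈ hypPlane) (h : det3 a b c ≠ 0)
    (hx : HasDerivAt x x' 0) (hy : HasDerivAt y y' 0) (hz : HasDerivAt z z' 0)
    (hx0 : x 0 = hdist b c) (hy0 : y 0 = hdist a b) (hz0 : z 0 = hdist a c) :
    HasDerivAt (fun t => triangleAngle (x t) (y t) (z t))
      (angleVar a b c (Real.sinh (hdist b c) * x') (Real.sinh (hdist a b) * y')
        (Real.sinh (hdist a c) * z')) 0 := by
  have hab : a ≠ b := by rintro rfl; exact h (det3_self_left _ _)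
  have hac : a ≠ c := by rintro rfl; exact h (det3_self_mid _ _)
  have := hasDerivAt_triangleAngle_aux hx hy hz (r := |det3 a b c|)
    (by rw [hy0]; exact hdist_pos ha hb hab) (by rw [hz0]; exact hdist_pos ha hc hac)
    (abs_pos.2 h) (by
      rw [sq_abs, det3_sq ha.1 hb.1 hc.1, hx0, hy0, hz0, cosh_hdist ha hb, cosh_hdist ha hc,
        cosh_hdist hb hc]
      ring)
  refine this.congr_deriv ?_
  rw [hx0, hy0, hz0, cosh_hdist ha hb, cosh_hdist ha hc, cosh_hdist hb hc, angleVar]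
  ring

theorem hasDerivAt_hdist {p r : ℝ → Mink} {p' r' : Mink} (hp : HasDerivAt p p' 0)
    (hr : HasDerivAt r r' 0) (hp0 : p 0 ∈ hypPlane) (hr0 : r 0 ∈ hypPlane) (hne : p 0 ≠ r 0) :
    HasDerivAt (fun t => hdist (p t) (r t))
      ((Real.sinh (hdist (p 0) (r 0)))⁻¹ * -(mform p' (r 0) + mform (p 0) r')) 0 := by
  have hp' := fun i => (hasDerivAt_pi.1 hp i)
  have hr' := fun i => (hasDerivAt_pi.1 hr i)
  have hm : HasDerivAt (fun t => -(mform (p t) (r t))) (-(mform p' (r 0) + mform (p 0) r')) 0 := by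
    refine ((((hp' 0).mul (hr' 0)).add ((hp' 1).mul (hr' 1))).sub
      ((hp' 2).mul (hr' 2))).neg.congr_deriv ?_
    simp only [mform]
    ring
  have := (Real.hasDerivAt_arcosh (x := -(mform (p 0) (r 0)))
    (one_lt_neg_mform hp0 hr0 hne)).comp (0 : ℝ) hm
  refine this.congr_deriv ?_
  rw [sinh_hdist hp0 hr0, neg_sq]

/-- The three angle variations of a triangle, paired with a vector `u`. -/
theorem angleVar_sum (ha : a ∈ hypPlane) (hb : b ∈ hypPlane) (hc : c ∈ hypPlane)
    (h : det3 a b c ≠ 0) (X Y Z : ℝ) (u : Mink) :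
    mform u a * angleVar a b c X Z Y + mform u b * angleVar b c a Y X Z
      + mform u c * angleVar c a b Z Y X =
    det3 a b c / |det3 a b c| * (X * det3 b c u / (mform b c ^ 2 - 1)
      + Y * det3 c a u / (mform c a ^ 2 - 1) + Z * det3 a b u / (mform a b ^ 2 - 1)) := by
  have hab : a ≠ b := by rintro rfl; exact h (det3_self_left _ _)
  have hac : a ≠ c := by rintro rfl; exact h (det3_self_mid _ _)
  have hbc : b ≠ c := by rintro rfl; exact h (det3_self_right _ _)
  have p1 := (mform_sq_sub_one_pos ha hb hab).ne'
  have p2 := (mform_sq_sub_one_pos ha hc hac).ne'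
  have p3 := (mform_sq_sub_one_pos hb hc hbc).ne'
  have p4 := (abs_pos.2 h).ne'
  have e1 := det3_mul_det3 a b c b c u
  have e2 := det3_mul_det3 a b c c a u
  have e3 := det3_mul_det3 a b c a b u
  unfold angleVar
  rw [det3_rotate a b c, det3_rotate' a b c]
  rw [ha.1, hb.1, hc.1, mform_comm b a, mform_comm c b, mform_comm c a, mform_comm a u,
    mform_comm b u, mform_comm c u] at *
  -- Multiplication by the determinant of the triangle turns each determinant into a Gram
  -- determinant. What remains is a rational identity in the pairwise products.
  have e : ∀ S T U : ℝ, det3 a b c / |det3 a b c| * (X * S / (mform b c ^ 2 - 1)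
      + Y * T / (mform a c ^ 2 - 1) + Z * U / (mform a b ^ 2 - 1)) =
      (X * (det3 a b c * S) / (mform b c ^ 2 - 1) + Y * (det3 a b c * T) / (mform a c ^ 2 - 1)
        + Z * (det3 a b c * U) / (mform a b ^ 2 - 1)) / |det3 a b c| := by
    intro S T U; ring
  rw [e, e1, e2, e3]
  generalize |det3 a b c| = D at *
  generalize mform a b = r at *
  generalize mform a c = s at *
  generalize mform b c = t at *
  field_simp
  ring

/-- The rotation speed at `a` of the geodesic from `a` to `b`, when `a` and `b` move with
velocities `ξ` and `η`. -/
def rotationVar (a b ξ η : Mink) : ℝ :=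
  (det3 a b η + mform a b * det3 a b ξ) / (mform a b ^ 2 - 1)

/-- The variation of an angle when the vertices of the triangle move. -/
theorem angleVar_of_velocity (ha : a ∈ hypPlane) (hb : b ∈ hypPlane) (hc : c ∈ hypPlane)
    (h : det3 a b c ≠ 0) {ξ η ζ : Mink} (hξ : mform ξ a = 0) (hη : mform η b = 0)
    (hζ : mform ζ c = 0) :
    angleVar a b c (-(mform η c + mform b ζ)) (-(mform ξ b + mform a η))
      (-(mform ξ c + mform a ζ)) =
    det3 a b c / |det3 a b c| * (rotationVar a c ξ ζ - rotationVar a b ξ η) := by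
  have hab : a ≠ b := by rintro rfl; exact h (det3_self_left _ _)
  have hac : a ≠ c := by rintro rfl; exact h (det3_self_mid _ _)
  have p1 := (mform_sq_sub_one_pos ha hb hab).ne'
  have p2 := (mform_sq_sub_one_pos ha hc hac).ne'
  have p4 := (abs_pos.2 h).ne'
  have e1 := det3_mul_det3 a b c a b ξ
  have e2 := det3_mul_det3 a b c a b η
  have e3 := det3_mul_det3 a b c a c ξ
  have e4 := det3_mul_det3 a b c a c ζ
  unfold angleVar rotationVar
  rw [mform_comm] at hξ hη hζ
  rw [mform_comm η c, mform_comm ξ b, mform_comm ξ c]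
  rw [ha.1, hb.1, mform_comm b a, mform_comm c b, mform_comm c a, hξ] at e1
  rw [ha.1, hb.1, mform_comm b a, mform_comm c b, mform_comm c a, hη] at e2
  rw [ha.1, hc.1, mform_comm b a, mform_comm c a, hξ] at e3
  rw [ha.1, hc.1, mform_comm b a, mform_comm c a, hζ] at e4
  have e : ∀ S T U V : ℝ, det3 a b c / |det3 a b c| * ((S + mform a c * T) / (mform a c ^ 2 - 1)
      - (U + mform a b * V) / (mform a b ^ 2 - 1)) =
      ((det3 a b c * S + mform a c * (det3 a b c * T)) / (mform a c ^ 2 - 1)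
      - (det3 a b c * U + mform a b * (det3 a b c * V)) / (mform a b ^ 2 - 1)) / |det3 a b c| := by
    intro S T U V; ring
  rw [e, e1, e2, e3, e4]
  generalize |det3 a b c| = D at *
  generalize mform a b = r at *
  generalize mform a c = s at *
  generalize mform b c = t at *
  field_simp
  ring

end Lengths

/-! ### Convex polygons -/

section FinCycle

variable {n : ℕ} [NeZero n]

theorem fin_cycle_induction {p : Fin n → Prop} {i : Fin n} (hi : p i)
    (h : ∀ j, p j → p (j + 1)) (j : Fin n) : p j := by
  have key : ∀ k : ℕ, p (i + Fin.ofNat n k) := by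
    intro k
    induction k with
    | zero => simpa using hi
    | succ k ih =>
      have : i + Fin.ofNat n (k + 1) = i + Fin.ofNat n k + 1 := by
        rw [add_assoc]
        congr 1
        ext
        simp [Fin.val_add]
      rw [this]
      exact h _ ih
  have := key (j - i).val
  rwa [Fin.ofNat_val_eq_self, add_sub_cancel] at this

theorem fin_add_one_ne (hn : 3 ≤ n) (i : Fin n) : i + 1 ≠ i := by
  obtain ⟨m, rfl⟩ := Nat.exists_eq_add_of_le' hn
  intro h
  simp at h

theorem fin_add_two_ne (hn : 3 ≤ n) (i : Fin n) : i + 1 + 1 ≠ i := by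
  obtain ⟨m, rfl⟩ := Nat.exists_eq_add_of_le' hn
  intro h
  rw [add_assoc] at h
  have : (1 + 1 : Fin (m + 3)) = 0 := by simpa using h
  simp [Fin.ext_iff, Fin.val_add, Nat.mod_eq_of_lt (show 2 < m + 3 by omega)] at this

end FinCycle

namespace ConvexPolygon

variable {n q : ℕ} [NeZero n] (P : ConvexPolygon n) {w : Fin q → Mink}

theorem edgeDual_self (i : Fin n) : mform (P.edgeDual i) (P.edgeDual i) = 1 :=
  (P.edgeDual_spec i).1

@[simp] theorem edgeDual_left (i : Fin n) : mform (P.edgeDual i) (P.vertex i) = 0 :=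
  (P.edgeDual_spec i).2.1

@[simp] theorem edgeDual_right (i : Fin n) : mform (P.edgeDual i) (P.vertex (i + 1)) = 0 :=
  (P.edgeDual_spec i).2.2.1

theorem edgeDual_neg {i j : Fin n} (h1 : j ≠ i) (h2 : j ≠ i + 1) :
    mform (P.edgeDual i) (P.vertex j) < 0 :=
  (P.edgeDual_spec i).2.2.2 j h1 h2

theorem vertex_injective : Function.Injective P.vertex := by
  intro i j hij
  by_contra h
  by_cases h2 : j = i + 1
  · subst h2
    have h3 := P.edgeDual_neg (fin_add_one_ne P.three_le i).symm
      (fin_add_two_ne P.three_le i).symm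
    rw [hij, edgeDual_left] at h3
    exact h3.false
  · have h3 := P.edgeDual_neg (Ne.symm h) h2
    rw [← hij, edgeDual_left] at h3
    exact h3.false

theorem vertex_ne_succ (i : Fin n) : P.vertex i ≠ P.vertex (i + 1) := fun h =>
  fin_add_one_ne P.three_le i (P.vertex_injective h).symm

/-- The sign that describes whether the vertices are numbered counterclockwise. -/
theorem exists_orientation : ∃ s : ℝ, (s = 1 ∨ s = -1) ∧ ∀ i j, j ≠ i → j ≠ i + 1 →
    0 < s * det3 (P.vertex i) (P.vertex (i + 1)) (P.vertex j) := by
  set τ : Fin n → ℝ := fun i => -det3 (P.vertex i) (P.vertex (i + 1)) (P.edgeDual i) with hτ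
  -- By the Gram formula, det(v_i, v_{i+1}, e_i^*) det(v_i, v_{i+1}, v_j) = (⟨v_i, v_{i+1}⟩² - 1)
  -- ⟨e_i^*, v_j⟩, which is negative.
  have h1 : ∀ i j, j ≠ i → j ≠ i + 1 →
      0 < τ i * det3 (P.vertex i) (P.vertex (i + 1)) (P.vertex j) := by
    intro i j hi hj
    have e := det3_mul_det3 (P.vertex i) (P.vertex (i + 1)) (P.edgeDual i)
      (P.vertex i) (P.vertex (i + 1)) (P.vertex j)
    rw [edgeDual_left, edgeDual_right, (P.vertex_mem _).1, (P.vertex_mem _).1,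
      mform_comm (P.vertex (i + 1)) (P.vertex i)] at e
    have e1 := mform_sq_sub_one_pos (P.vertex_mem i) (P.vertex_mem (i + 1)) (P.vertex_ne_succ i)
    have e2 := P.edgeDual_neg hi hj
    simp only [hτ]
    nlinarith
  have h2 : ∀ i, 0 < τ 0 * τ i := by
    refine fin_cycle_induction (i := 0) ?_ ?_
    · have := h1 0 (0 + 1 + 1) (fin_add_two_ne P.three_le 0) (fin_add_one_ne P.three_le _)
      have h0 : τ 0 ≠ 0 := by rintro h; rw [h] at this; simp at this
      exact mul_self_pos.2 h0
    -- Edges j and j+1 share the triple v_j, v_{j+1}, v_{j+2}, whose determinant carries the sign of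
    -- `τ` from one to the other.
    · intro j hj
      have e1 := h1 j (j + 1 + 1) (fin_add_two_ne P.three_le j) (fin_add_one_ne P.three_le _)
      have e2 := h1 (j + 1) j (fin_add_one_ne P.three_le j).symm (fin_add_two_ne P.three_le j).symm
      rw [det3_rotate] at e2
      set D := det3 (P.vertex j) (P.vertex (j + 1)) (P.vertex (j + 1 + 1))
      have e3 : 0 < (τ 0 * τ (j + 1)) * (τ j * D) ^ 2 := by
        calc 0 < (τ 0 * τ j) * (τ (j + 1) * D) * (τ j * D) := by positivity
          _ = _ := by ring
      exact pos_of_mul_pos_left e3 (by positivity)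
  rcases lt_or_ge 0 (τ 0) with h0 | h0
  · refine ⟨1, Or.inl rfl, fun i j hi hj => ?_⟩
    have := pos_of_mul_pos_right (h2 i) h0.le
    rw [one_mul]
    exact pos_of_mul_pos_right (h1 i j hi hj) this.le
  · refine ⟨-1, Or.inr rfl, fun i j hi hj => ?_⟩
    have h3 := h1 i j hi hj
    have h4 := neg_of_mul_pos_right (h2 i) h0
    linarith [neg_of_mul_pos_right h3 h4.le]

/-- The orientation of the polygon. -/
def orientation : ℝ := P.exists_orientation.choose

theorem orientation_sq : P.orientation ^ 2 = 1 := by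
  rcases P.exists_orientation.choose_spec.1 with h | h <;> rw [orientation, h] <;> norm_num

theorem orientation_pos {i j : Fin n} (h1 : j ≠ i) (h2 : j ≠ i + 1) :
    0 < P.orientation * det3 (P.vertex i) (P.vertex (i + 1)) (P.vertex j) :=
  P.exists_orientation.choose_spec.2 i j h1 h2

theorem det3_vertex_ne_zero {i j : Fin n} (h1 : j ≠ i) (h2 : j ≠ i + 1) :
    det3 (P.vertex i) (P.vertex (i + 1)) (P.vertex j) ≠ 0 :=
  right_ne_zero_of_mul (P.orientation_pos h1 h2).ne'

theorem exists_det3_vertex_ne_zero :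
    ∃ i j k, det3 (P.vertex i) (P.vertex j) (P.vertex k) ≠ 0 :=
  ⟨0, 0 + 1, 0 + 1 + 1, P.det3_vertex_ne_zero (fin_add_two_ne P.three_le 0)
    (fin_add_one_ne P.three_le _)⟩

/-- Orthogonality to the edge gives proportionality, the unit norm fixes the factor up to sign, and
the orientation fixes the sign. Pairings with dual points thus become determinants. -/
theorem edgeDual_eq (i : Fin n) : P.edgeDual i =
    (-P.orientation / √(mform (P.vertex i) (P.vertex (i + 1)) ^ 2 - 1)) •
      mcross (P.vertex i) (P.vertex (i + 1)) := by
  have h2 := fin_add_two_ne P.three_le i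
  have h1 := fin_add_one_ne P.three_le (i + 1)
  have hd : det3 (P.vertex (i + 1 + 1)) (P.vertex i) (P.vertex (i + 1)) ≠ 0 := by
    rw [det3_rotate']; exact P.det3_vertex_ne_zero h2 h1
  have hp := P.orientation_pos h2 h1
  have hneg := P.edgeDual_neg h2 h1
  have e := eq_smul_mcross hd (P.edgeDual_left i) (P.edgeDual_right i)
  rw [det3_rotate'] at e hd
  set κ := mform (P.edgeDual i) (P.vertex (i + 1 + 1)) /
    det3 (P.vertex i) (P.vertex (i + 1)) (P.vertex (i + 1 + 1)) with hκ
  have hg := mform_sq_sub_one_pos (P.vertex_mem i) (P.vertex_mem (i + 1)) (P.vertex_ne_succ i)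
  set g := mform (P.vertex i) (P.vertex (i + 1)) ^ 2 - 1 with hgd
  have h1' : κ ^ 2 * g = 1 := by
    rw [← P.edgeDual_self i, e, mform_smul_left, mform_smul_right, mform_mcross_mcross,
      (P.vertex_mem _).1, (P.vertex_mem _).1, mform_comm (P.vertex (i + 1))]
    ring
  have hs := P.orientation_sq
  have hκneg : P.orientation * κ < 0 := by
    have : κ * det3 (P.vertex i) (P.vertex (i + 1)) (P.vertex (i + 1 + 1)) < 0 := by
      rw [hκ, div_mul_cancel₀ _ hd]; exact hneg
    nlinarith
  rw [e]
  congr 1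
  rw [eq_div_iff (Real.sqrt_pos.2 hg).ne']
  have hsq : (P.orientation * κ * √g) ^ 2 = 1 := by
    rw [mul_pow, mul_pow, hs, Real.sq_sqrt hg.le, one_mul, h1']
  have : P.orientation * κ * √g = -1 := by
    have hneg' : P.orientation * κ * √g < 0 := mul_neg_of_neg_of_pos hκneg (Real.sqrt_pos.2 hg)
    rcases sq_eq_one_iff.1 hsq with h | h
    · linarith
    · exact h
  linear_combination P.orientation * this - (κ * √g) * hs

theorem mform_edgeDual (i : Fin n) (x : Mink) : mform (P.edgeDual i) x =
    -(P.orientation * det3 (P.vertex i) (P.vertex (i + 1)) x) /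
      √(mform (P.vertex i) (P.vertex (i + 1)) ^ 2 - 1) := by
  conv_lhs => rw [edgeDual_eq, mform_smul_left, mform_mcross]
  ring

theorem sqrt_edge_pos (i : Fin n) : 0 < √(mform (P.vertex i) (P.vertex (i + 1)) ^ 2 - 1) :=
  Real.sqrt_pos.2
    (mform_sq_sub_one_pos (P.vertex_mem i) (P.vertex_mem (i + 1)) (P.vertex_ne_succ i))

theorem mform_edgeDual_nonpos_iff {i : Fin n} {x : Mink} : mform (P.edgeDual i) x ≤ 0 ↔
    0 ≤ P.orientation * det3 (P.vertex i) (P.vertex (i + 1)) x := by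
  rw [mform_edgeDual, neg_div, neg_nonpos]
  rw [le_div_iff₀ (P.sqrt_edge_pos i), zero_mul]

/-- A point on the inner side of all edges is a nonnegative combination of the vertices. -/
theorem mem_cone_vertex {x : Mink} (hx : ∀ i, mform (P.edgeDual i) x ≤ 0) :
    x ∈ cone P.vertex Finset.univ := by
  simp only [mform_edgeDual_nonpos_iff] at hx
  set s := P.orientation with hs
  set v : ℕ → Mink := fun k => P.vertex (Fin.ofNat n k) with hv
  have hsucc : ∀ k, Fin.ofNat n (k + 1) = Fin.ofNat n k + 1 := by
    intro k; ext; simp [Fin.val_add]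
  have hn := P.three_le
  have hv0 : ∀ k, v k = P.vertex (Fin.ofNat n k) := fun _ => rfl
  have hnn : Fin.ofNat n (n - 1) + 1 = 0 := by
    rw [← hsucc, Nat.sub_add_cancel (by omega)]; ext; simp
  have h00 : Fin.ofNat n 0 = 0 := by ext; simp
  have h1 : 0 ≤ s * det3 (v 0) (v 1) x := by
    have := hx (Fin.ofNat n 0)
    rwa [← hsucc] at this
  have hlast : s * det3 (v 0) (v (n - 1)) x ≤ 0 := by
    have := hx (Fin.ofNat n (n - 1))
    rw [hnn, ← h00, ← hv0, ← hv0, det3_swap'] at this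
    linarith
  -- The polygon is a fan of triangles at v_0. The side of `x` relative to v_0 v_k is nonnegative at
  -- k = 1 and nonpositive at k = n - 1, so it changes across some triangle v_0 v_k v_{k+1}.
  obtain ⟨k, hk1, hk2, hk3, hk4⟩ : ∃ k, 1 ≤ k ∧ k + 1 ≤ n - 1 ∧ 0 ≤ s * det3 (v 0) (v k) x ∧
      s * det3 (v 0) (v (k + 1)) x ≤ 0 := by
    by_contra! hcon
    have : ∀ m, 1 ≤ m → m ≤ n - 2 → 0 ≤ s * det3 (v 0) (v m) x := by
      intro m hm
      induction m, hm using Nat.le_induction with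
      | base => exact fun _ => h1
      | succ m hm ih => exact fun h => (hcon m hm (by omega) (ih (by omega))).le
    have h3 := hcon (n - 2) (by omega) (by omega) (this (n - 2) (by omega) le_rfl)
    rw [show n - 2 + 1 = n - 1 by omega] at h3
    linarith
  have hne1 : (Fin.ofNat n 0) ≠ Fin.ofNat n k := by
    intro h
    have := congrArg Fin.val h
    simp [Nat.mod_eq_of_lt (show k < n by omega)] at this
    omega
  have hne2 : (Fin.ofNat n 0) ≠ Fin.ofNat n k + 1 := by
    rw [← hsucc]
    intro h
    have := congrArg Fin.val h
    simp [Nat.mod_eq_of_lt (show k + 1 < n by omega)] at this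
  have hD := P.orientation_pos hne1 hne2
  rw [← hsucc, ← hv0, ← hv0, ← hv0, det3_rotate, ← hs] at hD
  have hxk := hx (Fin.ofNat n k)
  rw [← hsucc, ← hv0, ← hv0] at hxk
  have hD0 := right_ne_zero_of_mul hD.ne'
  have hs1 : s ^ 2 = 1 := P.orientation_sq
  have hs0 : s ≠ 0 := left_ne_zero_of_mul hD.ne'
  have hdiv : ∀ r, 0 ≤ s * r → 0 ≤ r / det3 (v 0) (v k) (v (k + 1)) := by
    intro r hr
    rw [← mul_div_mul_left _ _ hs0]
    exact div_nonneg hr hD.le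
  rw [cramer' hD0 x]
  refine add_mem_cone (add_mem_cone ?_ ?_) ?_
  · exact smul_mem_cone (mem_cone_self (Finset.mem_univ _)) (hdiv _ hxk)
  · refine smul_mem_cone (mem_cone_self (Finset.mem_univ _)) (hdiv _ ?_)
    rw [det3_swap']
    linarith
  · exact smul_mem_cone (mem_cone_self (Finset.mem_univ _)) (hdiv _ hk3)

theorem mform_edgeDual_vertex_nonpos (i j : Fin n) : mform (P.edgeDual i) (P.vertex j) ≤ 0 := by
  by_cases h1 : j = i
  · rw [h1, edgeDual_left]
  · by_cases h2 : j = i + 1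
    · rw [h2, edgeDual_right]
    · exact (P.edgeDual_neg h1 h2).le

theorem mform_edgeDual_nonpos_of_mem_cone {ι : Type*} {pos : ι → Mink} {S : Finset ι} {i : Fin n}
    (h : ∀ a ∈ S, mform (P.edgeDual i) (pos a) ≤ 0) {x : Mink} (hx : x ∈ cone pos S) :
    mform (P.edgeDual i) x ≤ 0 := by
  obtain ⟨c, hc, rfl⟩ := hx
  rw [mform_sum_right]
  refine Finset.sum_nonpos fun a ha => ?_
  rw [mform_smul_right]
  exact mul_nonpos_of_nonneg_of_nonpos (hc a ha) (h a ha)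

theorem mem_carrier_iff {x : Mink} :
    x ∈ P.carrier ↔ x ∈ hypPlane ∧ ∀ i, mform (P.edgeDual i) x ≤ 0 := by
  rw [carrier, geodesicHull_eq]
  exact and_congr_right fun _ => ⟨fun h i => P.mform_edgeDual_nonpos_of_mem_cone
    (fun a _ => P.mform_edgeDual_vertex_nonpos i a) h, P.mem_cone_vertex⟩

@[simp] theorem marked_inl (j : Fin n) : P.marked w (Sum.inl j) = P.vertex j := rfl

@[simp] theorem marked_inr (k : Fin q) : P.marked w (Sum.inr k) = w k := rfl

variable (hw : ∀ k, w k ∈ P.interior)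
include hw

theorem marked_mem (a : Fin n ⊕ Fin q) : P.marked w a ∈ hypPlane := by
  rcases a with j | k
  · exact P.vertex_mem j
  · exact (hw k).1

theorem mform_edgeDual_marked_nonpos (i : Fin n) (a : Fin n ⊕ Fin q) :
    mform (P.edgeDual i) (P.marked w a) ≤ 0 := by
  rcases a with j | k
  · exact P.mform_edgeDual_vertex_nonpos i j
  · exact ((hw k).2 i).le

theorem mform_edgeDual_marked_eq_zero {i : Fin n} {a : Fin n ⊕ Fin q}
    (h : mform (P.edgeDual i) (P.marked w a) = 0) : a = Sum.inl i ∨ a = Sum.inl (i + 1) := by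
  rcases a with j | k
  · by_contra! hne
    exact (P.edgeDual_neg (i := i) (j := j) (by simpa using hne.1) (by simpa using hne.2)).ne h
  · exact absurd h ((hw k).2 i).ne

theorem marked_injective (hinj : Function.Injective w) : Function.Injective (P.marked w) := by
  rintro (i | k) (j | l) h
  · rw [P.vertex_injective h]
  · have := (hw l).2 i
    rw [← P.marked_inr (w := w), ← h, marked_inl, edgeDual_left] at this
    exact absurd this (lt_irrefl _)
  · have := (hw k).2 j
    rw [← P.marked_inr (w := w), h, marked_inl, edgeDual_left] at this
    exact absurd this (lt_irrefl _)
  · rw [hinj h]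

end ConvexPolygon

/-! ### The local structure of a triangulation -/

section Triple

variable {ι : Type*} [DecidableEq ι] {a b c : ι}

theorem face_rotate : ({b, c, a} : Finset ι) = {a, b, c} := by
  ext x; simp only [Finset.mem_insert, Finset.mem_singleton]; tauto

theorem face_swap : ({a, c, b} : Finset ι) = {a, b, c} := by
  ext x; simp only [Finset.mem_insert, Finset.mem_singleton]; tauto

theorem mem_cone_pair_add (pos : ι → Mink) {ε : ℝ} (hε : 0 ≤ ε) :
    pos b + pos c + ε • pos a ∈ cone pos {a, b, c} :=
  add_mem_cone (add_mem_cone (mem_cone_self (by simp)) (mem_cone_self (by simp)))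
    (smul_mem_cone (mem_cone_self (by simp)) hε)

end Triple

namespace Triangulation

variable {n q : ℕ} [NeZero n] {P : ConvexPolygon n} {w : Fin q → Mink} (T : Triangulation P w)

section Faces

variable {a b c d : Fin n ⊕ Fin q} {σ τ : Finset (Fin n ⊕ Fin q)}

theorem ne_of_mem (h : {a, b, c} ∈ T.faces) : a ≠ b ∧ a ≠ c ∧ b ≠ c := by
  have := T.card_eq _ h
  refine ⟨?_, ?_, ?_⟩ <;> rintro rfl
  · have h2 := Finset.card_le_two (a := a) (b := c)
    simp at this; omega
  · have h2 := Finset.card_le_two (a := b) (b := a)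
    rw [Finset.insert_comm] at this; simp at this; omega
  · have h2 := Finset.card_le_two (a := a) (b := b)
    simp at this; omega

theorem exists_eq_triple (h : σ ∈ T.faces) : ∃ a b c, σ = {a, b, c} := by
  obtain ⟨a, b, c, -, -, -, h⟩ := Finset.card_eq_three.1 (T.card_eq σ h)
  exact ⟨a, b, c, h⟩

theorem exists_eq_insert (h : σ ∈ T.faces) (ha : a ∈ σ) (hb : b ∈ σ) (hab : a ≠ b) :
    ∃ c, σ = {c, a, b} := by
  have h1 : ({a, b} : Finset (Fin n ⊕ Fin q)) ⊆ σ := by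
    intro x hx
    simp only [Finset.mem_insert, Finset.mem_singleton] at hx
    rcases hx with rfl | rfl <;> assumption
  obtain ⟨c, hc⟩ : ∃ c, σ \ {a, b} = {c} := by
    rw [← Finset.card_eq_one, Finset.card_sdiff_of_subset h1, T.card_eq σ h,
      Finset.card_pair hab]
  refine ⟨c, ?_⟩
  rw [← Finset.sdiff_union_of_subset h1, hc]
  rfl

theorem det3_ne_zero (h : {a, b, c} ∈ T.faces) :
    det3 (P.marked w a) (P.marked w b) (P.marked w c) ≠ 0 := by
  obtain ⟨h1, h2, h3⟩ := T.ne_of_mem h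
  exact det3_ne_zero_of_linearIndependent (T.nondegenerate _ h) (by simp) (by simp) (by simp)
    h1 h2 h3

theorem isClosed_cone (h : σ ∈ T.faces) : IsClosed (cone (P.marked w) σ) := by
  obtain ⟨a, b, c, rfl⟩ := T.exists_eq_triple h
  exact isClosed_cone_triple (T.det3_ne_zero h)

theorem faces_nonempty : T.faces.Nonempty := by
  obtain ⟨σ, h, -⟩ := T.vertex_used (Sum.inl 0)
  exact ⟨σ, h⟩

/-- Homogeneity extends the covering axiom from the hyperbolic plane to the whole cone, so that sums
such as `p b + p c` can serve as midpoints without normalization. -/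
theorem exists_face_mem_cone {x : Mink} (hx : ∀ i, mform (P.edgeDual i) x ≤ 0) :
    ∃ σ ∈ T.faces, x ∈ cone (P.marked w) σ := by
  by_cases hx0 : x = 0
  · obtain ⟨σ, h⟩ := T.faces_nonempty
    exact ⟨σ, h, hx0 ▸ zero_mem_cone⟩
  · obtain ⟨r, hr, hrx⟩ := exists_smul_mem_hypPlane (fun a _ => P.vertex_mem a)
      (P.mem_cone_vertex hx) hx0
    have : r • x ∈ P.carrier := P.mem_carrier_iff.2 ⟨hrx, fun i => by
      rw [mform_smul_right]; exact mul_nonpos_of_nonneg_of_nonpos hr.le (hx i)⟩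
    rw [← T.cover] at this
    simp only [Set.mem_iUnion] at this
    obtain ⟨σ, hσ, h⟩ := this
    refine ⟨σ, hσ, ?_⟩
    have := smul_mem_cone h.2 (inv_nonneg.2 hr.le)
    rwa [smul_smul, inv_mul_cancel₀ hr.ne', one_smul] at this

/-- The face that one enters when leaving `m` in the direction of `y`. -/
theorem exists_face_near {m y : Mink}
    (h : ∀ᶠ ε in 𝓝[>] (0 : ℝ), ∀ i, mform (P.edgeDual i) (m + ε • y) ≤ 0) :
    ∃ τ ∈ T.faces, m ∈ cone (P.marked w) τ ∧
      ∃ᶠ ε in 𝓝[>] (0 : ℝ), m + ε • y ∈ cone (P.marked w) τ := by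
  -- There are finitely many faces, so one of them is met for arbitrarily small ε; being closed, its
  -- cone then contains `m`.
  obtain ⟨τ, hτ, hf⟩ : ∃ τ ∈ T.faces,
      ∃ᶠ ε in 𝓝[>] (0 : ℝ), m + ε • y ∈ cone (P.marked w) τ := by
    by_contra! hcon
    have := (Filter.eventually_all_finset T.faces).2 hcon
    obtain ⟨ε, h1, h2⟩ := (h.and this).exists
    obtain ⟨σ, hσ, h3⟩ := T.exists_face_mem_cone h1
    exact h2 σ hσ h3
  refine ⟨τ, hτ, ?_, hf⟩
  have hcont : Tendsto (fun ε : ℝ => m + ε • y) (𝓝[>] 0) (𝓝 m) := by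
    have : Continuous fun ε : ℝ => m + ε • y := by fun_prop
    have := this.tendsto 0
    simp only [zero_smul, add_zero] at this
    exact this.mono_left nhdsWithin_le_nhds
  exact (T.isClosed_cone hτ).mem_of_frequently_of_tendsto hf hcont

variable (hw : ∀ k, w k ∈ P.interior)
include hw

theorem nonpos_of_mem_cone {x : Mink} (hx : x ∈ cone (P.marked w) σ) (i : Fin n) :
    mform (P.edgeDual i) x ≤ 0 :=
  P.mform_edgeDual_nonpos_of_mem_cone (fun a _ => P.mform_edgeDual_marked_nonpos hw i a) hx

theorem cone_inter (hσ : σ ∈ T.faces) (hτ : τ ∈ T.faces) {x : Mink}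
    (h1 : x ∈ cone (P.marked w) σ) (h2 : x ∈ cone (P.marked w) τ) :
    x ∈ cone (P.marked w) (σ ∩ τ) := by
  by_cases hx0 : x = 0
  · exact hx0 ▸ zero_mem_cone
  · obtain ⟨r, hr, hrx⟩ := exists_smul_mem_hypPlane (fun a _ => P.marked_mem hw a) h1 hx0
    have : r • x ∈ geodesicHull (P.marked w) σ ∩ geodesicHull (P.marked w) τ :=
      ⟨⟨hrx, smul_mem_cone h1 hr.le⟩, ⟨hrx, smul_mem_cone h2 hr.le⟩⟩
    rw [T.inter σ hσ τ hτ] at this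
    have := smul_mem_cone this.2 (inv_nonneg.2 hr.le)
    rwa [smul_smul, inv_mul_cancel₀ hr.ne', one_smul] at this

/-- A face `τ` that meets the face `abc` outside of the side `bc` contains `a`. -/
theorem mem_of_mem_cone (h : {a, b, c} ∈ T.faces) (hτ : τ ∈ T.faces) {x : Mink}
    (h1 : x ∈ cone (P.marked w) {a, b, c}) (h2 : x ∈ cone (P.marked w) τ)
    (hx : det3 (P.marked w b) (P.marked w c) x ≠ 0) : a ∈ τ := by
  by_contra ha
  refine hx (det3_eq_zero_of_mem_cone ?_ (T.cone_inter hw h hτ h1 h2))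
  intro y hy
  simp only [Finset.mem_inter, Finset.mem_insert, Finset.mem_singleton] at hy ⊢
  rcases hy with ⟨rfl | h | h, hy⟩
  · exact absurd hy ha
  · exact Or.inl h
  · exact Or.inr h

/-- Two faces on the same side of a common edge are equal. -/
theorem eq_of_same_side (ha : {a, b, c} ∈ T.faces) (hd : {d, b, c} ∈ T.faces)
    (h : 0 < det3 (P.marked w b) (P.marked w c) (P.marked w a) *
      det3 (P.marked w b) (P.marked w c) (P.marked w d)) : a = d := by
  set p := P.marked w with hp
  have hd0 := T.det3_ne_zero hd
  -- A small push from the midpoint of `bc` towards `a` stays in the cone of `dbc`, as `d` is on the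
  -- same side. The resulting point of both faces is off the plane of `bc`, which forces `a` into
  -- the face `dbc`.
  have key : ∀ᶠ ε in 𝓝[>] (0 : ℝ), p b + p c + ε • p a ∈ cone p {d, b, c} := by
    have ht : ∀ u v : Mink, Tendsto (fun ε : ℝ => det3 u v (p b + p c + ε • p a) /
        det3 (p d) (p b) (p c)) (𝓝[>] 0) (𝓝 (det3 u v (p b + p c) / det3 (p d) (p b) (p c))) := by
      intro u v
      have : Continuous (fun ε : ℝ => det3 u v (p b + p c + ε • p a) /
        det3 (p d) (p b) (p c)) :=
        ((continuous_det3_right u v).comp (by fun_prop)).div_const _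
      have := this.tendsto 0
      simp only [zero_smul, add_zero] at this
      exact this.mono_left nhdsWithin_le_nhds
    have e1 : det3 (p c) (p d) (p b + p c) / det3 (p d) (p b) (p c) = 1 := by
      rw [det3_add_right, det3_self_mid, add_zero, det3_rotate', div_self hd0]
    have e2 : det3 (p d) (p b) (p b + p c) / det3 (p d) (p b) (p c) = 1 := by
      rw [det3_add_right, det3_self_right, zero_add, div_self hd0]
    have t1 := ht (p c) (p d)
    have t2 := ht (p d) (p b)
    rw [e1] at t1
    rw [e2] at t2
    filter_upwards [t1.eventually (lt_mem_nhds one_pos), t2.eventually (lt_mem_nhds one_pos),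
      self_mem_nhdsWithin] with ε h1 h2 h3
    rw [mem_cone_triple hd0]
    refine ⟨?_, h1.le, h2.le⟩
    rw [det3_add_right, det3_add_right, det3_self_mid, det3_self_right, det3_smul_right,
      ← det3_rotate (p d), add_zero, zero_add]
    have h3' : (0 : ℝ) < ε := h3
    have : 0 < det3 (p b) (p c) (p a) / det3 (p b) (p c) (p d) := by
      rcases mul_pos_iff.1 h with ⟨h4, h5⟩ | ⟨h4, h5⟩
      · exact div_pos h4 h5
      · exact div_pos_of_neg_of_neg h4 h5
    rw [mul_div_assoc]
    positivity
  obtain ⟨ε, h1, h2⟩ := (key.and self_mem_nhdsWithin).exists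
  have h2' : (0 : ℝ) < ε := h2
  have hmem := T.mem_of_mem_cone hw ha hd (mem_cone_pair_add p h2'.le) h1 (by
    rw [det3_add_right, det3_add_right, det3_self_mid, det3_self_right, det3_smul_right,
      add_zero, zero_add]
    exact mul_ne_zero h2'.ne' (left_ne_zero_of_mul h.ne'))
  obtain ⟨n1, n2, -⟩ := T.ne_of_mem ha
  simpa [n1, n2] using hmem

omit hw in
/-- The pair `b`, `c` is an edge of the polygon. -/
def IsSide (b c : Fin n ⊕ Fin q) : Prop :=
  ∃ i : Fin n, (b = Sum.inl i ∧ c = Sum.inl (i + 1)) ∨ (c = Sum.inl i ∧ b = Sum.inl (i + 1))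

/-- The midpoint of an edge that is not a side is interior to the polygon, so a small push away from
`a` enters some face. That face contains the midpoint, hence both ends of the edge. -/
theorem exists_opposite (h : {a, b, c} ∈ T.faces) (hbc : ¬ IsSide b c) :
    ∃ d, {d, b, c} ∈ T.faces ∧ det3 (P.marked w b) (P.marked w c) (P.marked w a) *
      det3 (P.marked w b) (P.marked w c) (P.marked w d) < 0 := by
  obtain ⟨n1, n2, n3⟩ := T.ne_of_mem h
  have ha0 := T.det3_ne_zero h
  set p := P.marked w with hp
  -- Equality would put both `b` and `c` on the line of the i-th edge, and `bc` would be a side.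
  have hneg : ∀ i, mform (P.edgeDual i) (p b + p c) < 0 := by
    intro i
    have h1 := P.mform_edgeDual_marked_nonpos hw i b
    have h2 := P.mform_edgeDual_marked_nonpos hw i c
    rw [mform_add_right]
    by_contra! hcon
    have e1 := P.mform_edgeDual_marked_eq_zero hw (i := i) (a := b) (by linarith)
    have e2 := P.mform_edgeDual_marked_eq_zero hw (i := i) (a := c) (by linarith)
    refine hbc ⟨i, ?_⟩
    rcases e1 with e1 | e1 <;> rcases e2 with e2 | e2
    · exact absurd (e1.trans e2.symm) n3
    · exact Or.inl ⟨e1, e2⟩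
    · exact Or.inr ⟨e2, e1⟩
    · exact absurd (e1.trans e2.symm) n3
  have hev : ∀ᶠ ε in 𝓝[>] (0 : ℝ), ∀ i,
      mform (P.edgeDual i) (p b + p c + ε • (-p a)) ≤ 0 := by
    rw [Filter.eventually_all]
    intro i
    have : Continuous fun ε : ℝ => mform (P.edgeDual i) (p b + p c + ε • (-p a)) :=
      (continuous_mform _).comp (by fun_prop)
    have := this.tendsto 0
    simp only [zero_smul, add_zero] at this
    filter_upwards [(this.mono_left nhdsWithin_le_nhds).eventually (gt_mem_nhds (hneg i))]
      with ε h using h.le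
  obtain ⟨τ, hτ, hm, hf⟩ := T.exists_face_near hev
  have hm' : p b + p c ∈ cone p {a, b, c} := by
    simpa using mem_cone_pair_add p (a := a) (b := b) (c := c) le_rfl
  have hb : b ∈ τ := by
    refine T.mem_of_mem_cone hw (a := b) (b := c) (c := a) (by rwa [face_rotate]) hτ
      (by rwa [face_rotate]) hm ?_
    rw [det3_add_right, det3_self_mid, add_zero, det3_rotate']
    exact ha0
  have hc : c ∈ τ := by
    refine T.mem_of_mem_cone hw (a := c) (b := a) (c := b) (by rwa [← face_rotate]) hτ
      (by rwa [← face_rotate]) hm ?_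
    rw [det3_add_right, det3_self_right, zero_add]
    exact ha0
  obtain ⟨d, rfl⟩ := T.exists_eq_insert hτ hb hc n3
  have hd0 := T.det3_ne_zero hτ
  refine ⟨d, hτ, ?_⟩
  obtain ⟨ε, h1, h2⟩ := (hf.and_eventually self_mem_nhdsWithin).exists
  have h2' : (0 : ℝ) < ε := h2
  have h3 := ((mem_cone_triple hd0).1 h1).1
  rw [det3_add_right, det3_add_right, det3_self_mid, det3_self_right, det3_smul_right,
    add_zero, zero_add, ← mform_mcross, mform_neg_right, mform_mcross, ← det3_rotate (p d)] at h3
  rw [← det3_rotate] at ha0 hd0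
  have h4 : 0 ≤ ε * -det3 (p b) (p c) (p a) / det3 (p b) (p c) (p d) *
      (det3 (p b) (p c) (p d)) ^ 2 := mul_nonneg h3 (sq_nonneg _)
  have h5 : ε * -det3 (p b) (p c) (p a) / det3 (p b) (p c) (p d) *
      (det3 (p b) (p c) (p d)) ^ 2 =
      -(ε * (det3 (p b) (p c) (p a) * det3 (p b) (p c) (p d))) := by
    field_simp
  rw [h5] at h4
  have h6 : det3 (p b) (p c) (p a) * det3 (p b) (p c) (p d) ≤ 0 := by
    by_contra! hcon
    have := mul_pos h2' hcon
    linarith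
  exact lt_of_le_of_ne h6 (mul_ne_zero ha0 hd0)

theorem orientation_pos_of_face {i : Fin n} (h : {a, Sum.inl i, Sum.inl (i + 1)} ∈ T.faces) :
    0 < P.orientation * det3 (P.vertex i) (P.vertex (i + 1)) (P.marked w a) := by
  have h1 := P.mform_edgeDual_marked_nonpos hw i a
  rw [P.mform_edgeDual_nonpos_iff] at h1
  obtain ⟨n1, n2, n3⟩ := T.ne_of_mem h
  have h2 := T.det3_ne_zero h
  rw [← det3_rotate] at h2
  refine lt_of_le_of_ne h1 (mul_ne_zero ?_ h2).symm
  have := P.orientation_sq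
  rintro h0
  rw [h0] at this
  norm_num at this

/-- The functional of e_i^* is nonpositive on all marked points and zero at the midpoint of the
side. A face containing the midpoint therefore expresses it through the two ends alone, and neither
end suffices without the other. -/
theorem exists_face_side (i : Fin n) : ∃ a, {a, Sum.inl i, Sum.inl (i + 1)} ∈ T.faces := by
  set m := P.vertex i + P.vertex (i + 1) with hm
  have hmi : ∀ j, mform (P.edgeDual j) m ≤ 0 := by
    intro j
    rw [hm, mform_add_right]
    exact add_nonpos (P.mform_edgeDual_vertex_nonpos j i) (P.mform_edgeDual_vertex_nonpos j _)
  obtain ⟨τ, hτ, c, hc, hmc⟩ := T.exists_face_mem_cone hmi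
  have hz : ∀ d ∈ τ, c d = 0 ∨ d = Sum.inl i ∨ d = Sum.inl (i + 1) := by
    have h0 : ∑ d ∈ τ, c d * mform (P.edgeDual i) (P.marked w d) = 0 := by
      have := congrArg (mform (P.edgeDual i)) hmc
      rw [hm, mform_add_right, P.edgeDual_left, P.edgeDual_right, mform_sum_right] at this
      simp only [mform_smul_right] at this
      linarith
    rw [Finset.sum_eq_zero_iff_of_nonpos] at h0
    · intro d hd
      refine (mul_eq_zero.1 (h0 d hd)).imp_right fun h => P.mform_edgeDual_marked_eq_zero hw h
    · exact fun d hd => mul_nonpos_of_nonneg_of_nonpos (hc d hd)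
        (P.mform_edgeDual_marked_nonpos hw i d)
  have hdet := P.det3_vertex_ne_zero (fin_add_two_ne P.three_le i) (fin_add_one_ne P.three_le _)
  set k := i + 1 + 1
  have hi : Sum.inl i ∈ τ := by
    by_contra hcon
    have h1 := congrArg (fun x => det3 (P.vertex (i + 1)) (P.vertex k) x) hmc
    rw [hm, det3_add_right, det3_self_mid, add_zero, det3_rotate, ← mform_mcross _ _ (∑ d ∈ τ, _),
      mform_sum_right] at h1
    refine hdet (h1.trans (Finset.sum_eq_zero fun d hd => ?_))
    rw [mform_smul_right, mform_mcross]
    rcases hz d hd with h | rfl | rfl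
    · rw [h, zero_mul]
    · exact absurd hd hcon
    · rw [P.marked_inl, det3_self_mid, mul_zero]
  have hi1 : Sum.inl (i + 1) ∈ τ := by
    by_contra hcon
    have h1 := congrArg (fun x => det3 (P.vertex k) (P.vertex i) x) hmc
    rw [hm, det3_add_right, det3_self_right, zero_add, det3_rotate',
      ← mform_mcross _ _ (∑ d ∈ τ, _), mform_sum_right] at h1
    refine hdet (h1.trans (Finset.sum_eq_zero fun d hd => ?_))
    rw [mform_smul_right, mform_mcross]
    rcases hz d hd with h | rfl | rfl
    · rw [h, zero_mul]
    · rw [P.marked_inl, det3_self_right, mul_zero]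
    · exact absurd hd hcon
  obtain ⟨a, rfl⟩ := T.exists_eq_insert hτ hi hi1 (by
    simpa using (fin_add_one_ne P.three_le i).symm)
  exact ⟨a, hτ⟩

/-- All faces at a side lie on its inner side, hence coincide. -/
theorem sum_link_side {i : Fin n} (h : {a, Sum.inl i, Sum.inl (i + 1)} ∈ T.faces)
    (f : Fin n ⊕ Fin q → ℝ) :
    (∑ x, if {x, Sum.inl i, Sum.inl (i + 1)} ∈ T.faces then f x else 0) = f a := by
  rw [Finset.sum_eq_single a, if_pos h]
  · intro x _ hx
    refine if_neg fun hxf => hx ?_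
    refine T.eq_of_same_side hw hxf h ?_
    have h1 := T.orientation_pos_of_face hw h
    have h2 := T.orientation_pos_of_face hw hxf
    have h3 := P.orientation_sq
    have := mul_pos h1 h2
    simp only [P.marked_inl]
    nlinarith
  · simp

/-- A third face at the edge would lie on the same side as one of these two. -/
theorem sum_link_interior (ha : {a, b, c} ∈ T.faces) (hd : {d, b, c} ∈ T.faces)
    (h : det3 (P.marked w b) (P.marked w c) (P.marked w a) *
      det3 (P.marked w b) (P.marked w c) (P.marked w d) < 0) (f : Fin n ⊕ Fin q → ℝ) :
    (∑ x, if {x, b, c} ∈ T.faces then f x else 0) = f a + f d := by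
  have hne : a ≠ d := by rintro rfl; nlinarith
  rw [← Finset.sum_subset (Finset.subset_univ {a, d}), Finset.sum_pair hne, if_pos ha, if_pos hd]
  intro x _ hx
  refine if_neg fun hxf => hx ?_
  have hx0 := T.det3_ne_zero hxf
  rw [← det3_rotate] at hx0
  set A := det3 (P.marked w b) (P.marked w c) (P.marked w a)
  set D := det3 (P.marked w b) (P.marked w c) (P.marked w d)
  set X := det3 (P.marked w b) (P.marked w c) (P.marked w x) with hX
  rw [Finset.mem_insert, Finset.mem_singleton]
  rcases lt_or_gt_of_ne (mul_ne_zero hx0 (left_ne_zero_of_mul h.ne)) with h1 | h1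
  · refine Or.inr (T.eq_of_same_side hw hxf hd ?_)
    have h2 : 0 < (X * D) * A ^ 2 := by
      have := mul_pos_of_neg_of_neg h1 h
      linarith
    exact pos_of_mul_pos_left h2 (sq_nonneg _)
  · exact Or.inl (T.eq_of_same_side hw hxf ha h1)

end Faces

end Triangulation

/-! ### Strong connectivity of triangulations -/

/-- Genericity arguments choose a parameter outside finitely many such zero sets; affine conditions
are the case of top coefficient 0. -/
theorem finite_quadratic {A B C : ℝ} (h : ¬ (A = 0 ∧ B = 0 ∧ C = 0)) :
    {s : ℝ | A + s * B + s ^ 2 * C = 0}.Finite := by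
  set p : Polynomial ℝ := Polynomial.C A + Polynomial.C B * Polynomial.X +
    Polynomial.C C * Polynomial.X ^ 2 with hp
  have hp0 : p ≠ 0 := by
    intro h0
    apply h
    have h1 : p.coeff 0 = 0 := by rw [h0]; simp
    have h2 : p.coeff 1 = 0 := by rw [h0]; simp
    have h3 : p.coeff 2 = 0 := by rw [h0]; simp
    simp [hp, Polynomial.coeff_X, Polynomial.coeff_C] at h1 h2 h3
    exact ⟨h1, h2, h3⟩
  refine (Polynomial.finite_setOfPred_isRoot hp0).subset fun s hs => ?_
  simp only [Set.mem_ofPred_eq, Polynomial.IsRoot, hp, Polynomial.eval_add, Polynomial.eval_mul,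
    Polynomial.eval_C, Polynomial.eval_X, Polynomial.eval_pow] at hs ⊢
  linarith

/-- A point inside the cone of `a`, `b`, `c` that avoids finitely many given planes. -/
theorem exists_generic {ι : Type*} [Finite ι] {a b c : Mink} (h : det3 a b c ≠ 0) {m : ι → Mink}
    (hm : ∀ e, m e ≠ 0) :
    ∃ s : ℝ, 0 < s ∧ ∀ e, mform (m e) (a + s • b + s ^ 2 • c) ≠ 0 := by
  -- Along this moment curve the product with `m e` is a quadratic polynomial in s, nonzero because
  -- `a`, `b`, `c` is a basis.
  have hfin : (⋃ e, {s : ℝ | mform (m e) (a + s • b + s ^ 2 • c) = 0}).Finite := by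
    refine Set.finite_iUnion fun e => ?_
    simp only [mform_add_right, mform_smul_right]
    exact finite_quadratic fun h0 => hm e (eq_zero_of_mform_triple h h0.1 h0.2.1 h0.2.2)
  obtain ⟨s, hs, hs2⟩ := ((Set.Ioi_infinite (0 : ℝ)).sdiff hfin).nonempty
  refine ⟨s, hs, fun e he => hs2 (Set.mem_iUnion.2 ⟨e, he⟩)⟩

namespace Triangulation

variable {n q : ℕ} [NeZero n] {P : ConvexPolygon n} {w : Fin q → Mink} (T : Triangulation P w)

theorem generic_mem_cone {a b c : Fin n ⊕ Fin q} {s : ℝ} (hs : 0 < s) :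
    P.marked w a + s • P.marked w b + s ^ 2 • P.marked w c ∈ cone (P.marked w) {a, b, c} :=
  add_mem_cone (add_mem_cone (mem_cone_self (by simp))
    (smul_mem_cone (mem_cone_self (by simp)) hs.le))
    (smul_mem_cone (mem_cone_self (by simp)) (by positivity))

variable (hw : ∀ k, w k ∈ P.interior) (hinj : Function.Injective w)
include hw hinj

theorem mcross_marked_ne_zero {a b : Fin n ⊕ Fin q} (hab : a ≠ b) :
    mcross (P.marked w a) (P.marked w b) ≠ 0 :=
  mcross_ne_zero (P.marked_mem hw a) (P.marked_mem hw b)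
    fun h => hab (P.marked_injective hw hinj h)

/-- A function on the faces that takes the same value on faces with a common edge is constant. -/
theorem eq_of_forall_adjacent {α : Type*} (X : Finset (Fin n ⊕ Fin q) → α)
    (hX : ∀ a d b c, {a, b, c} ∈ T.faces → {d, b, c} ∈ T.faces → X {a, b, c} = X {d, b, c})
    {σ τ : Finset (Fin n ⊕ Fin q)} (hσ : σ ∈ T.faces) (hτ : τ ∈ T.faces) : X σ = X τ := by
  classical
  by_contra hne
  set p := P.marked w with hp
  -- generic points of the two faces
  obtain ⟨x, hx, hxe⟩ : ∃ x ∈ cone p σ, ∀ e, mcross x (p e) ≠ 0 := by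
    obtain ⟨a, b, c, rfl⟩ := T.exists_eq_triple hσ
    have hother : ∀ e : Fin n ⊕ Fin q, ∃ e', e ≠ e' := by
      intro e
      by_cases h : e = Sum.inl 0
      · exact ⟨Sum.inl (0 + 1), by rw [h]; simpa using (fin_add_one_ne P.three_le (0 : Fin n)).symm⟩
      · exact ⟨_, h⟩
    -- To keep `x` off the line of each marked point, it is enough to avoid one plane through that
    -- point.
    choose o ho using hother
    obtain ⟨s, hs, h⟩ := exists_generic (T.det3_ne_zero hσ)
      (fun e => mcross_marked_ne_zero hw hinj (ho e))
    refine ⟨_, generic_mem_cone hs, fun e he => h e ?_⟩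
    rw [mform_mcross, ← det3_rotate', ← mform_mcross, he, mform_zero_left]
  obtain ⟨y, hy, hye⟩ : ∃ y ∈ cone p τ, ∀ e, det3 x (p e) y ≠ 0 := by
    obtain ⟨a, b, c, rfl⟩ := T.exists_eq_triple hτ
    obtain ⟨s, hs, h⟩ := exists_generic (T.det3_ne_zero hτ) hxe
    exact ⟨_, generic_mem_cone hs, fun e => by rw [← mform_mcross]; exact h e⟩
  have hclosed : ∀ S : Finset (Finset (Fin n ⊕ Fin q)), S ⊆ T.faces →
      IsClosed (⋃ ρ ∈ S, cone p ρ) := fun S hS =>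
    S.finite_toSet.isClosed_biUnion fun ρ hρ => T.isClosed_cone (hS hρ)
  -- The faces with value `X σ` and those with other values give two closed sets that cover the
  -- segment from `x` to `y` and both meet it. By connectedness they meet on the segment.
  have hpre := isPreconnected_closed_iff.1 (convex_segment (𝕜 := ℝ) x y).isPreconnected
    _ _ (hclosed (T.faces.filter (X · = X σ)) (Finset.filter_subset _ _))
    (hclosed (T.faces.filter (X · ≠ X σ)) (Finset.filter_subset _ _)) (by
      rintro z ⟨r, t, hr, ht, -, rfl⟩
      have hz : ∀ i, mform (P.edgeDual i) (r • x + t • y) ≤ 0 := by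
        intro i
        rw [mform_add_right, mform_smul_right, mform_smul_right]
        exact add_nonpos
          (mul_nonpos_of_nonneg_of_nonpos hr (nonpos_of_mem_cone hw hx i))
          (mul_nonpos_of_nonneg_of_nonpos ht (nonpos_of_mem_cone hw hy i))
      obtain ⟨ρ, hρ, h⟩ := T.exists_face_mem_cone hz
      by_cases hX : X ρ = X σ
      · exact Or.inl (Set.mem_biUnion (show ρ ∈ (T.faces.filter (X · = X σ) : Set _) by
          simp [hρ, hX]) h)
      · exact Or.inr (Set.mem_biUnion (show ρ ∈ (T.faces.filter (X · ≠ X σ) : Set _) by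
          simp [hρ, hX]) h))
    ⟨x, left_mem_segment ℝ x y, Set.mem_biUnion
      (show σ ∈ (T.faces.filter (X · = X σ) : Set _) by simp [hσ]) hx⟩
    ⟨y, right_mem_segment ℝ x y, Set.mem_biUnion
      (show τ ∈ (T.faces.filter (X · ≠ X σ) : Set _) by simp [hτ, Ne.symm hne]) hy⟩
  obtain ⟨z, ⟨r, t, hr, ht, hrt, rfl⟩, hz1, hz2⟩ := hpre
  simp only [Set.mem_iUnion, Finset.mem_filter] at hz1 hz2
  obtain ⟨ρ, ⟨hρ, hρX⟩, h1⟩ := hz1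
  obtain ⟨π, ⟨hπ, hπX⟩, h2⟩ := hz2
  have h3 := T.cone_inter hw hρ hπ h1 h2
  -- Faces with different values share no edge, so they have at most one common vertex.
  obtain ⟨e, he⟩ : ∃ e, ρ ∩ π ⊆ {e} := by
    by_contra! hcon
    obtain ⟨b, hb⟩ : (ρ ∩ π).Nonempty := by
      by_contra hemp
      rw [Finset.not_nonempty_iff_eq_empty] at hemp
      exact hcon (Sum.inl 0) (by rw [hemp]; simp)
    obtain ⟨c, hc, hcb⟩ := Finset.not_subset.1 (hcon b)
    rw [Finset.mem_singleton] at hcb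
    rw [Finset.mem_inter] at hb hc
    obtain ⟨a, rfl⟩ := T.exists_eq_insert hρ hb.1 hc.1 (Ne.symm hcb)
    obtain ⟨d, rfl⟩ := T.exists_eq_insert hπ hb.2 hc.2 (Ne.symm hcb)
    exact hπX ((hX _ _ _ _ hρ hπ).symm.trans hρX)
  obtain ⟨k, hk⟩ : ∃ k : ℝ, r • x + t • y = k • p e := by
    obtain ⟨f, -, hf⟩ := cone_mono he h3
    exact ⟨f e, by rw [hf, Finset.sum_singleton]⟩
  -- As `y` is off the plane of `x` and `p e`, this forces t = 0, and then `x` would lie on the line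
  -- of `p e`.
  have h4 := congrArg (fun v => mform (mcross x (p e)) v) hk
  simp only [mform_add_right, mform_smul_right, mform_mcross, det3_self_mid, det3_self_right,
    mul_zero, zero_add, mul_eq_zero, hye e, or_false] at h4
  subst h4
  have hr1 : r = 1 := by linarith
  subst hr1
  rw [one_smul, zero_smul, add_zero] at hk
  apply hxe e
  refine eq_zero_of_mform_eq_zero fun v => ?_
  rw [mform_mcross, hk, ← det3_rotate, det3_smul_right, det3_self_mid, mul_zero]

end Triangulation

/-! ### Counting the faces and edges of a triangulation -/

namespace Triangulation

variable {n q : ℕ} [NeZero n] {P : ConvexPolygon n} {w : Fin q → Mink} (T : Triangulation P w)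

/-- The line through `a` in the direction of `z` enters the face `σ` from `a` in this direction. -/
def Enters (P : ConvexPolygon n) (w : Fin q → Mink) (z : Mink) (σ : Finset (Fin n ⊕ Fin q))
    (a : Fin n ⊕ Fin q) : Prop :=
  ∃ b c, σ = {a, b, c} ∧
    0 < det3 (P.marked w c) (P.marked w a) z /
      det3 (P.marked w a) (P.marked w b) (P.marked w c) ∧
    0 < det3 (P.marked w a) (P.marked w b) z / det3 (P.marked w a) (P.marked w b) (P.marked w c)

/-- The point `z` or its opposite, according to a sign. -/
def signed (z : Mink) (ε : Bool) : Mink := if ε then z else -z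

/-- The coordinate at `a` starts from 1 and the other two grow from 0. The second clause says that
the point is off all three side planes, however the vertices are listed. -/
theorem eventually_of_enters {z : Mink} {σ : Finset (Fin n ⊕ Fin q)} (hσ : σ ∈ T.faces)
    {a : Fin n ⊕ Fin q} (h : Enters P w z σ a) :
    ∀ᶠ δ in 𝓝[>] (0 : ℝ), P.marked w a + δ • z ∈ cone (P.marked w) σ ∧
      ∀ b c d, σ = {b, c, d} → det3 (P.marked w c) (P.marked w d) (P.marked w a + δ • z) ≠ 0 := by
  obtain ⟨b, c, rfl, h1, h2⟩ := h
  set p := P.marked w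
  have h0 := T.det3_ne_zero hσ
  have ht : Tendsto (fun δ : ℝ => det3 (p b) (p c) (p a + δ • z) / det3 (p a) (p b) (p c))
      (𝓝[>] 0) (𝓝 1) := by
    have : Continuous (fun δ : ℝ => det3 (p b) (p c) (p a + δ • z) / det3 (p a) (p b) (p c)) :=
      ((continuous_det3_right _ _).comp (by fun_prop)).div_const _
    have := this.tendsto 0
    simp only [zero_smul, add_zero] at this
    rw [det3_rotate (p a) (p b) (p c), div_self h0] at this
    exact this.mono_left nhdsWithin_le_nhds
  filter_upwards [ht.eventually (lt_mem_nhds one_pos), self_mem_nhdsWithin] with δ h3 h4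
  have h4' : (0 : ℝ) < δ := h4
  have e1 : 0 < det3 (p c) (p a) (p a + δ • z) / det3 (p a) (p b) (p c) := by
    rw [det3_add_right, det3_self_right, zero_add, det3_smul_right, mul_div_assoc]
    positivity
  have e2 : 0 < det3 (p a) (p b) (p a + δ • z) / det3 (p a) (p b) (p c) := by
    rw [det3_add_right, det3_self_mid, zero_add, det3_smul_right, mul_div_assoc]
    positivity
  refine ⟨(mem_cone_triple h0).2 ⟨h3.le, e1.le, e2.le⟩, ?_⟩
  intro b' c' d' hs hz
  have f1 : det3 (p b) (p c) (p a + δ • z) ≠ 0 := fun h => by rw [h, zero_div] at h3; exact h3.false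
  have f2 : det3 (p c) (p a) (p a + δ • z) ≠ 0 := fun h => by rw [h, zero_div] at e1; exact e1.false
  have f3 : det3 (p a) (p b) (p a + δ • z) ≠ 0 := fun h => by rw [h, zero_div] at e2; exact e2.false
  obtain ⟨n1, n2, n3⟩ := T.ne_of_mem (hs ▸ hσ)
  have hc : c' = a ∨ c' = b ∨ c' = c := by
    have : c' ∈ ({a, b, c} : Finset (Fin n ⊕ Fin q)) := by rw [hs]; simp
    simpa using this
  have hd : d' = a ∨ d' = b ∨ d' = c := by
    have : d' ∈ ({a, b, c} : Finset (Fin n ⊕ Fin q)) := by rw [hs]; simp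
    simpa using this
  have hflip : ∀ u v : Mink, det3 u v (p a + δ • z) = 0 → det3 v u (p a + δ • z) = 0 :=
    fun u v h => by rw [det3_swap', h, neg_zero]
  rcases hc with rfl | rfl | rfl <;> rcases hd with rfl | rfl | rfl
  · exact n3 rfl
  · exact f3 hz
  · exact f2 (hflip _ _ hz)
  · exact f3 (hflip _ _ hz)
  · exact n3 rfl
  · exact f1 hz
  · exact f2 hz
  · exact f1 (hflip _ _ hz)
  · exact n3 rfl

/-- As `z` has time coordinate 0, its coordinates in the basis of the face do not all have the same
sign. One sign differs from the other two, and the face is entered from the corresponding vertex,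
along `z` or `-z` according to the sign of the other two. -/
theorem exists_enters {z : Mink} (hz2 : z 2 = 0) {σ : Finset (Fin n ⊕ Fin q)} (hσ : σ ∈ T.faces)
    (hw : ∀ k, w k ∈ P.interior)
    (hz : ∀ a b, a ≠ b → det3 (P.marked w a) (P.marked w b) z ≠ 0) :
    ∃ x : (Fin n ⊕ Fin q) × Bool, Enters P w (signed z x.2) σ x.1 := by
  obtain ⟨a, b, c, rfl⟩ := T.exists_eq_triple hσ
  obtain ⟨n1, n2, n3⟩ := T.ne_of_mem hσ
  have h0 := T.det3_ne_zero hσ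
  have hz' := hz
  set p := P.marked w
  set D := det3 (p a) (p b) (p c) with hD
  set A := det3 (p b) (p c) z / D with hA
  set B := det3 (p c) (p a) z / D with hB
  set C := det3 (p a) (p b) z / D with hC
  have hA0 : A ≠ 0 := div_ne_zero (hz b c n3) h0
  have hB0 : B ≠ 0 := div_ne_zero (hz c a n2.symm) h0
  have hC0 : C ≠ 0 := div_ne_zero (hz a b n1) h0
  have hsum : A * p a 2 + B * p b 2 + C * p c 2 = 0 := by
    have := congrFun (cramer' h0 z) 2
    rw [hz2] at this
    simpa using this.symm
  have ta := (P.marked_mem hw a).2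
  have tb := (P.marked_mem hw b).2
  have tc := (P.marked_mem hw c).2
  have rot : det3 (p b) (p c) (p a) = D := det3_rotate _ _ _
  have rot' : det3 (p c) (p a) (p b) = D := det3_rotate' _ _ _
  have neg : ∀ u v : Mink, det3 u v (-z) / D = -(det3 u v z / D) := by
    intro u v
    rw [← mform_mcross, mform_neg_right, mform_mcross, neg_div]
  have EA : ∀ ε, 0 < det3 (p c) (p a) (signed z ε) / D → 0 < det3 (p a) (p b) (signed z ε) / D →
      ∃ x : (Fin n ⊕ Fin q) × Bool, Enters P w (signed z x.2) {a, b, c} x.1 := fun ε h1 h2 =>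
    ⟨(a, ε), b, c, rfl, h1, h2⟩
  have EB : ∀ ε, 0 < det3 (p a) (p b) (signed z ε) / D → 0 < det3 (p b) (p c) (signed z ε) / D →
      ∃ x : (Fin n ⊕ Fin q) × Bool, Enters P w (signed z x.2) {a, b, c} x.1 := fun ε h1 h2 =>
    ⟨(b, ε), c, a, face_rotate.symm, by rw [← rot] at h1 h2; exact ⟨h1, h2⟩⟩
  have EC : ∀ ε, 0 < det3 (p b) (p c) (signed z ε) / D → 0 < det3 (p c) (p a) (signed z ε) / D →
      ∃ x : (Fin n ⊕ Fin q) × Bool, Enters P w (signed z x.2) {a, b, c} x.1 := fun ε h1 h2 =>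
    ⟨(c, ε), a, b, face_rotate, by rw [← rot'] at h1 h2; exact ⟨h1, h2⟩⟩
  rcases lt_or_gt_of_ne hA0 with hA1 | hA1 <;> rcases lt_or_gt_of_ne hB0 with hB1 | hB1 <;>
    rcases lt_or_gt_of_ne hC0 with hC1 | hC1
  · have := mul_neg_of_neg_of_pos hA1 ta
    have := mul_neg_of_neg_of_pos hB1 tb
    have := mul_neg_of_neg_of_pos hC1 tc
    linarith
  · exact EC false (by simp only [signed, Bool.false_eq_true, if_false, neg]; linarith)
      (by simp only [signed, Bool.false_eq_true, if_false, neg]; linarith)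
  · exact EB false (by simp only [signed, Bool.false_eq_true, if_false, neg]; linarith)
      (by simp only [signed, Bool.false_eq_true, if_false, neg]; linarith)
  · exact EA true hB1 hC1
  · exact EA false (by simp only [signed, Bool.false_eq_true, if_false, neg]; linarith)
      (by simp only [signed, Bool.false_eq_true, if_false, neg]; linarith)
  · exact EB true hC1 hA1
  · exact EC true hA1 hB1
  · have := mul_pos hA1 ta
    have := mul_pos hB1 tb
    have := mul_pos hC1 tc
    linarith

/-- The vector (1, s, 0) works for all but finitely many s. A plane through two marked points is
never horizontal: a vertical normal cannot be orthogonal to a vector of positive time coordinate. -/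
theorem exists_horizontal (hw : ∀ k, w k ∈ P.interior) (hinj : Function.Injective w) :
    ∃ z : Mink, z 2 = 0 ∧ z ≠ 0 ∧
      ∀ a b, a ≠ b → det3 (P.marked w a) (P.marked w b) z ≠ 0 := by
  have hfin : (⋃ x : {x : (Fin n ⊕ Fin q) × (Fin n ⊕ Fin q) // x.1 ≠ x.2},
      {s : ℝ | mcross (P.marked w x.1.1) (P.marked w x.1.2) 0 +
        s * mcross (P.marked w x.1.1) (P.marked w x.1.2) 1 + s ^ 2 * 0 = 0}).Finite := by
    refine Set.finite_iUnion fun x => finite_quadratic ?_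
    rintro ⟨h0, h1, -⟩
    apply mcross_marked_ne_zero hw hinj x.2
    set m := mcross (P.marked w x.1.1) (P.marked w x.1.2) with hm
    have h2 : mform m (P.marked w x.1.1) = 0 := by rw [hm, mform_mcross, det3_self_mid]
    rw [mform, h0, h1] at h2
    have h3 := (P.marked_mem hw x.1.1).2
    have h4 : m 2 = 0 := by
      have : m 2 * P.marked w x.1.1 2 = 0 := by linarith
      exact (mul_eq_zero.1 this).resolve_right h3.ne'
    ext i; fin_cases i <;> assumption
  obtain ⟨s, hs⟩ := hfin.infinite_compl.nonempty
  refine ⟨![1, s, 0], rfl, fun h => one_ne_zero (congrFun h 0), fun a b hab h => ?_⟩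
  refine hs (Set.mem_iUnion.2 ⟨⟨(a, b), hab⟩, ?_⟩)
  rw [← mform_mcross] at h
  simp [mform] at h ⊢
  linarith

/-- A sweep along `z` takes the place of Euler's formula. Each face is charged to a vertex and a
direction ±z from which it is entered, and distinct faces have distinct charges. A point w_k takes
at most two charges, a vertex of the polygon at most one, and two extreme vertices take none. -/
theorem card_faces_le (hw : ∀ k, w k ∈ P.interior) (hinj : Function.Injective w) :
    T.faces.card + 2 ≤ 2 * q + n := by
  classical
  obtain ⟨z, hz2, hz0, hz⟩ := exists_horizontal hw hinj
  have hez : ∀ i, mform (P.edgeDual i) z ≠ 0 := by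
    intro i h
    rw [P.mform_edgeDual, neg_div, neg_eq_zero, div_eq_zero_iff] at h
    rcases h with h | h
    · refine hz (Sum.inl i) (Sum.inl (i + 1)) ?_
        ((mul_eq_zero.1 h).resolve_left fun h0 => ?_)
      · simpa using (fin_add_one_ne P.three_le i).symm
      · have := P.orientation_sq
        rw [h0] at this
        norm_num at this
    · exact (P.sqrt_edge_pos i).ne' h
  -- neither `z` nor `-z` lies in the cone of the polygon
  have hout : ∀ y : Mink, y 2 = 0 → y ≠ 0 → ¬ ∀ i, mform (P.edgeDual i) y ≤ 0 := by
    intro y hy hy0 h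
    obtain ⟨r, -, hr⟩ := exists_smul_mem_hypPlane (fun a _ => P.vertex_mem a)
      (P.mem_cone_vertex h) hy0
    have := hr.2
    simp [hy] at this
  -- A constant sign of ⟨e_j^*, z⟩ would put `z` or `-z` into the cone of the polygon, so the sign
  -- changes in both ways around the cycle. At a vertex where it changes, neither `z` nor `-z`
  -- points into the polygon.
  obtain ⟨j₁, hj₁, hj₁'⟩ : ∃ j, mform (P.edgeDual j) z < 0 ∧ 0 < mform (P.edgeDual (j + 1)) z := by
    by_contra! hcon
    obtain ⟨i, hi⟩ : ∃ i, mform (P.edgeDual i) z < 0 := by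
      by_contra! h
      refine hout (-z) (by simp [hz2]) (by simpa using hz0) fun i => ?_
      rw [mform_neg_right]
      linarith [h i]
    exact hout z hz2 hz0 fun j => (fin_cycle_induction (p := fun j => mform (P.edgeDual j) z < 0) hi
      (fun j hj => lt_of_le_of_ne (hcon j hj) (hez _)) j).le
  obtain ⟨j₂, hj₂, hj₂'⟩ : ∃ j, 0 < mform (P.edgeDual j) z ∧ mform (P.edgeDual (j + 1)) z < 0 := by
    by_contra! hcon
    obtain ⟨i, hi⟩ : ∃ i, 0 < mform (P.edgeDual i) z := by
      by_contra! h
      exact hout z hz2 hz0 h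
    refine hout (-z) (by simp [hz2]) (by simpa using hz0) fun j => ?_
    have := fin_cycle_induction (p := fun j => 0 < mform (P.edgeDual j) z) hi
      (fun j hj => lt_of_le_of_ne (hcon j hj) (hez _).symm) j
    rw [mform_neg_right]
    linarith
  choose f hf using fun σ : T.faces => T.exists_enters hz2 σ.2 hw hz
  have hfinj : Function.Injective f := by
    intro σ τ hst
    have h1 := T.eventually_of_enters σ.2 (hf σ)
    have h2 := T.eventually_of_enters τ.2 (hf τ)
    rw [hst] at h1
    obtain ⟨δ, h3, h4⟩ := (h1.and h2).exists
    have hsub : ∀ ρ π : T.faces, ∀ x, (x ∈ cone (P.marked w) ρ ∧ ∀ b c d, ρ.1 = {b, c, d} →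
        det3 (P.marked w c) (P.marked w d) x ≠ 0) → x ∈ cone (P.marked w) π → ρ.1 ⊆ π.1 := by
      intro ρ π x hx hx' a ha
      obtain ⟨b, hb⟩ : ∃ b ∈ ρ.1, b ≠ a := by
        apply Finset.exists_mem_ne
        rw [T.card_eq ρ ρ.2]; norm_num
      obtain ⟨c, hc⟩ := T.exists_eq_insert ρ.2 ha hb.1 hb.2.symm
      have hc' : ρ.1 = {a, b, c} := hc.trans face_rotate.symm
      exact T.mem_of_mem_cone hw (hc' ▸ ρ.2) π.2 (hc' ▸ hx.1) hx' (hx.2 a b c hc')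
    exact Subtype.ext ((hsub σ τ _ h3 h4.1).antisymm (hsub τ σ _ h4 h3.1))
  have hfe : ∀ σ i, mform (P.edgeDual i) (P.marked w (f σ).1) = 0 →
      mform (P.edgeDual i) (signed z (f σ).2) ≤ 0 := by
    intro σ i h0
    obtain ⟨δ, ⟨h1, -⟩, h2⟩ :=
      ((T.eventually_of_enters σ.2 (hf σ)).and self_mem_nhdsWithin).exists
    have h2' : (0 : ℝ) < δ := h2
    have := nonpos_of_mem_cone hw h1 i
    rw [mform_add_right, h0, zero_add, mform_smul_right] at this
    by_contra! hcon
    linarith [mul_pos h2' hcon]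
  have hsg : ∀ i ε, mform (P.edgeDual i) (signed z ε) ≤ 0 ↔
      (ε = true ↔ mform (P.edgeDual i) z < 0) := by
    intro i ε
    cases ε
    · simp only [signed, Bool.false_eq_true, if_false, mform_neg_right, false_iff, not_lt]
      constructor <;> intro h <;> linarith
    · simp only [signed, if_true, true_iff]
      exact ⟨fun h => lt_of_le_of_ne h (hez i), le_of_lt⟩
  set g : T.faces → Fin n ⊕ (Fin q × Bool) := fun σ =>
    Sum.elim Sum.inl (fun k => Sum.inr (k, (f σ).2)) (f σ).1 with hg
  have hginj : Function.Injective g := by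
    intro σ τ h
    apply hfinj
    have hσ := hfe σ
    have hτ := hfe τ
    simp only [hg] at h
    rcases hfσ : f σ with ⟨i | k, ε⟩ <;> rcases hfτ : f τ with ⟨j | l, δ⟩ <;>
      simp only [hfσ, hfτ, Sum.elim_inl, Sum.elim_inr, Sum.inl.injEq, Sum.inr.injEq,
        Prod.mk.injEq, reduceCtorEq] at h
    · subst h
      rw [hfσ] at hσ
      rw [hfτ] at hτ
      have e1 := (hsg i ε).1 (hσ i (P.edgeDual_left i))
      have e2 := (hsg i δ).1 (hτ i (P.edgeDual_left i))
      have : ε = δ := Bool.eq_iff_iff.2 (e1.trans e2.symm)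
      rw [this]
    · rw [h.1, h.2]
  have hgne : ∀ j, (mform (P.edgeDual j) z < 0 ↔ ¬ mform (P.edgeDual (j + 1)) z < 0) →
      ∀ σ, g σ ≠ Sum.inl (j + 1) := by
    intro j hj σ h
    have hσ := hfe σ
    simp only [hg] at h
    rcases hfσ : f σ with ⟨i | k, ε⟩ <;> simp only [hfσ, Sum.elim_inl, Sum.elim_inr,
      Sum.inl.injEq, reduceCtorEq] at h
    subst h
    rw [hfσ] at hσ
    have e1 := (hsg j ε).1 (hσ j (P.edgeDual_right j))
    have e2 := (hsg (j + 1) ε).1 (hσ (j + 1) (P.edgeDual_left (j + 1)))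
    tauto
  have hne : j₁ ≠ j₂ := by rintro rfl; linarith
  have hcard : (Finset.univ.image g).card ≤
      (Finset.univ \ {Sum.inl (j₁ + 1), Sum.inl (j₂ + 1)} :
        Finset (Fin n ⊕ (Fin q × Bool))).card := by
    refine Finset.card_le_card fun x hx => ?_
    obtain ⟨σ, -, rfl⟩ := Finset.mem_image.1 hx
    have h1 := hgne j₁ (by constructor <;> intro <;> linarith) σ
    have h2 := hgne j₂ (by constructor <;> intro <;> linarith) σ
    simp [h1, h2]
  rw [Finset.card_image_of_injective _ hginj, Finset.card_univ, Fintype.card_coe,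
    Finset.card_sdiff_of_subset (Finset.subset_univ _), Finset.card_pair (by simpa using hne),
    Finset.card_univ, Fintype.card_sum, Fintype.card_prod, Fintype.card_fin, Fintype.card_fin,
    Fintype.card_bool] at hcard
  have := P.three_le
  omega

/-- The edges of the triangulation. -/
def edges : Finset (Sym2 (Fin n ⊕ Fin q)) :=
  open Classical in Finset.univ.filter fun e => ∃ a b, e = s(a, b) ∧ T.Adj a b

theorem adj_symm {a b : Fin n ⊕ Fin q} (h : T.Adj a b) : T.Adj b a := by
  obtain ⟨h1, σ, h2, h3, h4⟩ := h
  exact ⟨h1.symm, σ, h2, h4, h3⟩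

theorem mem_edges {a b : Fin n ⊕ Fin q} : s(a, b) ∈ T.edges ↔ T.Adj a b := by
  simp only [edges, Finset.mem_filter, Finset.mem_univ, true_and]
  constructor
  · rintro ⟨c, d, h, h2⟩
    rcases Sym2.eq_iff.1 h with ⟨rfl, rfl⟩ | ⟨rfl, rfl⟩
    · exact h2
    · exact T.adj_symm h2
  · exact fun h => ⟨a, b, rfl, h⟩

theorem adj_of_face {a b c : Fin n ⊕ Fin q} (h : {a, b, c} ∈ T.faces) : T.Adj b c :=
  ⟨(T.ne_of_mem h).2.2, _, h, by simp, by simp⟩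

theorem adj_iff {b c : Fin n ⊕ Fin q} : T.Adj b c ↔ ∃ a, {a, b, c} ∈ T.faces := by
  constructor
  · rintro ⟨h, σ, h1, h2, h3⟩
    obtain ⟨a, rfl⟩ := T.exists_eq_insert h1 h2 h3 h
    exact ⟨a, h1⟩
  · rintro ⟨a, h⟩
    exact T.adj_of_face h

/-- Incidences are counted twice: a face has at most three edges, a side lies in at least one face
and any other edge in at least two. Hence 2|E| ≤ 3|F| + n. -/
theorem card_edges_le (hw : ∀ k, w k ∈ P.interior) (hinj : Function.Injective w) :
    T.edges.card + 3 ≤ 3 * q + 2 * n := by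
  classical
  set r : Sym2 (Fin n ⊕ Fin q) → Finset (Fin n ⊕ Fin q) → Prop := fun e σ => ∀ x ∈ e, x ∈ σ with hr
  have hdc := Finset.sum_card_bipartiteAbove_eq_sum_card_bipartiteBelow (s := T.edges)
    (t := T.faces) r
  have h1 : ∑ σ ∈ T.faces, (T.edges.bipartiteBelow r σ).card ≤ 3 * T.faces.card := by
    rw [mul_comm, ← smul_eq_mul, ← Finset.sum_const]
    refine Finset.sum_le_sum fun σ hσ => ?_
    obtain ⟨a, b, c, rfl⟩ := T.exists_eq_triple hσ
    refine le_trans (Finset.card_le_card (t := {s(a, b), s(a, c), s(b, c)}) fun e he => ?_)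
      Finset.card_le_three
    rw [Finset.mem_bipartiteBelow] at he
    obtain ⟨he, h⟩ := he
    induction e with | _ x y =>
    have hxy := (T.mem_edges.1 he).1
    have hx := h x (by simp)
    have hy := h y (by simp)
    simp only [Finset.mem_insert, Finset.mem_singleton] at hx hy ⊢
    rcases hx with rfl | rfl | rfl <;> rcases hy with rfl | rfl | rfl <;>
      simp_all [Sym2.eq_swap]
  set S : Finset (Sym2 (Fin n ⊕ Fin q)) :=
    Finset.univ.image fun i : Fin n => s(Sum.inl i, Sum.inl (i + 1)) with hS
  have hSc : S.card ≤ n := Finset.card_image_le.trans (by simp)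
  have h2 : ∀ e ∈ T.edges, 2 ≤ (T.faces.bipartiteAbove r e).card + if e ∈ S then 1 else 0 := by
    intro e he
    induction e with | _ b c =>
    obtain ⟨a, ha⟩ := T.adj_iff.1 (T.mem_edges.1 he)
    have hmem : ∀ d, {d, b, c} ∈ T.faces → {d, b, c} ∈ T.faces.bipartiteAbove r s(b, c) := by
      intro d hd
      rw [Finset.mem_bipartiteAbove]
      refine ⟨hd, fun x hx => ?_⟩
      rcases Sym2.mem_iff.1 hx with rfl | rfl <;> simp
    split_ifs with hs
    · have : 0 < (T.faces.bipartiteAbove r s(b, c)).card := Finset.card_pos.2 ⟨_, hmem a ha⟩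
      omega
    · have hns : ¬ IsSide b c := by
        rintro ⟨i, ⟨rfl, rfl⟩ | ⟨rfl, rfl⟩⟩
        · exact hs (Finset.mem_image.2 ⟨i, Finset.mem_univ _, rfl⟩)
        · exact hs (Finset.mem_image.2 ⟨i, Finset.mem_univ _, Sym2.eq_swap⟩)
      obtain ⟨d, hd, hneg⟩ := T.exists_opposite hw ha hns
      rw [add_zero]
      change 1 < _
      refine Finset.one_lt_card.2 ⟨_, hmem a ha, _, hmem d hd, fun h => ?_⟩
      have : a ∈ ({d, b, c} : Finset (Fin n ⊕ Fin q)) := by rw [← h]; simp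
      obtain ⟨n1, n2, -⟩ := T.ne_of_mem ha
      have : a = d := by simpa [n1, n2] using this
      subst this
      nlinarith
  have h3 := Finset.sum_le_sum h2
  rw [Finset.sum_const, smul_eq_mul, Finset.sum_add_distrib, hdc, ← Finset.card_filter] at h3
  have h4 : (T.edges.filter (· ∈ S)).card ≤ n := le_trans (Finset.card_le_card fun e he =>
    (Finset.mem_filter.1 he).2) hSc
  have h5 := T.card_faces_le hw hinj
  omega

end Triangulation

/-! ### First-order variations of the angles of a triangulated polygon -/

namespace Triangulation

variable {n q : ℕ} [NeZero n] {P : ConvexPolygon n} {w : Fin q → Mink} (T : Triangulation P w)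

/-- The variation of the hyperbolic cosine of the length of the edge `ab`. -/
def coshVar (P : ConvexPolygon n) (w : Fin q → Mink) (δ : Sym2 (Fin n ⊕ Fin q) → ℝ)
    (a b : Fin n ⊕ Fin q) : ℝ :=
  Real.sinh (hdist (P.marked w a) (P.marked w b)) * δ s(a, b)

theorem coshVar_comm (δ : Sym2 (Fin n ⊕ Fin q) → ℝ) (a b : Fin n ⊕ Fin q) :
    coshVar P w δ a b = coshVar P w δ b a := by
  rw [coshVar, coshVar, hdist_comm, Sym2.eq_swap]

/-- The variation of the total angle at `a`. -/
def totalAngleVar (a : Fin n ⊕ Fin q) : (Sym2 (Fin n ⊕ Fin q) → ℝ) →ₗ[ℝ] ℝ where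
  toFun δ := (1 / 2 : ℝ) * ∑ b, ∑ c, if {a, b, c} ∈ T.faces then
    angleVar (P.marked w a) (P.marked w b) (P.marked w c) (coshVar P w δ b c) (coshVar P w δ a b)
      (coshVar P w δ a c) else 0
  map_add' δ ε := by
    rw [← mul_add, ← Finset.sum_add_distrib]
    congr 1
    refine Finset.sum_congr rfl fun b _ => ?_
    rw [← Finset.sum_add_distrib]
    refine Finset.sum_congr rfl fun c _ => ?_
    split_ifs
    · simp only [angleVar, coshVar, Pi.add_apply]; ring
    · simp
  map_smul' r δ := by
    simp only [RingHom.id_apply, smul_eq_mul]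
    rw [mul_left_comm]
    congr 1
    rw [Finset.mul_sum]
    refine Finset.sum_congr rfl fun b _ => ?_
    rw [Finset.mul_sum]
    refine Finset.sum_congr rfl fun c _ => ?_
    split_ifs
    · simp only [angleVar, coshVar, Pi.smul_apply, smul_eq_mul]; ring
    · simp

theorem totalAngleVar_apply (a : Fin n ⊕ Fin q) (δ : Sym2 (Fin n ⊕ Fin q) → ℝ) :
    T.totalAngleVar a δ = (1 / 2 : ℝ) * ∑ b, ∑ c, if {a, b, c} ∈ T.faces then
      angleVar (P.marked w a) (P.marked w b) (P.marked w c) (coshVar P w δ b c)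
        (coshVar P w δ a b) (coshVar P w δ a c) else 0 := rfl

theorem adj_of_face' {a b c : Fin n ⊕ Fin q} (h : {a, b, c} ∈ T.faces) :
    T.Adj b c ∧ T.Adj a b ∧ T.Adj a c := by
  obtain ⟨h1, h2, h3⟩ := T.ne_of_mem h
  exact ⟨⟨h3, _, h, by simp, by simp⟩, ⟨h1, _, h, by simp, by simp⟩, ⟨h2, _, h, by simp, by simp⟩⟩

theorem totalAngleVar_congr {δ ε : Sym2 (Fin n ⊕ Fin q) → ℝ}
    (h : ∀ a b, T.Adj a b → δ s(a, b) = ε s(a, b)) (a : Fin n ⊕ Fin q) :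
    T.totalAngleVar a δ = T.totalAngleVar a ε := by
  rw [totalAngleVar_apply, totalAngleVar_apply]
  congr 1
  refine Finset.sum_congr rfl fun b _ => Finset.sum_congr rfl fun c _ => ?_
  split_ifs with hf
  · obtain ⟨h1, h2, h3⟩ := T.adj_of_face' hf
    simp only [coshVar, h _ _ h1, h _ _ h2, h _ _ h3]
  · rfl

theorem hasDerivAt_totalAngle (hw : ∀ k, w k ∈ P.interior)
    {L : ℝ → Sym2 (Fin n ⊕ Fin q) → ℝ} {δ : Sym2 (Fin n ⊕ Fin q) → ℝ}
    (h0 : ∀ a b, T.Adj a b → L 0 s(a, b) = hdist (P.marked w a) (P.marked w b))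
    (hL : ∀ a b, T.Adj a b → HasDerivAt (fun t => L t s(a, b)) (δ s(a, b)) 0)
    (a : Fin n ⊕ Fin q) :
    HasDerivAt (fun t => T.totalAngle (L t) a) (T.totalAngleVar a δ) 0 := by
  rw [totalAngleVar_apply]
  unfold totalAngle
  refine HasDerivAt.const_mul _ (HasDerivAt.fun_sum fun b _ => HasDerivAt.fun_sum fun c _ => ?_)
  split_ifs with hf
  · obtain ⟨h1, h2, h3⟩ := T.adj_of_face' hf
    exact hasDerivAt_triangleAngle (P.marked_mem hw a) (P.marked_mem hw b) (P.marked_mem hw c)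
      (T.det3_ne_zero hf) (hL _ _ h1) (hL _ _ h2) (hL _ _ h3) (h0 _ _ h1) (h0 _ _ h2) (h0 _ _ h3)
  · exact hasDerivAt_const _ _

theorem sum_rotate {ι : Type*} [Fintype ι] (H : ι → ι → ι → ℝ) :
    ∑ a, ∑ b, ∑ c, H b c a = ∑ a, ∑ b, ∑ c, H a b c := by
  rw [Finset.sum_comm]
  refine Finset.sum_congr rfl fun b _ => ?_
  rw [Finset.sum_comm]

/-- The contribution to the duality formula of the edge `bc`. -/
def edgeTerm (X : Finset (Fin n ⊕ Fin q) → Mink) (δ : Sym2 (Fin n ⊕ Fin q) → ℝ)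
    (b c : Fin n ⊕ Fin q) : ℝ :=
  coshVar P w δ b c / (mform (P.marked w b) (P.marked w c) ^ 2 - 1) *
    ∑ a, if {a, b, c} ∈ T.faces then
      det3 (P.marked w b) (P.marked w c) (P.marked w a) /
        |det3 (P.marked w b) (P.marked w c) (P.marked w a)| *
        det3 (P.marked w b) (P.marked w c) (X {a, b, c}) else 0

theorem edgeTerm_comm (X : Finset (Fin n ⊕ Fin q) → Mink) (δ : Sym2 (Fin n ⊕ Fin q) → ℝ)
    (b c : Fin n ⊕ Fin q) : T.edgeTerm X δ c b = T.edgeTerm X δ b c := by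
  unfold edgeTerm
  rw [coshVar_comm, mform_comm (P.marked w c)]
  congr 1
  refine Finset.sum_congr rfl fun a _ => ?_
  rw [face_swap]
  split_ifs
  · rw [det3_swap' (P.marked w b), det3_swap' (P.marked w b), abs_neg]; ring
  · rfl

/-- Applying `angleVar_sum` in each face regroups the angle variations by edges. The vector may
depend on the face: a constant `X` yields the vector equation, a varying one serves its converse. -/
theorem sum_mul_totalAngleVar (hw : ∀ k, w k ∈ P.interior)
    {X : Finset (Fin n ⊕ Fin q) → Mink} {f : Fin n ⊕ Fin q → ℝ}
    (hX : ∀ σ ∈ T.faces, ∀ a ∈ σ, mform (X σ) (P.marked w a) = f a)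
    (δ : Sym2 (Fin n ⊕ Fin q) → ℝ) :
    ∑ a, f a * T.totalAngleVar a δ = (1 / 2 : ℝ) * ∑ b, ∑ c, T.edgeTerm X δ b c := by
  set p := P.marked w with hp
  set H : Fin n ⊕ Fin q → Fin n ⊕ Fin q → Fin n ⊕ Fin q → ℝ := fun a b c =>
    if {a, b, c} ∈ T.faces then f a * angleVar (p a) (p b) (p c) (coshVar P w δ b c)
      (coshVar P w δ a b) (coshVar P w δ a c) else 0 with hH
  set K : Fin n ⊕ Fin q → Fin n ⊕ Fin q → Fin n ⊕ Fin q → ℝ := fun b c a =>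
    if {a, b, c} ∈ T.faces then coshVar P w δ b c / (mform (p b) (p c) ^ 2 - 1) *
      (det3 (p b) (p c) (p a) / |det3 (p b) (p c) (p a)| * det3 (p b) (p c) (X {a, b, c})) else 0
    with hK
  have hL : ∑ a, f a * T.totalAngleVar a δ = (1 / 2 : ℝ) * ∑ a, ∑ b, ∑ c, H a b c := by
    rw [Finset.mul_sum]
    refine Finset.sum_congr rfl fun a _ => ?_
    rw [totalAngleVar_apply, mul_left_comm]
    congr 1
    rw [Finset.mul_sum]
    refine Finset.sum_congr rfl fun b _ => ?_
    rw [Finset.mul_sum]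
    refine Finset.sum_congr rfl fun c _ => ?_
    simp only [hH]
    split_ifs <;> simp [hp]
  have hR : ∑ b, ∑ c, T.edgeTerm X δ b c = ∑ b, ∑ c, ∑ a, K b c a := by
    refine Finset.sum_congr rfl fun b _ => Finset.sum_congr rfl fun c _ => ?_
    rw [edgeTerm, Finset.mul_sum]
    refine Finset.sum_congr rfl fun a _ => ?_
    simp only [hK]
    split_ifs <;> simp [hp]
  -- The two sides agree only after summation over the rotations of a triple; in the sum over all
  -- triples every rotation contributes the same.
  have key : ∀ a b c, H a b c + H b c a + H c a b = K b c a + K c a b + K a b c := by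
    intro a b c
    simp only [hH, hK]
    rw [face_rotate (a := a) (b := b) (c := c), face_rotate (a := c) (b := a) (c := b),
      face_rotate (a := b) (b := c) (c := a), face_rotate (a := a) (b := b) (c := c)]
    split_ifs with hf
    · have h := angleVar_sum (P.marked_mem hw a) (P.marked_mem hw b) (P.marked_mem hw c)
        (T.det3_ne_zero hf) (coshVar P w δ b c) (coshVar P w δ a c) (coshVar P w δ a b)
        (X {a, b, c})
      rw [hX _ hf a (by simp), hX _ hf b (by simp), hX _ hf c (by simp)] at h
      rw [coshVar_comm δ c a, coshVar_comm δ b a, coshVar_comm δ c b]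
      rw [det3_rotate (p a) (p b) (p c), det3_rotate' (p a) (p b) (p c)]
      rw [h]
      ring
    · simp
  have hsum : ∑ a, ∑ b, ∑ c, (H a b c + H b c a + H c a b) =
      ∑ a, ∑ b, ∑ c, (K b c a + K c a b + K a b c) := by simp only [key]
  simp only [Finset.sum_add_distrib] at hsum
  rw [sum_rotate H, sum_rotate K, sum_rotate fun a b c => H b c a, sum_rotate H,
    sum_rotate fun a b c => K b c a, sum_rotate K] at hsum
  rw [hL, hR]
  linarith

/-- Each side occurs in both orders; n ≥ 3 keeps the neighbours i + 1 and i - 1 distinct. -/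
theorem sum_sides {S : Fin n ⊕ Fin q → Fin n ⊕ Fin q → ℝ} (hn : 3 ≤ n)
    (hS : ∀ b c, ¬ IsSide b c → S b c = 0) :
    ∑ b, ∑ c, S b c =
      ∑ i, (S (Sum.inl i) (Sum.inl (i + 1)) + S (Sum.inl (i + 1)) (Sum.inl i)) := by
  have h1 : ∀ k c, S (Sum.inr k) c = 0 := fun k c => hS _ _ (by simp [IsSide])
  have h2 : ∀ b k, S b (Sum.inr k) = 0 := fun b k => hS _ _ (by simp [IsSide])
  simp only [Fintype.sum_sum_type, h1, h2, Finset.sum_const_zero, add_zero]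
  have h3 : ∀ i : Fin n, ∑ j : Fin n, S (Sum.inl i) (Sum.inl j) =
      S (Sum.inl i) (Sum.inl (i + 1)) + S (Sum.inl i) (Sum.inl (i - 1)) := by
    intro i
    have hne : i + 1 ≠ i - 1 := by
      intro h
      apply fin_add_two_ne hn (i - 1)
      rw [sub_add_cancel, h]
    rw [← Finset.sum_subset (Finset.subset_univ {i + 1, i - 1}), Finset.sum_pair hne]
    intro j _ hj
    refine hS _ _ ?_
    rintro ⟨k, ⟨e1, e2⟩ | ⟨e1, e2⟩⟩
    · apply hj
      rw [Sum.inl.injEq] at e1 e2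
      simp [e1, e2]
    · apply hj
      rw [Sum.inl.injEq] at e1 e2
      simp [e1, e2]
  simp only [h3, Finset.sum_add_distrib]
  congr 1
  rw [← Equiv.sum_comp (Equiv.addRight (1 : Fin n))]
  simp

/-! ### The first-order vector equation -/

section Link

variable (hw : ∀ k, w k ∈ P.interior)
include hw

/-- The edge terms of a constant function vanish at interior edges. -/
theorem sum_link_sign_eq_zero {b c : Fin n ⊕ Fin q} (hbc : ¬ IsSide b c) :
    (∑ a, if {a, b, c} ∈ T.faces then det3 (P.marked w b) (P.marked w c) (P.marked w a) /
        |det3 (P.marked w b) (P.marked w c) (P.marked w a)| else 0) = 0 := by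
  by_cases h : ∃ a, {a, b, c} ∈ T.faces
  · obtain ⟨a, ha⟩ := h
    obtain ⟨d, hd, hneg⟩ := T.exists_opposite hw ha hbc
    rw [T.sum_link_interior hw ha hd hneg]
    rcases mul_neg_iff.1 hneg with ⟨h1, h2⟩ | ⟨h1, h2⟩
    · rw [abs_of_pos h1, abs_of_neg h2, div_self h1.ne', div_neg, div_self h2.ne]; norm_num
    · rw [abs_of_neg h1, abs_of_pos h2, div_self h2.ne', div_neg, div_self h1.ne]; norm_num
  · push Not at h
    exact Finset.sum_eq_zero fun a _ => if_neg (h a)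

theorem sign_of_face {i : Fin n} {a : Fin n ⊕ Fin q}
    (h : {a, Sum.inl i, Sum.inl (i + 1)} ∈ T.faces) :
    det3 (P.vertex i) (P.vertex (i + 1)) (P.marked w a) /
      |det3 (P.vertex i) (P.vertex (i + 1)) (P.marked w a)| = P.orientation := by
  have h1 := T.orientation_pos_of_face hw h
  have h2 := P.orientation_sq
  have h3 := right_ne_zero_of_mul h1.ne'
  rcases sq_eq_one_iff.1 h2 with h2 | h2 <;> rw [h2] at h1 ⊢
  · rw [one_mul] at h1
    rw [abs_of_pos h1, div_self h3]
  · rw [abs_of_neg (by linarith), div_neg, div_self h3]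

/-- The hyperbolic sine of the side length is √(⟨v_i, v_{i+1}⟩² - 1), the same factor that
normalizes the dual point, so the determinant becomes a product with e_i^*. -/
theorem edgeTerm_side {i : Fin n} {a : Fin n ⊕ Fin q}
    (h : {a, Sum.inl i, Sum.inl (i + 1)} ∈ T.faces) (X : Finset (Fin n ⊕ Fin q) → Mink)
    (δ : Sym2 (Fin n ⊕ Fin q) → ℝ) :
    T.edgeTerm X δ (Sum.inl i) (Sum.inl (i + 1)) = -(δ s(Sum.inl i, Sum.inl (i + 1)) *
      mform (P.edgeDual i) (X {a, Sum.inl i, Sum.inl (i + 1)})) := by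
  rw [edgeTerm, T.sum_link_side hw h, P.mform_edgeDual, coshVar]
  simp only [P.marked_inl]
  rw [T.sign_of_face hw h, sinh_hdist (P.vertex_mem _) (P.vertex_mem _)]
  have h1 := P.sqrt_edge_pos i
  have h2 := Real.sq_sqrt (mform_sq_sub_one_pos (P.vertex_mem i) (P.vertex_mem (i + 1))
    (P.vertex_ne_succ i)).le
  rw [← h2]
  rw [Real.sqrt_sq h1.le]
  field_simp

/-- The first-order Gauss–Bonnet type formula: the variations satisfy the vector equation,
paired with `u`. -/
theorem sum_mform_mul_totalAngleVar (u : Mink) (δ : Sym2 (Fin n ⊕ Fin q) → ℝ) :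
    ∑ a, mform u (P.marked w a) * T.totalAngleVar a δ =
      -∑ i, δ s(Sum.inl i, Sum.inl (i + 1)) * mform (P.edgeDual i) u := by
  rw [T.sum_mul_totalAngleVar hw (X := fun _ => u) (fun _ _ _ _ => rfl)]
  rw [sum_sides P.three_le]
  · rw [← Finset.sum_neg_distrib, Finset.mul_sum]
    refine Finset.sum_congr rfl fun i _ => ?_
    obtain ⟨a, ha⟩ := T.exists_face_side hw i
    rw [T.edgeTerm_comm _ _ (Sum.inl i), T.edgeTerm_side hw ha]
    ring
  · intro b c hbc
    rw [edgeTerm]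
    have := T.sum_link_sign_eq_zero hw hbc
    have h2 := congrArg (· * det3 (P.marked w b) (P.marked w c) u) this
    simp only [Finset.sum_mul, ite_mul, zero_mul] at h2
    rw [h2, mul_zero]

end Link

end Triangulation

/-! ### The vector equation as a linear map, and its sufficiency by duality -/

/-- The vector `∑ l' i • e_i^* + ∑ α' j • v_j - ∑ θ' k • w_k` attached to variations of edge
lengths, angles and curvatures. -/
def balance {n q : ℕ} [NeZero n] (P : ConvexPolygon n) (w : Fin q → Mink) :
    ((Fin n → ℝ) × (Fin n → ℝ) × (Fin q → ℝ)) →ₗ[ℝ] Mink where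
  toFun y := ∑ i, y.1 i • P.edgeDual i + ∑ j, y.2.1 j • P.vertex j - ∑ k, y.2.2 k • w k
  map_add' y z := by
    simp only [Prod.fst_add, Prod.snd_add, Pi.add_apply, add_smul, Finset.sum_add_distrib]
    abel
  map_smul' r y := by
    simp only [Prod.smul_fst, Prod.smul_snd, Pi.smul_apply, smul_eq_mul, mul_smul,
      ← Finset.smul_sum, smul_sub, smul_add, RingHom.id_apply]

theorem balance_apply {n q : ℕ} [NeZero n] (P : ConvexPolygon n) (w : Fin q → Mink)
    (y : (Fin n → ℝ) × (Fin n → ℝ) × (Fin q → ℝ)) : balance P w y =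
    ∑ i, y.1 i • P.edgeDual i + ∑ j, y.2.1 j • P.vertex j - ∑ k, y.2.2 k • w k := rfl

/-- Three vertices already span. Surjectivity gives the kernel its exact dimension 2n + q - 3. -/
theorem balance_surjective {n q : ℕ} [NeZero n] (P : ConvexPolygon n) (w : Fin q → Mink) :
    Function.Surjective (balance P w) := by
  obtain ⟨i, j, k, h⟩ := P.exists_det3_vertex_ne_zero
  have hv : ∀ m, P.vertex m ∈ LinearMap.range (balance P w) := fun m =>
    ⟨(0, Pi.single m 1, 0), by simp [balance_apply, Pi.single_apply, ite_smul]⟩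
  rw [← LinearMap.range_eq_top, eq_top_iff]
  intro x _
  rw [cramer' h x]
  exact Submodule.add_mem _ (Submodule.add_mem _ (Submodule.smul_mem _ _ (hv i))
    (Submodule.smul_mem _ _ (hv j))) (Submodule.smul_mem _ _ (hv k))

namespace Triangulation

variable {n q : ℕ} [NeZero n] {P : ConvexPolygon n} {w : Fin q → Mink} (T : Triangulation P w)

/-- The variations of the lengths of the edges of the polygon, of its angles and of the
curvatures, for a given variation of the lengths of the edges of the triangulation. -/
def variations :
    (Sym2 (Fin n ⊕ Fin q) → ℝ) →ₗ[ℝ] (Fin n → ℝ) × (Fin n → ℝ) × (Fin q → ℝ) :=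
  (LinearMap.pi fun i => LinearMap.proj s(Sum.inl i, Sum.inl (i + 1))).prod
    ((LinearMap.pi fun j => T.totalAngleVar (Sum.inl j)).prod
      (LinearMap.pi fun k => -T.totalAngleVar (Sum.inr k)))

theorem variations_apply (δ : Sym2 (Fin n ⊕ Fin q) → ℝ) : T.variations δ =
    (fun i => δ s(Sum.inl i, Sum.inl (i + 1)), fun j => T.totalAngleVar (Sum.inl j) δ,
      fun k => -T.totalAngleVar (Sum.inr k) δ) := rfl

theorem side_injective (hn : 3 ≤ n) {i j : Fin n}
    (h : (s(Sum.inl i, Sum.inl (i + 1)) : Sym2 (Fin n ⊕ Fin q)) =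
      s(Sum.inl j, Sum.inl (j + 1))) : i = j := by
  rcases Sym2.eq_iff.1 h with ⟨h1, -⟩ | ⟨h1, h2⟩
  · exact Sum.inl_injective h1
  · have e1 : i = j + 1 := Sum.inl_injective h1
    have e2 : i + 1 = j := Sum.inl_injective h2
    rw [e1] at e2
    exact absurd e2 (fin_add_two_ne hn j)

variable (hw : ∀ k, w k ∈ P.interior)
include hw

theorem adj_side (i : Fin n) : T.Adj (Sum.inl i) (Sum.inl (i + 1)) :=
  T.adj_iff.2 (T.exists_face_side hw i)

theorem variations_congr {δ ε : Sym2 (Fin n ⊕ Fin q) → ℝ}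
    (h : ∀ a b, T.Adj a b → δ s(a, b) = ε s(a, b)) : T.variations δ = T.variations ε := by
  simp only [variations_apply, T.totalAngleVar_congr h, h _ _ (T.adj_side hw _)]

theorem balance_variations (δ : Sym2 (Fin n ⊕ Fin q) → ℝ) :
    balance P w (T.variations δ) = 0 := by
  refine eq_zero_of_mform_eq_zero fun u => ?_
  rw [balance_apply, variations_apply, mform_sub_left, mform_add_left, mform_sum_left,
    mform_sum_left, mform_sum_left]
  have h := T.sum_mform_mul_totalAngleVar hw u δ
  rw [Fintype.sum_sum_type] at h
  simp only [mform_smul_left, neg_mul, Finset.sum_neg_distrib, P.marked_inl, P.marked_inr,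
    mform_comm u] at h ⊢
  simp only [mul_comm (mform _ u)] at h
  linarith

/-- A linear relation between the variations comes from a vector of Minkowski space. -/
theorem exists_of_relation (hinj : Function.Injective w) {lam : Fin n → ℝ}
    {f : Fin n ⊕ Fin q → ℝ}
    (h : ∀ δ : Sym2 (Fin n ⊕ Fin q) → ℝ, ∑ i, lam i * δ s(Sum.inl i, Sum.inl (i + 1)) +
      ∑ a, f a * T.totalAngleVar a δ = 0) :
    ∃ u, (∀ i, lam i = mform u (P.edgeDual i)) ∧ ∀ a, f a = mform u (P.marked w a) := by
  classical
  have hex : ∀ σ ∈ T.faces, ∃ u, ∀ a ∈ σ, mform u (P.marked w a) = f a := by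
    intro σ hσ
    obtain ⟨a, b, c, rfl⟩ := T.exists_eq_triple hσ
    obtain ⟨u, h1, h2, h3⟩ := exists_mform_triple (T.det3_ne_zero hσ) (f a) (f b) (f c)
    refine ⟨u, fun x hx => ?_⟩
    simp only [Finset.mem_insert, Finset.mem_singleton] at hx
    rcases hx with rfl | rfl | rfl <;> assumption
  choose! X hX using hex
  -- The relation is tested on the variation of a single edge, whose two orders absorb the factor
  -- 1/2.
  have hterm : ∀ b c, b ≠ c →
      ∑ i, lam i * (if s(Sum.inl i, Sum.inl (i + 1)) = s(b, c) then 1 else 0) +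
      T.edgeTerm X (fun e => if e = s(b, c) then 1 else 0) b c = 0 := by
    intro b c hbc
    have h1 := h (fun e => if e = s(b, c) then 1 else 0)
    rw [T.sum_mul_totalAngleVar hw hX] at h1
    set δ : Sym2 (Fin n ⊕ Fin q) → ℝ := fun e => if e = s(b, c) then 1 else 0 with hδ
    have h2 : ∑ b', ∑ c', T.edgeTerm X δ b' c' = T.edgeTerm X δ b c + T.edgeTerm X δ c b := by
      rw [← Fintype.sum_prod_type' (f := fun x y => T.edgeTerm X δ x y),
        ← Finset.sum_subset (Finset.subset_univ {(b, c), (c, b)}),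
        Finset.sum_pair (by simp [hbc])]
      rintro ⟨x, y⟩ - hxy
      have : s(x, y) ≠ s(b, c) := by
        intro he
        apply hxy
        rcases Sym2.eq_iff.1 he with ⟨rfl, rfl⟩ | ⟨rfl, rfl⟩ <;> simp
      simp [edgeTerm, coshVar, hδ, this]
    rw [h2, T.edgeTerm_comm X δ b c] at h1
    linarith
  -- At an edge that is not a side, both vectors have products f b and f c with the ends. The tested
  -- relation gives equal products with the cross product of the ends, which completes them to a
  -- basis.
  have hconst : ∀ a d b c, {a, b, c} ∈ T.faces → {d, b, c} ∈ T.faces →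
      X {a, b, c} = X {d, b, c} := by
    intro a d b c ha hd
    by_cases had : a = d
    · rw [had]
    obtain ⟨-, -, hbc⟩ := T.ne_of_mem ha
    have hns : ¬ IsSide b c := by
      intro hs
      apply had
      have aux : ∀ i, ∀ x y, {x, Sum.inl i, Sum.inl (i + 1)} ∈ T.faces →
          {y, Sum.inl i, Sum.inl (i + 1)} ∈ T.faces → x = y := by
        intro i x y hx hy
        have h1 := T.sum_link_side hw hx fun z => if z = x then 1 else 0
        rw [T.sum_link_side hw hy] at h1
        by_contra hne
        simp [Ne.symm hne] at h1
      obtain ⟨i, ⟨rfl, rfl⟩ | ⟨rfl, rfl⟩⟩ := hs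
      · exact aux i a d ha hd
      · exact aux i a d (by rwa [face_swap] at ha) (by rwa [face_swap] at hd)
    obtain ⟨d', hd', hneg⟩ := T.exists_opposite hw ha hns
    have hdd : d = d' := by
      have h1 := T.sum_link_interior hw ha hd' hneg fun z => if z = d then 1 else 0
      rw [Finset.sum_eq_single d (fun x _ hx => by simp [hx]) (by simp), if_pos hd, if_pos rfl,
        if_neg had] at h1
      by_contra hne
      rw [if_neg (Ne.symm hne)] at h1
      norm_num at h1
    subst hdd
    have h1 := hterm b c hbc
    rw [Finset.sum_eq_zero, zero_add, edgeTerm, T.sum_link_interior hw ha hd hneg] at h1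
    · have hg := mform_sq_sub_one_pos (P.marked_mem hw b) (P.marked_mem hw c)
        (fun h => hbc (P.marked_injective hw hinj h))
      have hcv : coshVar P w (fun e => if e = s(b, c) then 1 else 0) b c ≠ 0 := by
        simp only [coshVar, if_true, mul_one]
        exact (Real.sinh_pos_iff.2 (hdist_pos (P.marked_mem hw b) (P.marked_mem hw c)
          (fun h => hbc (P.marked_injective hw hinj h)))).ne'
      have h2 := (mul_eq_zero.1 h1).resolve_left (div_ne_zero hcv hg.ne')
      have h3 : det3 (P.marked w b) (P.marked w c) (X {a, b, c}) =
          det3 (P.marked w b) (P.marked w c) (X {d, b, c}) := by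
        rcases mul_neg_iff.1 hneg with ⟨h4, h5⟩ | ⟨h4, h5⟩
        · rw [abs_of_pos h4, abs_of_neg h5, div_self h4.ne', div_neg, div_self h5.ne] at h2
          linarith
        · rw [abs_of_neg h4, abs_of_pos h5, div_self h5.ne', div_neg, div_self h4.ne] at h2
          linarith
      rw [← sub_eq_zero]
      refine eq_zero_of_mform_triple (a := P.marked w b) (b := P.marked w c)
        (c := mcross (P.marked w b) (P.marked w c)) ?_ ?_ ?_ ?_
      · rw [← mform_mcross, mform_mcross_mcross, (P.marked_mem hw b).1, (P.marked_mem hw c).1,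
          mform_comm (P.marked w c)]
        nlinarith
      · rw [mform_sub_left, hX _ ha b (by simp), hX _ hd b (by simp), sub_self]
      · rw [mform_sub_left, hX _ ha c (by simp), hX _ hd c (by simp), sub_self]
      · rw [mform_sub_left, mform_comm, mform_mcross, mform_comm, mform_mcross, h3, sub_self]
    · intro i _
      rw [if_neg, mul_zero]
      intro he
      apply hns
      rcases Sym2.eq_iff.1 he with ⟨h1, h2⟩ | ⟨h1, h2⟩
      · exact ⟨i, Or.inl ⟨h1.symm, h2.symm⟩⟩
      · exact ⟨i, Or.inr ⟨h1.symm, h2.symm⟩⟩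
  obtain ⟨σ, hσ⟩ := T.faces_nonempty
  have hall : ∀ τ ∈ T.faces, X τ = X σ := fun τ hτ =>
    T.eq_of_forall_adjacent hw hinj X hconst hτ hσ
  refine ⟨X σ, fun i => ?_, fun a => ?_⟩
  · obtain ⟨a, ha⟩ := T.exists_face_side hw i
    have h1 := hterm _ _ (T.ne_of_mem ha).2.2
    rw [T.edgeTerm_side hw ha, hall _ ha, Finset.sum_eq_single i, if_pos rfl] at h1
    · rw [mform_comm]
      linarith
    · intro j _ hj
      rw [if_neg (fun he => hj (side_injective P.three_le he)), mul_zero]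
    · simp
  · obtain ⟨τ, hτ, ha⟩ := T.vertex_used a
    rw [← hall τ hτ, hX τ hτ a ha]

/-- The variations that satisfy the vector equation are realized. -/
theorem exists_variations_eq (hinj : Function.Injective w)
    {y : (Fin n → ℝ) × (Fin n → ℝ) × (Fin q → ℝ)} (hy : balance P w y = 0) :
    ∃ δ, T.variations δ = y := by
  by_contra hcon
  have hy' : y ∉ LinearMap.range T.variations := hcon
  -- A functional separating `y` from the range turns out to be ⟨u, `balance` ·⟩ for some u, and so
  -- vanishes at `y`.
  obtain ⟨φ, hφy, hφ⟩ := Submodule.exists_dual_map_eq_bot_of_notMem hy' inferInstance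
  have hφ0 : ∀ δ, φ (T.variations δ) = 0 := by
    intro δ
    have : φ (T.variations δ) ∈ (LinearMap.range T.variations).map φ :=
      ⟨_, ⟨δ, rfl⟩, rfl⟩
    rwa [hφ, Submodule.mem_bot] at this
  set lam : Fin n → ℝ := fun i => φ (Pi.single i 1, 0, 0) with hlam
  set mu : Fin n → ℝ := fun i => φ (0, Pi.single i 1, 0) with hmu
  set nu : Fin q → ℝ := fun i => φ (0, 0, Pi.single i 1) with hnu
  have hrep : ∀ z, φ z = ∑ i, lam i * z.1 i + ∑ i, mu i * z.2.1 i + ∑ i, nu i * z.2.2 i := by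
    intro z
    have e1 := LinearMap.pi_apply_eq_sum_univ (φ.comp (LinearMap.inl ℝ _ _)) z.1
    have e2 := LinearMap.pi_apply_eq_sum_univ
      (φ.comp ((LinearMap.inr ℝ _ _).comp (LinearMap.inl ℝ _ _))) z.2.1
    have e3 := LinearMap.pi_apply_eq_sum_univ
      (φ.comp ((LinearMap.inr ℝ _ _).comp (LinearMap.inr ℝ _ _))) z.2.2
    have hs : ∀ m (i : Fin m), (fun j => if i = j then (1 : ℝ) else 0) = Pi.single i 1 := by
      intro m i
      ext j
      simp [Pi.single_apply, eq_comm]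
    simp only [LinearMap.comp_apply, LinearMap.inl_apply, LinearMap.inr_apply, hs,
      smul_eq_mul] at e1 e2 e3
    have : φ z = φ (z.1, 0) + φ (0, z.2.1, 0) + φ (0, 0, z.2.2) := by
      rw [← map_add, ← map_add]
      congr 1
      ext <;> simp
    rw [this, e1, e2, e3]
    simp [hlam, hmu, hnu, mul_comm]
    rfl
  -- Curvature is 2π minus the total angle, whence the sign of `nu`.
  obtain ⟨u, hu1, hu2⟩ := T.exists_of_relation hw hinj (lam := lam) (f := Sum.elim mu (-nu))
    (fun δ => by
      have := hφ0 δ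
      rw [hrep] at this
      rw [Fintype.sum_sum_type]
      simp only [variations_apply, Sum.elim_inl, Sum.elim_inr, Pi.neg_apply] at this ⊢
      simp only [mul_neg, neg_mul] at this ⊢
      linarith)
  apply hφy
  have hm := congrArg (mform u) hy
  rw [balance_apply, mform_sub_right, mform_add_right, mform_sum_right, mform_sum_right,
    mform_sum_right, mform_zero_right] at hm
  simp only [mform_smul_right, ← hu1] at hm
  have h1 : ∀ j, mform u (P.vertex j) = mu j := fun j => (hu2 (Sum.inl j)).symm
  have h2 : ∀ k, mform u (w k) = -nu k := fun k => (hu2 (Sum.inr k)).symm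
  simp only [h1, h2, mul_neg, Finset.sum_neg_distrib] at hm
  rw [hrep]
  simp only [mul_comm] at hm ⊢
  linarith

end Triangulation

/-! ### Motions of the marked points -/

/-- The velocities of all marked points when the points `w k` move in the hyperbolic plane with
horizontal velocities `η k`. -/
def motion {n q : ℕ} (w : Fin q → Mink) (η : Fin q → Fin 2 → ℝ) : Fin n ⊕ Fin q → Mink :=
  Sum.elim 0 fun k => ![η k 0, η k 1, (w k 0 * η k 0 + w k 1 * η k 1) / w k 2]

@[simp] theorem motion_inl {n q : ℕ} (w : Fin q → Mink) (η : Fin q → Fin 2 → ℝ) (j : Fin n) :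
    motion w η (Sum.inl j : Fin n ⊕ Fin q) = 0 := rfl

/-- The variation of the edge lengths for given velocities of the marked points. -/
def lengthVar {n q : ℕ} [NeZero n] (P : ConvexPolygon n) (w : Fin q → Mink)
    (ξ : Fin n ⊕ Fin q → Mink) : Sym2 (Fin n ⊕ Fin q) → ℝ :=
  Sym2.lift ⟨fun a b => (Real.sinh (hdist (P.marked w a) (P.marked w b)))⁻¹ *
    -(mform (ξ a) (P.marked w b) + mform (P.marked w a) (ξ b)), fun a b => by
      dsimp only
      rw [hdist_comm, mform_comm (ξ a), mform_comm _ (ξ b), add_comm]⟩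

theorem lengthVar_mk {n q : ℕ} [NeZero n] (P : ConvexPolygon n) (w : Fin q → Mink)
    (ξ : Fin n ⊕ Fin q → Mink) (a b : Fin n ⊕ Fin q) : lengthVar P w ξ s(a, b) =
    (Real.sinh (hdist (P.marked w a) (P.marked w b)))⁻¹ *
      -(mform (ξ a) (P.marked w b) + mform (P.marked w a) (ξ b)) := rfl

/-- A linear map is skew for the Minkowski form if it is so on a basis. -/
theorem skew_of_triple {a b c : Mink} (h : det3 a b c ≠ 0) {L : Mink →ₗ[ℝ] Mink}
    (haa : mform (L a) a = 0) (hbb : mform (L b) b = 0) (hcc : mform (L c) c = 0)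
    (hab : mform (L a) b + mform a (L b) = 0) (hac : mform (L a) c + mform a (L c) = 0)
    (hbc : mform (L b) c + mform b (L c) = 0) (x y : Mink) :
    mform (L x) y + mform x (L y) = 0 := by
  rw [cramer' h x, cramer' h y]
  simp only [map_add, map_smul, mform_add_left, mform_add_right, mform_smul_left,
    mform_smul_right]
  rw [mform_comm a (L a), mform_comm b (L b), mform_comm c (L c), mform_comm b (L a),
    mform_comm c (L a), mform_comm c (L b), haa, hbb, hcc]
  rw [mform_comm a (L b)] at hab ⊢
  rw [mform_comm a (L c)] at hac ⊢
  rw [mform_comm b (L c)] at hbc ⊢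
  linear_combination
    ((det3 b c x / det3 a b c) * (det3 c a y / det3 a b c) +
      (det3 c a x / det3 a b c) * (det3 b c y / det3 a b c)) * hab +
    ((det3 b c x / det3 a b c) * (det3 a b y / det3 a b c) +
      (det3 a b x / det3 a b c) * (det3 b c y / det3 a b c)) * hac +
    ((det3 c a x / det3 a b c) * (det3 a b y / det3 a b c) +
      (det3 a b x / det3 a b c) * (det3 c a y / det3 a b c)) * hbc

/-- The linear map with given values on a basis. -/
theorem exists_linearMap_triple {a b c : Mink} (h : det3 a b c ≠ 0) (x y z : Mink) :
    ∃ L : Mink →ₗ[ℝ] Mink, L a = x ∧ L b = y ∧ L c = z := by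
  refine ⟨(det3 a b c)⁻¹ • ((mformL (mcross b c)).smulRight x + (mformL (mcross c a)).smulRight y +
    (mformL (mcross a b)).smulRight z), ?_, ?_, ?_⟩ <;>
  simp [mform_mcross, det3_self_mid, det3_self_right, det3_rotate a b c, det3_rotate' a b c,
    smul_smul, h]

theorem linearMap_ext_triple {a b c : Mink} (h : det3 a b c ≠ 0) {L M : Mink →ₗ[ℝ] Mink}
    (ha : L a = M a) (hb : L b = M b) (hc : L c = M c) : L = M := by
  refine LinearMap.ext fun x => ?_
  rw [cramer' h x]
  simp only [map_add, map_smul, ha, hb, hc]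

section Motion

variable {n q : ℕ} [NeZero n] {P : ConvexPolygon n} {w : Fin q → Mink} (T : Triangulation P w)

variable (hw : ∀ k, w k ∈ P.interior) (hinj : Function.Injective w)
include hw

theorem mform_motion (η : Fin q → Fin 2 → ℝ) (a : Fin n ⊕ Fin q) :
    mform (motion w η a) (P.marked w a) = 0 := by
  rcases a with j | k
  · simp
  · have := (hw k).1.2.ne'
    simp only [motion, Sum.elim_inr, mform, P.marked_inr]
    simp
    field_simp
    ring

include hinj

theorem sinh_hdist_pos {a b : Fin n ⊕ Fin q} (hab : a ≠ b) :
    0 < Real.sinh (hdist (P.marked w a) (P.marked w b)) :=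
  Real.sinh_pos_iff.2 (hdist_pos (P.marked_mem hw a) (P.marked_mem hw b)
    fun h => hab (P.marked_injective hw hinj h))

theorem coshVar_lengthVar (ξ : Fin n ⊕ Fin q → Mink) {a b : Fin n ⊕ Fin q} (hab : a ≠ b) :
    Triangulation.coshVar P w (lengthVar P w ξ) a b =
      -(mform (ξ a) (P.marked w b) + mform (P.marked w a) (ξ b)) := by
  rw [Triangulation.coshVar, lengthVar_mk, mul_inv_cancel_left₀ (sinh_hdist_pos hw hinj hab).ne']

/-- Moving the marked points changes neither the polygon nor the curvatures. -/
theorem totalAngleVar_lengthVar (η : Fin q → Fin 2 → ℝ) (a : Fin n ⊕ Fin q) :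
    T.totalAngleVar a (lengthVar P w (motion w η)) = 0 := by
  set p := P.marked w with hp
  set ξ : Fin n ⊕ Fin q → Mink := motion w η with hξ
  -- With the orientation sign `s` of the face, each angle variation at `a` is `s` times the
  -- difference of the rotation speeds of the two sides at `a`.
  set s : Fin n ⊕ Fin q → Fin n ⊕ Fin q → ℝ := fun b c =>
    if {a, b, c} ∈ T.faces then det3 (p a) (p b) (p c) / |det3 (p a) (p b) (p c)| else 0 with hs
  have h1 : ∀ b c, (if {a, b, c} ∈ T.faces then angleVar (p a) (p b) (p c)
      (Triangulation.coshVar P w (lengthVar P w ξ) b c)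
      (Triangulation.coshVar P w (lengthVar P w ξ) a b)
      (Triangulation.coshVar P w (lengthVar P w ξ) a c) else 0) =
      s b c * rotationVar (p a) (p c) (ξ a) (ξ c) -
        s b c * rotationVar (p a) (p b) (ξ a) (ξ b) := by
    intro b c
    simp only [hs]
    split_ifs with hf
    · obtain ⟨n1, n2, n3⟩ := T.ne_of_mem hf
      rw [coshVar_lengthVar hw hinj _ n1, coshVar_lengthVar hw hinj _ n2,
        coshVar_lengthVar hw hinj _ n3, angleVar_of_velocity (P.marked_mem hw a)
          (P.marked_mem hw b) (P.marked_mem hw c) (T.det3_ne_zero hf) (mform_motion hw η a)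
          (mform_motion hw η b) (mform_motion hw η c)]
      ring
    · ring
  have hanti : ∀ b c, s c b = -s b c := by
    intro b c
    simp only [hs]
    rw [face_swap]
    split_ifs
    · rw [det3_swap, abs_neg, neg_div]
    · simp
  -- The two faces at an interior edge have opposite signs, while the ends of a side of the polygon
  -- do not move.
  have h2 : ∀ b, (∑ c, s b c) * rotationVar (p a) (p b) (ξ a) (ξ b) = 0 := by
    intro b
    by_cases hside : Triangulation.IsSide a b
    · have : ξ a = 0 ∧ ξ b = 0 := by
        obtain ⟨i, ⟨rfl, rfl⟩ | ⟨rfl, rfl⟩⟩ := hside <;> exact ⟨rfl, rfl⟩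
      rw [this.1, this.2]
      simp [rotationVar, ← mform_mcross]
    · have := T.sum_link_sign_eq_zero hw hside
      simp only [hs]
      have h3 : ∀ c, ({c, a, b} : Finset (Fin n ⊕ Fin q)) = {a, b, c} := fun c =>
        face_rotate.symm
      simp only [h3, ← hp] at this
      rw [this, zero_mul]
  rw [T.totalAngleVar_apply]
  simp only [← hp, h1, Finset.sum_sub_distrib, ← Finset.sum_mul]
  rw [Finset.sum_comm]
  have h3 : ∑ c, ∑ b, s b c * rotationVar (p a) (p c) (ξ a) (ξ c) = 0 := by
    refine Finset.sum_eq_zero fun c _ => ?_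
    rw [← Finset.sum_mul]
    have : ∑ b, s b c = -∑ b, s c b := by
      rw [← Finset.sum_neg_distrib]
      exact Finset.sum_congr rfl fun b _ => by rw [hanti c b]
    rw [this, neg_mul, h2, neg_zero]
  rw [h3, Finset.sum_eq_zero fun b _ => h2 b]
  simp

theorem variations_lengthVar (η : Fin q → Fin 2 → ℝ) :
    T.variations (lengthVar P w (motion w η)) = 0 := by
  rw [T.variations_apply]
  simp only [totalAngleVar_lengthVar T hw hinj, lengthVar_mk, motion_inl]
  ext <;> simp

/-- A motion that fixes the vertices of the polygon and preserves the edge lengths to first order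
is zero. -/
theorem motion_eq_zero {ξ : Fin n ⊕ Fin q → Mink} (hξ : ∀ a, mform (ξ a) (P.marked w a) = 0)
    (hξ0 : ∀ j, ξ (Sum.inl j) = 0)
    (h : ∀ a b, T.Adj a b → mform (ξ a) (P.marked w b) + mform (P.marked w a) (ξ b) = 0) :
    ξ = 0 := by
  have hex : ∀ σ ∈ T.faces, ∃ L : Mink →ₗ[ℝ] Mink, ∀ a ∈ σ, L (P.marked w a) = ξ a := by
    intro σ hσ
    obtain ⟨a, b, c, rfl⟩ := T.exists_eq_triple hσ
    obtain ⟨L, h1, h2, h3⟩ := exists_linearMap_triple (T.det3_ne_zero hσ) (ξ a) (ξ b) (ξ c)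
    refine ⟨L, fun x hx => ?_⟩
    simp only [Finset.mem_insert, Finset.mem_singleton] at hx
    rcases hx with rfl | rfl | rfl <;> assumption
  choose! L hL using hex
  -- On a face the linear map is skew, that is, an infinitesimal isometry. With the length
  -- conditions on `db` and `dc`, skewness makes `L {a, b, c}` at `d` minus `ξ d` orthogonal to `d`,
  -- `b` and `c`, so the map of one face has the right value at the far vertex of the other.
  have hconst : ∀ a d b c, {a, b, c} ∈ T.faces → {d, b, c} ∈ T.faces →
      L {a, b, c} = L {d, b, c} := by
    intro a d b c ha hd
    have la := hL _ ha a (by simp)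
    have lb := hL _ ha b (by simp)
    have lc := hL _ ha c (by simp)
    have kd := hL _ hd d (by simp)
    have kb := hL _ hd b (by simp)
    have kc := hL _ hd c (by simp)
    obtain ⟨a1, a2, a3⟩ := T.adj_of_face' ha
    obtain ⟨d1, d2, d3⟩ := T.adj_of_face' hd
    have skew := skew_of_triple (T.det3_ne_zero ha) (L := L {a, b, c}) (by rw [la, hξ])
      (by rw [lb, hξ]) (by rw [lc, hξ]) (by rw [la, lb, h _ _ a2]) (by rw [la, lc, h _ _ a3])
      (by rw [lb, lc, h _ _ a1])
    refine linearMap_ext_triple (T.det3_ne_zero hd) ?_ (by rw [lb, kb]) (by rw [lc, kc])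
    rw [kd, ← sub_eq_zero]
    have s1 := skew (P.marked w d) (P.marked w d)
    have s2 := skew (P.marked w d) (P.marked w b)
    have s3 := skew (P.marked w d) (P.marked w c)
    rw [lb] at s2
    rw [lc] at s3
    rw [mform_comm (P.marked w d)] at s1
    refine eq_zero_of_mform_triple (T.det3_ne_zero hd) ?_ ?_ ?_ <;> rw [mform_sub_left]
    · rw [hξ]; linarith
    · linarith [h _ _ d2]
    · linarith [h _ _ d3]
  obtain ⟨σ, hσ⟩ := T.faces_nonempty
  have hall : ∀ a, L σ (P.marked w a) = ξ a := by
    intro a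
    obtain ⟨τ, hτ, ha⟩ := T.vertex_used a
    rw [T.eq_of_forall_adjacent hw hinj L hconst hσ hτ, hL τ hτ a ha]
  obtain ⟨i, j, k, hijk⟩ := P.exists_det3_vertex_ne_zero
  have hv : ∀ i, L σ (P.vertex i) = 0 := fun i => (hall (Sum.inl i)).trans (hξ0 i)
  have hL0 : L σ = 0 := linearMap_ext_triple hijk (by simp [hv]) (by simp [hv]) (by simp [hv])
  ext1 a
  rw [← hall a, hL0]
  rfl

/-- The variations of the edge lengths that change neither the lengths of the sides, nor the
angles, nor the curvatures, are those that come from motions of the points `w k`. -/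
theorem variations_eq_zero_iff (δ : Sym2 (Fin n ⊕ Fin q) → ℝ) :
    T.variations δ = 0 ↔
      ∃ η, ∀ a b, T.Adj a b → δ s(a, b) = lengthVar P w (motion w η) s(a, b) := by
  constructor
  swap
  · rintro ⟨η, h⟩
    rw [T.variations_congr hw h, variations_lengthVar T hw hinj]
  classical
  intro hδ
  -- variations of the lengths of actual edges
  set ext : (T.edges → ℝ) →ₗ[ℝ] (Sym2 (Fin n ⊕ Fin q) → ℝ) :=
    { toFun := fun f e => if h : e ∈ T.edges then f ⟨e, h⟩ else 0
      map_add' := fun f g => by ext e; by_cases h : e ∈ T.edges <;> simp [h]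
      map_smul' := fun r f => by ext e; by_cases h : e ∈ T.edges <;> simp [h] } with hext
  set res : (Sym2 (Fin n ⊕ Fin q) → ℝ) →ₗ[ℝ] (T.edges → ℝ) :=
    LinearMap.funLeft ℝ ℝ (fun e : T.edges => e.1) with hres
  have hextres : ∀ δ a b, T.Adj a b → ext (res δ) s(a, b) = δ s(a, b) := by
    intro δ a b hab
    have : s(a, b) ∈ T.edges := T.mem_edges.2 hab
    simp [hext, hres, this, LinearMap.funLeft_apply]
  set Φ := T.variations.comp ext with hΦ
  set Ψ : (Fin q → Fin 2 → ℝ) →ₗ[ℝ] (T.edges → ℝ) := res.comp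
    { toFun := fun η => lengthVar P w (motion w η)
      map_add' := fun η ζ => by
        ext e
        induction e with | _ a b =>
        rw [Pi.add_apply, lengthVar_mk, lengthVar_mk, lengthVar_mk]
        have : ∀ c : Fin n ⊕ Fin q, motion w (η + ζ) c = motion w η c + motion w ζ c := by
          rintro (j | k)
          · simp
          · ext i
            fin_cases i <;> simp [motion]
            ring
        rw [this, this, mform_add_left, mform_add_right]
        ring
      map_smul' := fun r η => by
        ext e
        induction e with | _ a b =>
        rw [Pi.smul_apply, lengthVar_mk, lengthVar_mk]
        have : ∀ c : Fin n ⊕ Fin q, motion w (r • η) c = r • motion w η c := by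
          rintro (j | k)
          · simp
          · ext i
            fin_cases i <;> simp [motion]
            ring
        rw [this, this, mform_smul_left, mform_smul_right, RingHom.id_apply, smul_eq_mul]
        ring } with hΨ
  have hΨa : ∀ η, Ψ η = res (lengthVar P w (motion w η)) := fun η => rfl
  have hrange : LinearMap.range Φ = LinearMap.ker (balance P w) := by
    ext y
    rw [LinearMap.mem_range, LinearMap.mem_ker]
    constructor
    · rintro ⟨f, rfl⟩
      exact T.balance_variations hw _
    · intro hy
      obtain ⟨ε, rfl⟩ := T.exists_variations_eq hw hinj hy
      exact ⟨res ε, T.variations_congr hw (hextres ε)⟩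
  have hΨinj : Function.Injective Ψ := by
    rw [← LinearMap.ker_eq_bot, LinearMap.ker_eq_bot']
    intro η hη
    have h0 : motion w η = (0 : Fin n ⊕ Fin q → Mink) := by
      refine motion_eq_zero T hw hinj (mform_motion hw η) (fun j => rfl) fun a b hab => ?_
      have h1 : lengthVar P w (motion w η) s(a, b) = 0 := by
        rw [← hextres (lengthVar P w (motion w η)) a b hab, ← hΨa, hη]
        simp
      rw [lengthVar_mk, mul_eq_zero, inv_eq_zero, neg_eq_zero] at h1
      exact h1.resolve_left (sinh_hdist_pos hw hinj hab.1).ne'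
    ext k i
    have h1 := congrFun h0 (Sum.inr k)
    fin_cases i
    · simpa [motion] using congrFun h1 0
    · simpa [motion] using congrFun h1 1
  have hle : LinearMap.range Ψ ≤ LinearMap.ker Φ := by
    rintro _ ⟨η, rfl⟩
    rw [LinearMap.mem_ker, hΦ, LinearMap.comp_apply, hΨa, T.variations_congr hw (hextres _),
      variations_lengthVar T hw hinj]
  -- dim ker Φ = |E| - dim ker B = |E| - (2n + q - 3) ≤ 2q = dim range Ψ.
  have hdim : Module.finrank ℝ (LinearMap.ker Φ) ≤ Module.finrank ℝ (LinearMap.range Ψ) := by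
    have e1 := LinearMap.finrank_range_add_finrank_ker Φ
    have e2 := LinearMap.finrank_range_add_finrank_ker (balance P w)
    have e3 := LinearMap.finrank_range_of_inj hΨinj
    rw [LinearMap.range_eq_top.2 (balance_surjective P w), finrank_top] at e2
    rw [hrange] at e1
    have e4 := T.card_edges_le hw hinj
    have f1 : Module.finrank ℝ (T.edges → ℝ) = T.edges.card := by simp
    have f2 : Module.finrank ℝ Mink = 3 := by simp
    have f3 : Module.finrank ℝ ((Fin n → ℝ) × (Fin n → ℝ) × (Fin q → ℝ)) = n + (n + q) := by
      simp
    have f4 : Module.finrank ℝ (Fin q → Fin 2 → ℝ) = q * 2 := by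
      simp [Module.finrank_pi_fintype]
    omega
  have heq := Submodule.eq_of_le_of_finrank_le hle hdim
  have hmem : res δ ∈ LinearMap.range Ψ := by
    rw [heq, LinearMap.mem_ker, hΦ, LinearMap.comp_apply, T.variations_congr hw (hextres _), hδ]
  obtain ⟨η, hη⟩ := hmem
  refine ⟨η, fun a b hab => ?_⟩
  rw [← hextres δ a b hab, ← hextres (lengthVar P w (motion w η)) a b hab, ← hΨa, hη]

end Motion

/-! ### Deformations -/

variable {n q : ℕ} [NeZero n] {P : ConvexPolygon n} {w : Fin q → Mink} (T : Triangulation P w)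

/-- The deformation with velocity `η` of a point `x` of the hyperbolic plane. -/
def moveCurve (x : Mink) (η : Fin 2 → ℝ) (t : ℝ) : Mink :=
  ![x 0 + t * η 0, x 1 + t * η 1,
    √(1 + (x 0 + t * η 0) ^ 2 + (x 1 + t * η 1) ^ 2)]

theorem moveCurve_mem (x : Mink) (η : Fin 2 → ℝ) (t : ℝ) : moveCurve x η t ∈ hypPlane := by
  have h : 0 < 1 + (x 0 + t * η 0) ^ 2 + (x 1 + t * η 1) ^ 2 := by positivity
  refine ⟨?_, Real.sqrt_pos.2 h⟩
  have := Real.mul_self_sqrt h.le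
  simp only [mform, moveCurve, Matrix.cons_val_zero, Matrix.cons_val_one, Matrix.cons_val]
  rw [this]
  ring

theorem sqrt_of_mem_hypPlane {x : Mink} (hx : x ∈ hypPlane) :
    √(1 + x 0 ^ 2 + x 1 ^ 2) = x 2 := by
  have h := hx.1
  rw [mform] at h
  rw [show 1 + x 0 ^ 2 + x 1 ^ 2 = x 2 ^ 2 by linarith, Real.sqrt_sq hx.2.le]

theorem moveCurve_zero {x : Mink} (hx : x ∈ hypPlane) (η : Fin 2 → ℝ) : moveCurve x η 0 = x := by
  have := sqrt_of_mem_hypPlane hx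
  ext i
  fin_cases i <;> simp [moveCurve, this]

theorem hasDerivAt_moveCurve {x : Mink} (hx : x ∈ hypPlane) (η : Fin 2 → ℝ) :
    HasDerivAt (moveCurve x η) ![η 0, η 1, (x 0 * η 0 + x 1 * η 1) / x 2] 0 := by
  have h0 : HasDerivAt (fun t : ℝ => x 0 + t * η 0) (η 0) 0 := by
    simpa using ((hasDerivAt_id (0 : ℝ)).mul_const (η 0)).const_add (x 0)
  have h1 : HasDerivAt (fun t : ℝ => x 1 + t * η 1) (η 1) 0 := by
    simpa using ((hasDerivAt_id (0 : ℝ)).mul_const (η 1)).const_add (x 1)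
  have hpos : 0 < 1 + (x 0 + 0 * η 0) ^ 2 + (x 1 + 0 * η 1) ^ 2 := by positivity
  have h2 := (((h0.pow 2).const_add 1).add (h1.pow 2)).sqrt hpos.ne'
  rw [hasDerivAt_pi]
  intro i
  fin_cases i
  · simpa [moveCurve] using h0
  · simpa [moveCurve] using h1
  · refine h2.congr_deriv ?_
    have h3 := sqrt_of_mem_hypPlane hx
    have h4 := hx.2.ne'
    simp
    rw [h3]
    field_simp

/-- The velocity of a curve in the hyperboloid is tangent, so its horizontal part determines it;
`moveCurve` realizes every horizontal velocity. -/
theorem isTrivial_iff (hw : ∀ k, w k ∈ P.interior) (hinj : Function.Injective w)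
    (δ : Sym2 (Fin n ⊕ Fin q) → ℝ) : T.IsTrivial δ ↔
      ∃ η, ∀ a b, T.Adj a b → δ s(a, b) = lengthVar P w (motion w η) s(a, b) := by
  have key : ∀ c : ℝ → Fin q → Mink, c 0 = w → ∀ η, (∀ a, HasDerivAt (fun t => P.marked (c t) a)
      (motion w η a) 0) → ∀ a b, a ≠ b → HasDerivAt
        (fun t => hdist (P.marked (c t) a) (P.marked (c t) b))
        (lengthVar P w (motion w η) s(a, b)) 0 := by
    intro c hc η hcd a b hab
    have := hasDerivAt_hdist (hcd a) (hcd b) (by rw [hc]; exact P.marked_mem hw a)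
      (by rw [hc]; exact P.marked_mem hw b)
      (by rw [hc]; exact fun h => hab (P.marked_injective hw hinj h))
    rwa [hc] at this
  constructor
  · rintro ⟨c, hc0, hcm, hcd, h⟩
    set η : Fin q → Fin 2 → ℝ := fun k => ![deriv c 0 k 0, deriv c 0 k 1] with hη
    refine ⟨η, fun a b hab => (h a b hab).unique (key c hc0 η ?_ a b hab.1)⟩
    rintro (j | k)
    · exact hasDerivAt_const _ _
    · have hk : HasDerivAt (fun t => c t k) (deriv c 0 k) 0 :=
        hasDerivAt_pi.1 hcd.hasDerivAt k
      have hki := fun i => hasDerivAt_pi.1 hk i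
      have hm : HasDerivAt (fun t => mform (c t k) (c t k))
          (2 * mform (deriv c 0 k) (w k)) 0 := by
        refine ((((hki 0).mul (hki 0)).add ((hki 1).mul (hki 1))).sub
          ((hki 2).mul (hki 2))).congr_deriv ?_
        simp only [mform, hc0]
        ring
      have hm0 : (fun t => mform (c t k) (c t k)) = fun _ => -1 := funext fun t => (hcm t k).1
      rw [hm0] at hm
      have h0 := (hasDerivAt_const (0 : ℝ) (-1 : ℝ)).unique hm
      refine hk.congr_deriv ?_
      have h2 := (hw k).1.2.ne'
      have h3 : deriv c 0 k 2 = (w k 0 * deriv c 0 k 0 + w k 1 * deriv c 0 k 1) / w k 2 := by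
        rw [eq_div_iff h2]
        rw [mform] at h0
        linarith
      ext i
      fin_cases i <;> simp [motion, hη, h3]
  · rintro ⟨η, h⟩
    refine ⟨fun t k => moveCurve (w k) (η k) t, ?_, fun t k => moveCurve_mem _ _ _, ?_, ?_⟩
    · ext1 k
      exact moveCurve_zero (hw k).1 _
    · refine differentiableAt_pi.2 fun k => ?_
      exact (hasDerivAt_moveCurve (hw k).1 (η k)).differentiableAt
    · intro a b hab
      rw [h a b hab]
      refine key _ (funext fun k => moveCurve_zero (hw k).1 _) η ?_ a b hab.1
      rintro (j | k)
      · exact hasDerivAt_const _ _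
      · exact hasDerivAt_moveCurve (hw k).1 (η k)

/-- Lengths and angles are differentiable along a deformation, so uniqueness of derivatives makes
the condition depend on the velocity only. -/
theorem ConeDeformation.realizes_iff {T : Triangulation P w} (hw : ∀ k, w k ∈ P.interior)
    (D : ConeDeformation T) (l' α' : Fin n → ℝ) (θ' : Fin q → ℝ) :
    D.Realizes l' α' θ' ↔ T.variations D.velocity = (l', α', θ') := by
  have h1 := fun i => D.hasDerivAt _ _ (T.adj_side hw i)
  have h2 := T.hasDerivAt_totalAngle hw D.length_zero D.hasDerivAt
  have h3 : ∀ k, HasDerivAt (fun t => T.curvature (D.length t) k)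
      (-T.totalAngleVar (Sum.inr k) D.velocity) 0 := fun k =>
    (h2 (Sum.inr k)).const_sub (2 * Real.pi)
  rw [T.variations_apply, Prod.mk.injEq, Prod.mk.injEq, funext_iff, funext_iff, funext_iff]
  constructor
  · rintro ⟨e1, e2, e3⟩
    exact ⟨fun i => (h1 i).unique (e1 i), fun j => (h2 _).unique (e2 j),
      fun k => (h3 k).unique (e3 k)⟩
  · rintro ⟨e1, e2, e3⟩
    exact ⟨fun i => e1 i ▸ h1 i, fun j => e2 j ▸ h2 (Sum.inl j), fun k => e3 k ▸ h3 k⟩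

/-- Every variation of the edge lengths is the velocity of a deformation. -/
theorem exists_deformation (hw : ∀ k, w k ∈ P.interior) (hinj : Function.Injective w)
    (δ : Sym2 (Fin n ⊕ Fin q) → ℝ) : ∃ D : ConeDeformation T, D.velocity = δ := by
  set ℓ : Sym2 (Fin n ⊕ Fin q) → ℝ :=
    Sym2.lift ⟨fun a b => hdist (P.marked w a) (P.marked w b), fun a b => hdist_comm _ _⟩ with hℓ
  have hℓa : ∀ a b, ℓ s(a, b) = hdist (P.marked w a) (P.marked w b) := fun a b => rfl
  have ht : ∀ e, Tendsto (fun t : ℝ => ℓ e + t * δ e) (𝓝 0) (𝓝 (ℓ e)) := by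
    intro e
    have : Continuous fun t : ℝ => ℓ e + t * δ e := by fun_prop
    simpa using this.tendsto 0
  -- An affine family suffices: the strict inequalities hold at t = 0 and persist for small t.
  refine ⟨{ length := fun t e => ℓ e + t * δ e
            velocity := δ
            length_zero := fun a b _ => by rw [zero_mul, add_zero, hℓa]
            isConeMetric := ?_
            hasDerivAt := fun a b _ => ?_ }, rfl⟩
  · refine Filter.Eventually.and ?_ ?_
    · simp only [Filter.eventually_all]
      intro a b hab
      refine (ht s(a, b)).eventually (lt_mem_nhds ?_)
      exact hdist_pos (P.marked_mem hw a) (P.marked_mem hw b)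
        fun h => hab.1 (P.marked_injective hw hinj h)
    · simp only [Filter.eventually_all]
      intro a b c hf
      refine (ht s(a, b)).eventually_lt ((ht s(a, c)).add (ht s(c, b))) ?_
      exact hdist_lt_add (P.marked_mem hw a) (P.marked_mem hw b) (P.marked_mem hw c)
        (T.det3_ne_zero hf)
  · simpa using ((hasDerivAt_id (0 : ℝ)).mul_const (δ s(a, b))).const_add (ℓ s(a, b))

theorem realizable_iff (hw : ∀ k, w k ∈ P.interior) (hinj : Function.Injective w)
    (l' α' : Fin n → ℝ) (θ' : Fin q → ℝ) : (∃ D : ConeDeformation T, D.Realizes l' α' θ') ↔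
      ∑ i, l' i • P.edgeDual i + ∑ j, α' j • P.vertex j - ∑ k, θ' k • w k = 0 := by
  constructor
  · rintro ⟨D, hD⟩
    rw [D.realizes_iff hw] at hD
    have := T.balance_variations hw D.velocity
    rwa [hD] at this
  · intro h
    obtain ⟨δ, hδ⟩ := T.exists_variations_eq hw hinj (y := (l', α', θ')) h
    obtain ⟨D, rfl⟩ := exists_deformation T hw hinj δ
    exact ⟨D, (D.realizes_iff hw _ _ _).2 hδ⟩

theorem realizes_iff_isTrivial_sub {T : Triangulation P w} (hw : ∀ k, w k ∈ P.interior)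
    (hinj : Function.Injective w) {l' α' : Fin n → ℝ} {θ' : Fin q → ℝ}
    {D₁ : ConeDeformation T} (h : D₁.Realizes l' α' θ') (D₂ : ConeDeformation T) :
    D₂.Realizes l' α' θ' ↔ T.IsTrivial (D₂.velocity - D₁.velocity) := by
  rw [ConeDeformation.realizes_iff hw] at h ⊢
  rw [isTrivial_iff T hw hinj, ← variations_eq_zero_iff T hw hinj, map_sub, h, sub_eq_zero]

/-! ### Existence of triangulations -/

section Lower

variable {ι : Type*} [Fintype ι] [DecidableEq ι] (pos : ι → Mink) (h : ι → ℝ)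

/-- The linear functional of `u` lies below the heights `h`. -/
def Below (u : Mink) : Prop := ∀ a, mform u (pos a) ≤ h a

/-- The height function takes the values of no linear functional on any dependent set. -/
def GenericHeights : Prop :=
  ∀ S : Finset ι, (∃ u, ∀ a ∈ S, mform u (pos a) = h a) →
    LinearIndependent ℝ (fun a : S => pos a)

/-- The faces of the lower hull of the points `pos a` with heights `h a`. -/
def IsLowerFace (σ : Finset ι) : Prop :=
  ∃ u, (∀ a ∈ σ, mform u (pos a) = h a) ∧ ∀ a ∉ σ, mform u (pos a) < h a

variable {pos h}

/-- The heights are -1 + ε g, where g gives a functional that is nonzero on a chosen relation of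
every dependent set. Outside finitely many ε the heights violate all these relations, and small ε
gives the inequalities. Near-constancy of the heights is what later makes every marked point a
vertex. -/
theorem exists_genericHeights {η : ℝ} (hη : 0 < η) :
    ∃ h : ι → ℝ, GenericHeights pos h ∧ (∀ a, h a < 0) ∧ ∀ a b, (1 + η) * h a < h b := by
  have hdep : ∀ S : {S : Finset ι // ¬ LinearIndependent ℝ (fun a : S => pos a)},
      ∃ d : ι → ℝ, d ≠ 0 ∧ (∀ a ∉ S.1, d a = 0) ∧ ∑ a, d a • pos a = 0 := by
    rintro ⟨S, hS⟩
    obtain ⟨g, hg, i, hi⟩ := Fintype.not_linearIndependent_iff.1 hS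
    refine ⟨fun a => if h : a ∈ S then g ⟨a, h⟩ else 0, fun h0 => hi ?_, fun a ha => ?_, ?_⟩
    · have := congrFun h0 i.1
      simpa using this
    · simp [ha]
    · rw [← hg, ← Finset.sum_subset (Finset.subset_univ S), ← Finset.sum_coe_sort S]
      · exact Finset.sum_congr rfl fun a _ => by simp
      · intro a _ ha
        simp [ha]
  choose d hd0 hdS hd using hdep
  obtain ⟨f, hf⟩ := Module.exists_dual_forall_apply_ne_zero (K := ℝ) d hd0
  set g : ι → ℝ := fun a => f (Pi.single a 1) with hg
  have hfg : ∀ v : ι → ℝ, f v = ∑ a, v a * g a := by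
    intro v
    rw [LinearMap.pi_apply_eq_sum_univ f v]
    refine Finset.sum_congr rfl fun a _ => ?_
    rw [smul_eq_mul, hg]
    congr 2
    ext b
    simp [Pi.single_apply, eq_comm]
  have ht : ∀ a, Tendsto (fun ε : ℝ => -1 + ε * g a) (𝓝[>] 0) (𝓝 (-1)) := by
    intro a
    have : Continuous fun ε : ℝ => -1 + ε * g a := by fun_prop
    have := this.tendsto 0
    simp only [zero_mul, add_zero] at this
    exact this.mono_left nhdsWithin_le_nhds
  have hev : ∀ᶠ ε in 𝓝[>] (0 : ℝ), (∀ a, -1 + ε * g a < 0) ∧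
      ∀ a b, (1 + η) * (-1 + ε * g a) < -1 + ε * g b := by
    refine Filter.Eventually.and ?_ ?_
    · rw [Filter.eventually_all]
      exact fun a => (ht a).eventually (gt_mem_nhds (by norm_num))
    · simp only [Filter.eventually_all]
      exact fun a b => ((ht a).const_mul (1 + η)).eventually_lt (ht b) (by linarith)
  obtain ⟨r, hr, hsub⟩ := mem_nhdsGT_iff_exists_Ioo_subset.1 hev
  have hfin : (⋃ S, {ε : ℝ | ∑ a, d S a * -1 + ε * f (d S) + ε ^ 2 * 0 = 0}).Finite :=
    Set.finite_iUnion fun S => finite_quadratic fun h0 => hf S h0.2.1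
  obtain ⟨ε, hε, hε2⟩ := ((Set.Ioo_infinite hr).sdiff hfin).nonempty
  obtain ⟨h1, h2⟩ := hsub hε
  refine ⟨fun a => -1 + ε * g a, ?_, h1, h2⟩
  rintro S ⟨u, hu⟩
  by_contra hS
  refine hε2 (Set.mem_iUnion.2 ⟨⟨S, hS⟩, ?_⟩)
  set dS := d ⟨S, hS⟩ with hdSd
  have h3 : ∑ a, dS a * mform u (pos a) = 0 := by
    have := congrArg (mform u) (hd ⟨S, hS⟩)
    simpa only [mform_sum_right, mform_smul_right, mform_zero_right] using this
  have h4 : ∀ a, dS a * mform u (pos a) = dS a * (-1 + ε * g a) := by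
    intro a
    by_cases ha : a ∈ S
    · rw [hu a ha]
    · rw [hdSd, hdS ⟨S, hS⟩ a ha, zero_mul, zero_mul]
  simp only [h4] at h3
  simp only [Set.mem_ofPred_eq, mul_zero, add_zero, hfg]
  rw [← h3, Finset.mul_sum, ← Finset.sum_add_distrib]
  exact Finset.sum_congr rfl fun a _ => by ring

theorem eq_of_mform_triple {a b c : Mink} (h : det3 a b c ≠ 0) (u : Mink) :
    u = (det3 a b c)⁻¹ • (mform u a • mcross b c + mform u b • mcross c a +
      mform u c • mcross a b) := by
  rw [← sub_eq_zero]
  apply eq_zero_of_mform_triple h <;>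
  · simp only [mform_sub_left, mform_add_left, mform_smul_left, mform_mcross, det3_self_mid,
      det3_self_right, det3_rotate a b c, det3_rotate' a b c]
    field_simp
    ring

omit [DecidableEq ι] in
/-- The functionals below the heights that are bounded below at an interior point form a compact
set. -/
theorem isCompact_below (hspan : ∃ i j k, det3 (pos i) (pos j) (pos k) ≠ 0) {c : ι → ℝ}
    (hc : ∀ a, 0 < c a) (m : ℝ) :
    IsCompact {u | Below pos h u ∧ m ≤ mform u (∑ a, c a • pos a)} := by
  obtain ⟨i, j, k, hd⟩ := hspan
  set M := ∑ a, c a * h a - m with hM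
  set F : ℝ × ℝ × ℝ → Mink := fun x => (det3 (pos i) (pos j) (pos k))⁻¹ •
    (x.1 • mcross (pos j) (pos k) + x.2.1 • mcross (pos k) (pos i) +
      x.2.2 • mcross (pos i) (pos j)) with hF
  have hFc : Continuous F := by fun_prop
  have hK : IsCompact (F '' (Set.Icc (h i - M / c i) (h i) ×ˢ
      (Set.Icc (h j - M / c j) (h j) ×ˢ Set.Icc (h k - M / c k) (h k)))) :=
    (isCompact_Icc.prod (isCompact_Icc.prod isCompact_Icc)).image hFc
  have hcont : ∀ y : Mink, Continuous fun u : Mink => mform u y := by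
    intro y; unfold mform; fun_prop
  refine hK.of_isClosed_subset ?_ ?_
  · have : {u | Below pos h u ∧ m ≤ mform u (∑ a, c a • pos a)} =
        (⋂ a, {u | mform u (pos a) ≤ h a}) ∩ {u | m ≤ mform u (∑ a, c a • pos a)} := by
      ext u
      simp [Below]
    rw [this]
    exact (isClosed_iInter fun a => isClosed_le (hcont _) continuous_const).inter
      (isClosed_le continuous_const (hcont _))
  · rintro u ⟨hu, hm⟩
    -- The weighted slacks are nonnegative with sum at most `M`, so each is at most `M`; the bounds
    -- at three independent points confine `u`.
    have hb : ∀ a, mform u (pos a) ∈ Set.Icc (h a - M / c a) (h a) := by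
      intro a
      refine ⟨?_, hu a⟩
      have h1 : c a * (h a - mform u (pos a)) ≤ ∑ b, c b * (h b - mform u (pos b)) :=
        Finset.single_le_sum (f := fun b => c b * (h b - mform u (pos b)))
          (fun b _ => mul_nonneg (hc b).le (sub_nonneg.2 (hu b))) (Finset.mem_univ a)
      have h2 : ∑ b, c b * (h b - mform u (pos b)) ≤ M := by
        rw [mform_sum_right] at hm
        simp only [mform_smul_right] at hm
        simp only [mul_sub, Finset.sum_sub_distrib]
        linarith
      rw [sub_le_comm, le_div_iff₀ (hc a)]
      linarith
    exact ⟨(mform u (pos i), mform u (pos j), mform u (pos k)), ⟨hb i, hb j, hb k⟩,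
      (eq_of_mform_triple hd u).symm⟩

/-- The lower hull covers the interior of the cone. -/
theorem exists_lowerFace_of_pos (hgen : GenericHeights pos h)
    (hspan : ∃ i j k, det3 (pos i) (pos j) (pos k) ≠ 0) {u₀ : Mink} (hu₀ : Below pos h u₀)
    {c : ι → ℝ} (hc : ∀ a, 0 < c a) :
    ∃ σ : Finset ι, σ.card = 3 ∧ LinearIndependent ℝ (fun a : σ => pos a) ∧
      IsLowerFace pos h σ ∧ ∑ a, c a • pos a ∈ cone pos σ := by
  set x := ∑ a, c a • pos a with hx
  set K := {u | Below pos h u ∧ mform u₀ x ≤ mform u x} with hKd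
  have hK : IsCompact K := isCompact_below hspan hc _
  have hcont : Continuous fun u : Mink => mform u x := by unfold mform; fun_prop
  obtain ⟨u₁, hu₁, hmax⟩ := hK.exists_isMaxOn ⟨u₀, hu₀, le_rfl⟩ hcont.continuousOn
  have hmax' : ∀ u, Below pos h u → mform u x ≤ mform u₁ x := by
    intro u hu
    by_cases h0 : mform u₀ x ≤ mform u x
    · exact hmax ⟨hu, h0⟩
    · exact (not_le.1 h0).le.trans hu₁.2
  have hM : IsCompact {u | Below pos h u ∧ mform u₁ x ≤ mform u x} := isCompact_below hspan hc _
  -- Linear programming: `u` is an extreme point of the set of maximizers at `x`. Its active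
  -- constraints are independent by genericity, and they span by extremality.
  obtain ⟨u, hu⟩ := hM.extremePoints_nonempty ⟨u₁, hu₁.1, le_rfl⟩
  obtain ⟨⟨hub, hux⟩, hext⟩ := mem_extremePoints.1 hu
  have hux' : mform u x = mform u₁ x := le_antisymm (hmax' u hub) hux
  set A : Finset ι := Finset.univ.filter fun a => mform u (pos a) = h a with hA
  have hAm : ∀ a, a ∈ A ↔ mform u (pos a) = h a := fun a => by simp [hA]
  have hfeas : ∀ y, (∀ a ∈ A, mform y (pos a) ≤ 0) →
      ∀ᶠ ε in 𝓝[>] (0 : ℝ), Below pos h (u + ε • y) := by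
    intro y hy
    unfold Below
    rw [Filter.eventually_all]
    intro a
    by_cases ha : a ∈ A
    · filter_upwards [self_mem_nhdsWithin] with ε hε
      have hε' : (0 : ℝ) < ε := hε
      rw [mform_add_left, mform_smul_left, (hAm a).1 ha]
      nlinarith [hy a ha]
    · have h1 : mform u (pos a) < h a := lt_of_le_of_ne (hub a) fun h0 => ha ((hAm a).2 h0)
      have h2 : Continuous fun ε : ℝ => mform (u + ε • y) (pos a) := by
        simp only [mform_add_left, mform_smul_left]; fun_prop
      have h3 := h2.tendsto 0
      simp only [zero_smul, add_zero] at h3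
      filter_upwards [(h3.mono_left nhdsWithin_le_nhds).eventually (gt_mem_nhds h1)]
        with ε hε using hε.le
  have hopt : ∀ y, (∀ a ∈ A, mform y (pos a) ≤ 0) → mform y x ≤ 0 := by
    intro y hy
    obtain ⟨ε, h1, h2⟩ := ((hfeas y hy).and self_mem_nhdsWithin).exists
    have h2' : (0 : ℝ) < ε := h2
    have h3 := hmax' _ h1
    rw [mform_add_left, mform_smul_left, hux'] at h3
    by_contra! hcon
    linarith [mul_pos h2' hcon]
  have hind : LinearIndependent ℝ (fun a : A => pos a) :=
    hgen A ⟨u, fun a ha => (hAm a).1 ha⟩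
  -- Otherwise `u` could move both ways along `y` among the maximizers.
  have hzero : ∀ y, (∀ a ∈ A, mform y (pos a) = 0) → y = 0 := by
    intro y hy
    have hy' : ∀ a ∈ A, mform (-y) (pos a) ≤ 0 := fun a ha => by
      rw [mform_neg_left, hy a ha, neg_zero]
    have h1 := hopt y fun a ha => (hy a ha).le
    have h2 := hopt (-y) hy'
    rw [mform_neg_left] at h2
    have hyx : mform y x = 0 := by linarith
    obtain ⟨ε, ⟨e1, e2⟩, e3⟩ := (((hfeas y fun a ha => (hy a ha).le).and (hfeas (-y) hy')).and
      self_mem_nhdsWithin).exists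
    have e3' : (0 : ℝ) < ε := e3
    have hmem1 : u + ε • y ∈ {u | Below pos h u ∧ mform u₁ x ≤ mform u x} := by
      refine ⟨e1, ?_⟩
      rw [mform_add_left, mform_smul_left, hyx, hux', mul_zero, add_zero]
    have hmem2 : u + ε • (-y) ∈ {u | Below pos h u ∧ mform u₁ x ≤ mform u x} := by
      refine ⟨e2, ?_⟩
      rw [mform_add_left, mform_smul_left, mform_neg_left, hyx, hux', neg_zero, mul_zero, add_zero]
    have := (hext _ hmem1 _ hmem2 ⟨1 / 2, 1 / 2, by norm_num, by norm_num, by norm_num, by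
      module⟩).1
    rw [add_eq_left, smul_eq_zero] at this
    exact this.resolve_left e3'.ne'
  have hcard : A.card = 3 := by
    apply le_antisymm
    · have := hind.fintype_card_le_finrank
      simpa using this
    · set φ : Mink →ₗ[ℝ] (A → ℝ) := LinearMap.pi fun a : A => mformL (pos a) with hφ
      have hinj : Function.Injective φ := by
        rw [← LinearMap.ker_eq_bot, LinearMap.ker_eq_bot']
        intro y hy
        refine hzero y fun a ha => ?_
        have := congrFun hy ⟨a, ha⟩
        rw [mform_comm]
        simpa [hφ] using this
      have := LinearMap.finrank_le_finrank_of_injective hinj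
      simpa using this
  refine ⟨A, hcard, hind, ⟨u, fun a ha => (hAm a).1 ha, fun a ha =>
    lt_of_le_of_ne (hub a) fun h0 => ha ((hAm a).2 h0)⟩, ?_⟩
  obtain ⟨a, b, d, hab, had, hbd, hA3⟩ := Finset.card_eq_three.1 hcard
  have hD : det3 (pos a) (pos b) (pos d) ≠ 0 :=
    det3_ne_zero_of_linearIndependent hind (by simp [hA3]) (by simp [hA3]) (by simp [hA3])
      hab had hbd
  rw [hA3, mem_cone_triple hD]
  -- Optimality as in Farkas' lemma: testing on the negated dual basis of the three active points
  -- shows that the coordinates of `x` are nonnegative.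
  have key : ∀ y : Mink, mform y (pos a) ≤ 0 → mform y (pos b) ≤ 0 → mform y (pos d) ≤ 0 →
      mform y x ≤ 0 := by
    intro y h1 h2 h3
    refine hopt y fun e he => ?_
    rw [hA3] at he
    simp only [Finset.mem_insert, Finset.mem_singleton] at he
    rcases he with rfl | rfl | rfl <;> assumption
  have hxc := cramer' hD x
  refine ⟨?_, ?_, ?_⟩
  · obtain ⟨y, h1, h2, h3⟩ := exists_mform_triple hD (-1) 0 0
    have := key y (by linarith) h2.le h3.le
    rw [hxc] at this
    simp only [mform_add_right, mform_smul_right, h1, h2, h3] at this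
    linarith
  · obtain ⟨y, h1, h2, h3⟩ := exists_mform_triple hD 0 (-1) 0
    have := key y h1.le (by linarith) h3.le
    rw [hxc] at this
    simp only [mform_add_right, mform_smul_right, h1, h2, h3] at this
    linarith
  · obtain ⟨y, h1, h2, h3⟩ := exists_mform_triple hD 0 0 (-1)
    have := key y h1.le h2.le (by linarith)
    rw [hxc] at this
    simp only [mform_add_right, mform_smul_right, h1, h2, h3] at this
    linarith

/-- The lower hull covers the cone. -/
theorem exists_lowerFace (hgen : GenericHeights pos h)
    (hspan : ∃ i j k, det3 (pos i) (pos j) (pos k) ≠ 0) {u₀ : Mink} (hu₀ : Below pos h u₀)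
    {x : Mink} (hx : x ∈ cone pos Finset.univ) :
    ∃ σ : Finset ι, σ.card = 3 ∧ LinearIndependent ℝ (fun a : σ => pos a) ∧
      IsLowerFace pos h σ ∧ x ∈ cone pos σ := by
  obtain ⟨c, hc, rfl⟩ := hx
  -- Adding ε to all weights makes them positive. One of the finitely many faces works for
  -- arbitrarily small ε, and its cone is closed.
  have hex : ∀ ε : ℝ, 0 < ε → ∃ σ : Finset ι, (σ.card = 3 ∧
      LinearIndependent ℝ (fun a : σ => pos a) ∧ IsLowerFace pos h σ) ∧
      (∑ a, c a • pos a) + ε • ∑ a, pos a ∈ cone pos σ := by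
    intro ε hε
    obtain ⟨σ, h1, h2, h3, h4⟩ := exists_lowerFace_of_pos hgen hspan hu₀ (c := fun a => c a + ε)
      fun a => add_pos_of_nonneg_of_pos (hc a (Finset.mem_univ a)) hε
    refine ⟨σ, ⟨h1, h2, h3⟩, ?_⟩
    simpa only [add_smul, Finset.sum_add_distrib, ← Finset.smul_sum] using h4
  obtain ⟨σ, hσ, hf⟩ : ∃ σ : Finset ι, (σ.card = 3 ∧
      LinearIndependent ℝ (fun a : σ => pos a) ∧ IsLowerFace pos h σ) ∧
      ∃ᶠ ε in 𝓝[>] (0 : ℝ), (∑ a, c a • pos a) + ε • ∑ a, pos a ∈ cone pos σ := by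
    by_contra! hcon
    have hall : ∀ᶠ ε in 𝓝[>] (0 : ℝ), ∀ σ : Finset ι, (σ.card = 3 ∧
        LinearIndependent ℝ (fun a : σ => pos a) ∧ IsLowerFace pos h σ) →
        (∑ a, c a • pos a) + ε • ∑ a, pos a ∉ cone pos σ := by
      simp only [Filter.eventually_all]
      exact hcon
    obtain ⟨ε, h1, h2⟩ := (hall.and self_mem_nhdsWithin).exists
    obtain ⟨σ, h3, h4⟩ := hex ε h2
    exact h1 σ h3 h4
  refine ⟨σ, hσ.1, hσ.2.1, hσ.2.2, ?_⟩
  have hcl : IsClosed (cone pos σ) := by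
    obtain ⟨a, b, d, hab, had, hbd, rfl⟩ := Finset.card_eq_three.1 hσ.1
    exact isClosed_cone_triple (det3_ne_zero_of_linearIndependent hσ.2.1 (by simp) (by simp)
      (by simp) hab had hbd)
  have hcont : Tendsto (fun ε : ℝ => (∑ a, c a • pos a) + ε • ∑ a, pos a) (𝓝[>] 0)
      (𝓝 (∑ a, c a • pos a)) := by
    have : Continuous fun ε : ℝ => (∑ a, c a • pos a) + ε • ∑ a, pos a := by fun_prop
    have := this.tendsto 0
    simp only [zero_smul, add_zero] at this
    exact this.mono_left nhdsWithin_le_nhds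
  exact hcl.mem_of_frequently_of_tendsto hf hcont

omit [Fintype ι] in
/-- Two faces of the lower hull meet along a common face. -/
theorem cone_inter_of_isLowerFace {σ τ : Finset ι} (hσ : IsLowerFace pos h σ)
    (hτ : IsLowerFace pos h τ) {x : Mink} (h1 : x ∈ cone pos σ) (h2 : x ∈ cone pos τ) :
    x ∈ cone pos (σ ∩ τ) := by
  obtain ⟨u, hu, hu'⟩ := hσ
  obtain ⟨v, hv, hv'⟩ := hτ
  have hle : ∀ a, mform u (pos a) ≤ h a := fun a => by
    by_cases ha : a ∈ σ
    · exact (hu a ha).le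
    · exact (hu' a ha).le
  have hle' : ∀ a, mform v (pos a) ≤ h a := fun a => by
    by_cases ha : a ∈ τ
    · exact (hv a ha).le
    · exact (hv' a ha).le
  obtain ⟨c, hc, hxc⟩ := h1
  obtain ⟨d, hd, hxd⟩ := h2
  -- Complementary slackness: the slacks of `v` on σ, weighted by the coordinates of `x`, sum to ⟨u,
  -- x⟩ - ⟨v, x⟩ ≤ 0. So `x` has no weight on points of σ outside τ.
  have e1 : mform u x ≤ mform v x := by
    rw [hxd, mform_sum_right, mform_sum_right]
    refine Finset.sum_le_sum fun a ha => ?_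
    rw [mform_smul_right, mform_smul_right, hv a ha]
    exact mul_le_mul_of_nonneg_left (hle a) (hd a ha)
  have e2 : ∑ a ∈ σ, c a * (h a - mform v (pos a)) = 0 := by
    refine le_antisymm ?_ (Finset.sum_nonneg fun a ha =>
      mul_nonneg (hc a ha) (sub_nonneg.2 (hle' a)))
    have f1 : ∑ a ∈ σ, c a * h a = mform u x := by
      rw [hxc, mform_sum_right]
      exact Finset.sum_congr rfl fun a ha => by rw [mform_smul_right, hu a ha]
    have f2 : ∑ a ∈ σ, c a * mform v (pos a) = mform v x := by
      rw [hxc, mform_sum_right]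
      exact Finset.sum_congr rfl fun a ha => by rw [mform_smul_right]
    simp only [mul_sub, Finset.sum_sub_distrib]
    linarith
  rw [Finset.sum_eq_zero_iff_of_nonneg fun a ha =>
    mul_nonneg (hc a ha) (sub_nonneg.2 (hle' a))] at e2
  refine ⟨c, fun a ha => hc a (Finset.mem_inter.1 ha).1, ?_⟩
  rw [hxc]
  symm
  refine Finset.sum_subset Finset.inter_subset_left fun a ha hna => ?_
  have haτ : a ∉ τ := fun h0 => hna (Finset.mem_inter.2 ⟨ha, h0⟩)
  have := (mul_eq_zero.1 (e2 a ha)).resolve_right (sub_pos.2 (hv' a haτ)).ne'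
  rw [this, zero_smul]

end Lower

/-- A convex polygon with marked interior points has a geodesic triangulation. -/
theorem nonempty_triangulation {n q : ℕ} [NeZero n] {P : ConvexPolygon n} {w : Fin q → Mink}
    (hw : ∀ k, w k ∈ P.interior) (hinj : Function.Injective w) :
    Nonempty (Triangulation P w) := by
  classical
  have hmem := P.marked_mem hw
  obtain ⟨η, hη, hsep⟩ : ∃ η : ℝ, 0 < η ∧ ∀ a b, a ≠ b →
      1 + η < -mform (P.marked w a) (P.marked w b) := by
    have : ∀ᶠ η in 𝓝[>] (0 : ℝ), ∀ a b, a ≠ b →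
        1 + η < -mform (P.marked w a) (P.marked w b) := by
      simp only [Filter.eventually_all]
      intro a b hab
      have h1 := one_lt_neg_mform (hmem a) (hmem b) fun h => hab (P.marked_injective hw hinj h)
      filter_upwards [(tendsto_id.mono_left nhdsWithin_le_nhds :
        Tendsto id (𝓝[>] (0 : ℝ)) (𝓝 0)).eventually (gt_mem_nhds (sub_pos.2 h1))] with η hη
      simp only [id] at hη
      linarith
    obtain ⟨η, h1, h2⟩ := (this.and self_mem_nhdsWithin).exists
    exact ⟨η, h2, h1⟩
  obtain ⟨h, hgen, hneg, hh⟩ := exists_genericHeights (pos := P.marked w) hη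
  have hspan : ∃ i j k, det3 (P.marked w i) (P.marked w j) (P.marked w k) ≠ 0 := by
    obtain ⟨i, j, k, hd⟩ := P.exists_det3_vertex_ne_zero
    exact ⟨Sum.inl i, Sum.inl j, Sum.inl k, hd⟩
  -- A large vertical vector works, since time coordinates are at least 1.
  have hu₀ : Below (P.marked w) h ![0, 0, ∑ a, |h a|] := by
    intro a
    have h1 : |h a| ≤ ∑ b, |h b| :=
      Finset.single_le_sum (fun b _ => abs_nonneg (h b)) (Finset.mem_univ a)
    have h2 : 1 ≤ P.marked w a 2 := by
      have e1 := (hmem a).1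
      have e2 := (hmem a).2
      rw [mform] at e1
      nlinarith [sq_nonneg (P.marked w a 0), sq_nonneg (P.marked w a 1)]
    have h3 : mform ![0, 0, ∑ a, |h a|] (P.marked w a) = -((∑ a, |h a|) * P.marked w a 2) := by
      simp [mform]
    rw [h3]
    nlinarith [neg_abs_le (h a), abs_nonneg (h a)]
  have hcov : ∀ x : Mink, (∀ i, mform (P.edgeDual i) x ≤ 0) → ∃ σ : Finset (Fin n ⊕ Fin q),
      σ.card = 3 ∧ LinearIndependent ℝ (fun a : σ => P.marked w a) ∧
      IsLowerFace (P.marked w) h σ ∧ x ∈ cone (P.marked w) σ := by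
    intro x hx
    refine exists_lowerFace hgen hspan hu₀ ?_
    obtain ⟨c, hc, rfl⟩ := P.mem_cone_vertex hx
    refine ⟨Sum.elim c 0, ?_, ?_⟩
    · rintro (j | k) -
      · exact hc j (Finset.mem_univ j)
      · exact le_rfl
    · simp [Fintype.sum_sum_type]
  refine ⟨{ faces := Finset.univ.filter fun σ => σ.card = 3 ∧
              LinearIndependent ℝ (fun a : σ => P.marked w a) ∧ IsLowerFace (P.marked w) h σ
            card_eq := fun σ hσ => (Finset.mem_filter.1 hσ).2.1
            nondegenerate := fun σ hσ => (Finset.mem_filter.1 hσ).2.2.1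
            vertex_used := ?_
            cover := ?_
            inter := ?_ }⟩
  · intro a
    obtain ⟨σ, h1, h2, h3, h4⟩ := hcov (P.marked w a)
      fun i => P.mform_edgeDual_marked_nonpos hw i a
    refine ⟨σ, by simp [h1, h2, h3], ?_⟩
    -- If `a` is a combination of other points with weights c, pairing with `a` gives (1 + η) ∑ c ≤
    -- 1. The heights are negative and agree up to the factor 1 + η, so the interpolated height at
    -- `a` is at least `h a`, contrary to `u` being strictly below there.
    by_contra ha
    obtain ⟨u, hu, hu'⟩ := h3
    obtain ⟨c, hc, hac⟩ := h4
    have e1 : (1 + η) * ∑ b ∈ σ, c b ≤ 1 := by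
      have := congrArg (mform (P.marked w a)) hac
      rw [(hmem a).1, mform_sum_right] at this
      simp only [mform_smul_right] at this
      have h5 : ∑ b ∈ σ, c b * (1 + η) ≤ ∑ b ∈ σ, -(c b * mform (P.marked w a) (P.marked w b)) :=
        Finset.sum_le_sum fun b hb => by
          have := hsep a b (by rintro rfl; exact ha hb)
          nlinarith [hc b hb]
      rw [Finset.sum_neg_distrib, ← this, ← Finset.sum_mul] at h5
      linarith
    have e2 : mform u (P.marked w a) = ∑ b ∈ σ, c b * h b := by
      conv_lhs => rw [hac]
      rw [mform_sum_right]
      exact Finset.sum_congr rfl fun b hb => by rw [mform_smul_right, hu b hb]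
    have e3 : ∑ b ∈ σ, c b * ((1 + η) * h a) ≤ ∑ b ∈ σ, c b * h b :=
      Finset.sum_le_sum fun b hb => mul_le_mul_of_nonneg_left (hh a b).le (hc b hb)
    rw [← Finset.sum_mul] at e3
    have e4 := hu' a ha
    nlinarith [hneg a]
  · ext x
    simp only [Set.mem_iUnion, Finset.mem_filter, Finset.mem_univ, true_and]
    constructor
    · rintro ⟨σ, -, hx1, hx2⟩
      exact P.mem_carrier_iff.2 ⟨hx1, Triangulation.nonpos_of_mem_cone hw hx2⟩
    · intro hx
      obtain ⟨hx1, hx2⟩ := P.mem_carrier_iff.1 hx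
      obtain ⟨σ, h1, h2, h3, h4⟩ := hcov x hx2
      exact ⟨σ, ⟨h1, h2, h3⟩, hx1, h4⟩
  · intro σ hσ τ hτ
    simp only [geodesicHull_eq]
    have h1 := (Finset.mem_filter.1 hσ).2.2.2
    have h2 := (Finset.mem_filter.1 hτ).2.2.2
    ext x
    constructor
    · rintro ⟨⟨hx, hx1⟩, ⟨-, hx2⟩⟩
      refine ⟨hx, ?_⟩
      convert cone_inter_of_isLowerFace h1 h2 hx1 hx2
    · rintro ⟨hx, hx1⟩
      exact ⟨⟨hx, cone_mono Finset.inter_subset_left hx1⟩,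
        ⟨hx, cone_mono Finset.inter_subset_right hx1⟩⟩

end HypPolygon

end

theorem theorem1p17 (n q : ℕ) [NeZero n] (P : ConvexPolygon n) (w : Fin q → Mink)
    (hw : ∀ k, w k ∈ P.interior) (hw_inj : Function.Injective w) :
    Nonempty (Triangulation P w) ∧
    ∀ T : Triangulation P w, ∀ (l' α' : Fin n → ℝ) (θ' : Fin q → ℝ),
      ((∃ D : ConeDeformation T, D.Realizes l' α' θ') ↔
        ∑ i, l' i • P.edgeDual i + ∑ j, α' j • P.vertex j - ∑ k, θ' k • w k = 0) ∧
      ∀ D₁ D₂ : ConeDeformation T, D₁.Realizes l' α' θ' →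
        (D₂.Realizes l' α' θ' ↔ T.IsTrivial (D₂.velocity - D₁.velocity)) := by
  exact ⟨nonempty_triangulation hw hw_inj, fun T l' α' θ' =>
    ⟨realizable_iff T hw hw_inj l' α' θ', fun D₁ D₂ h =>
      realizes_iff_isTrivial_sub hw hw_inj h D₂⟩⟩
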